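/- **Theorem 5.9 (Lietz, S.).** The following is a theorem of $\mathsf{ZF}$ (the Axiom of Choice is not assumed); that is, it holds in every model of $\mathsf{ZF}$, all notions being evaluated in that model. Let $\lambda$ be an ordinal, let $\lambda^+$ be the least ordinal that does not inject into $\lambda$, and let $j:V_{\lambda^+}\to V_{\lambda^+}$ be an elementary embedding (with respect to $\in$) which has a critical point $\kappa_0$ (the least ordinal moved up by $j$) and such that $\lambda=\kappa_\omega(j)=\sup_{n<\omega}\kappa_n$, where $\kappa_{n+1}=j(\kappa_n)$. Then for each $n<\omega$ there is a limit ordinal $\delta<\lambda^+$ such that $j``\delta\subseteq\delta$ and $k=j\restriction V_\delta$ is a $\Sigma_1$-elementary map $V_\delta\to V_\delta$, but none of the iterates $k_0,k_1,\ldots,k_n$ is a $\Sigma_2$-elementary map $V_\delta\to V_\delta$. Here, for $X\subseteq V_\delta$, $k^+(X)=\bigcup_{\alpha<\delta}k(X\cap V_\alpha)$, and the iterates of $k$ are defined by $k_0=k$ and $k_{m+1}=k^+(k_m)$ (maps being identified with their graphs). $\Sigma_0$ ($=\Pi_0$) formulas are the formulas of the language of set theory all of whose quantifiers are bounded, $\Sigma_{m+1}$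 formulas are obtained from $\Pi_m$ formulas by prefixing finitely many existential quantifiers, $\Pi_{m+1}$ formulas are the negations of $\Sigma_{m+1}$ formulas, and a map is $\Sigma_m$-elementary if it preserves the truth of all $\Sigma_m$ formulas in both directions. -/

import Mathlib

namespace RankToRank

/-- The relation symbols of the language of set theory: one binary symbol. -/
inductive MemRel : ℕ → Type
  | mem : MemRel 2

/-- The first-order language of set theory. -/
def setLang : FirstOrder.Language.{0, 0} := ⟨fun _ => Empty, MemRel⟩

section Model

variable {M : Type*} [setLang.Structure M]

/-- The membership relation of the structure `M`. -/
def Mem (x y : M) : Prop := FirstOrder.Language.Structure.RelMap (L := setLang) MemRel.mem ![x, y]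

infix:50 " ∈ₘ " => Mem

/-! ### Basic set-theoretic notions, evaluated in the structure `M`

Everything from here on is a first-order property over `M`, i.e. all quantifiers range over
`M`; the definitions are the relativizations to `M` of the usual definitions in ZF. -/

/-- `x ⊆ y`. -/
def IsSubset (x y : M) : Prop := ∀ z, z ∈ₘ x → z ∈ₘ y

/-- `x = ∅`. -/
def IsEmp (x : M) : Prop := ∀ z, ¬ z ∈ₘ x

/-- `y = x ∪ {x}`. -/
def IsSucc (x y : M) : Prop := ∀ z, z ∈ₘ y ↔ z ∈ₘ x ∨ z = x

/-- `p = {x, y}`. -/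
def IsUPair (x y p : M) : Prop := ∀ z, z ∈ₘ p ↔ z = x ∨ z = y

/-- `p = (x, y) = {{x}, {x, y}}`. -/
def IsOPair (x y p : M) : Prop := ∃ a b, IsUPair x x a ∧ IsUPair x y b ∧ IsUPair a b p

/-- `(x, y) ∈ f`; when `f` is a function this says `f(x) = y`. -/
def App (f x y : M) : Prop := ∃ p, IsOPair x y p ∧ p ∈ₘ f

/-- `f` is a function with domain `a`. -/
def IsFunOn (f a : M) : Prop :=
  (∀ p, p ∈ₘ f → ∃ x y, x ∈ₘ a ∧ IsOPair x y p) ∧ ∀ x, x ∈ₘ a → ∃! y, App f x y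

/-- `f : a → b`. -/
def IsFun (f a b : M) : Prop := IsFunOn f a ∧ ∀ x y, App f x y → y ∈ₘ b

variable (M) in
/-- `M` is a model of ZF (without Choice). In Separation and Collection, `φ` ranges over all
formulas of the language of set theory, with parameters `p` from `M`. -/
structure IsModelZF : Prop where
  extensionality : ∀ x y : M, (∀ z, z ∈ₘ x ↔ z ∈ₘ y) → x = y
  foundation : ∀ x : M, (∃ y, y ∈ₘ x) → ∃ y, y ∈ₘ x ∧ ∀ z, z ∈ₘ y → ¬ z ∈ₘ x
  pairing : ∀ x y : M, ∃ p, IsUPair x y p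
  union : ∀ x : M, ∃ u, ∀ z, z ∈ₘ u ↔ ∃ y, y ∈ₘ x ∧ z ∈ₘ y
  powerset : ∀ x : M, ∃ u, ∀ z, z ∈ₘ u ↔ IsSubset z x
  infinity : ∃ w : M, (∃ e, IsEmp e ∧ e ∈ₘ w) ∧ ∀ x, x ∈ₘ w → ∃ y, IsSucc x y ∧ y ∈ₘ w
  separation : ∀ (n : ℕ) (φ : setLang.Formula (Fin (n + 1))) (p : Fin n → M) (a : M),
    ∃ b, ∀ x, x ∈ₘ b ↔ x ∈ₘ a ∧ φ.Realize (Fin.cons x p : Fin (n + 1) → M)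
  collection : ∀ (n : ℕ) (φ : setLang.Formula (Fin (n + 2))) (p : Fin n → M) (a : M),
    (∀ x, x ∈ₘ a → ∃ y, φ.Realize (Fin.cons x (Fin.cons y p) : Fin (n + 2) → M)) →
    ∃ b, ∀ x, x ∈ₘ a →
      ∃ y, y ∈ₘ b ∧ φ.Realize (Fin.cons x (Fin.cons y p) : Fin (n + 2) → M)

/-! ### Ordinals and the cumulative hierarchy -/

/-- `x` is an ordinal: transitive and linearly ordered by membership. -/
def IsOrd (x : M) : Prop :=
  (∀ y, y ∈ₘ x → IsSubset y x) ∧ ∀ y z, y ∈ₘ x → z ∈ₘ x → y ∈ₘ z ∨ y = z ∨ z ∈ₘ y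

/-- `x` is a (nonzero) limit ordinal. -/
def IsLimit (x : M) : Prop :=
  IsOrd x ∧ (∃ y, y ∈ₘ x) ∧ ∀ y, y ∈ₘ x → ∃ z, z ∈ₘ x ∧ y ∈ₘ z

/-- `w = ω`, the least limit ordinal. -/
def IsOmega (w : M) : Prop := IsLimit w ∧ ∀ x, x ∈ₘ w → ¬ IsLimit x

/-- `i ∈ ω`, in the sense of `M`. -/
def IsNat (i : M) : Prop := ∃ w, IsOmega w ∧ i ∈ₘ w

/-- There is an injection from `x` into `y`. -/
def Injects (x y : M) : Prop :=
  ∃ f, IsFun f x y ∧ ∀ a b c, App f a c → App f b c → a = b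

/-- `m = l⁺`: `l` and `m` are ordinals and `m` is the least ordinal that does not inject
into `l`, i.e. the least cardinal greater than `l`. -/
def IsSuccCard (l m : M) : Prop :=
  IsOrd l ∧ IsOrd m ∧ ¬ Injects m l ∧ ∀ a, a ∈ₘ m → Injects a l

/-- `v = V_a`: `a` is an ordinal, and there is a function `f` on `a + 1` with `f(a) = v` and
`f(b) = ⋃_{c < b} 𝒫(f(c))` for all `b ≤ a`. (The recursion gives `V_0 = ∅`,
`V_{b+1} = 𝒫(V_b)`, and unions at limits.) -/
def IsRank (a v : M) : Prop :=
  IsOrd a ∧ ∃ f s, IsSucc a s ∧ IsFunOn f s ∧ App f a v ∧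
    ∀ b u, b ∈ₘ s → App f b u →
      ∀ z, z ∈ₘ u ↔ ∃ c w, c ∈ₘ b ∧ App f c w ∧ IsSubset z w

/-! ### Codes for formulas, as elements of `M`

The formulas of the object language are sets of `M`, with variables `x_i` for `i ∈ ω` (in the
sense of `M`), and primitives `∈, =, ¬, ∧, ∃`. -/

/-- `x` is the numeral `n` of `M`. -/
def IsNumeral : ℕ → M → Prop
  | 0, x => IsEmp x
  | n + 1, x => ∃ y, IsNumeral n y ∧ IsSucc y x

/-- `c = (n, (x, y))`. -/
def IsTagged (n : ℕ) (x y c : M) : Prop :=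
  ∃ t p, IsNumeral n t ∧ IsOPair x y p ∧ IsOPair t p c

/-- `c` is the formula `x_i ∈ x_k`. -/
def IsMemCode (i k c : M) : Prop := IsTagged 0 i k c

/-- `c` is the formula `x_i = x_k`. -/
def IsEqCode (i k c : M) : Prop := IsTagged 1 i k c

/-- `c` is the formula `¬ a`. -/
def IsNegCode (a c : M) : Prop := IsTagged 2 a a c

/-- `c` is the formula `a ∧ b`. -/
def IsAndCode (a b c : M) : Prop := IsTagged 3 a b c

/-- `c` is the formula `∃ x_i, a`. -/
def IsExCode (i a c : M) : Prop := IsTagged 4 i a c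

/-- `c` is the formula `∃ x_i ∈ x_k, a`, that is, `∃ x_i, (x_i ∈ x_k ∧ a)`. -/
def IsBddExCode (i k a c : M) : Prop :=
  ∃ m b, IsMemCode i k m ∧ IsAndCode m a b ∧ IsExCode i b c

/-- The set `X` contains all atomic formulas and is closed under `¬` and `∧`. -/
def BoolClosed (X : M) : Prop :=
  (∀ i k c, IsNat i → IsNat k → IsMemCode i k c → c ∈ₘ X) ∧
  (∀ i k c, IsNat i → IsNat k → IsEqCode i k c → c ∈ₘ X) ∧
  (∀ a c, a ∈ₘ X → IsNegCode a c → c ∈ₘ X) ∧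
  (∀ a b c, a ∈ₘ X → b ∈ₘ X → IsAndCode a b c → c ∈ₘ X)

/-- `c` is a formula of the language of set theory. -/
def IsFormula (c : M) : Prop :=
  ∀ X, BoolClosed X →
    (∀ i a b, IsNat i → a ∈ₘ X → IsExCode i a b → b ∈ₘ X) → c ∈ₘ X

/-- `c` is a `Σ₀` formula: all quantifiers are bounded. -/
def IsSigma0 (c : M) : Prop :=
  ∀ X, BoolClosed X →
    (∀ i k a b, IsNat i → IsNat k → i ≠ k → a ∈ₘ X → IsBddExCode i k a b → b ∈ₘ X) → c ∈ₘ X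

/-- `c` is obtained from a formula with the property `P` by prefixing finitely many (possibly
no) existential quantifiers. -/
def ExClosure (P : M → Prop) (c : M) : Prop :=
  ∀ X, (∀ a, P a → a ∈ₘ X) →
    (∀ i a b, IsNat i → a ∈ₘ X → IsExCode i a b → b ∈ₘ X) → c ∈ₘ X

/-- `c` is a `Σ₁` formula (recall `Π₀ = Σ₀`). -/
def IsSigma1 (c : M) : Prop := ExClosure IsSigma0 c

/-- `c` is a `Π₁` formula: the negation of a `Σ₁` formula. -/
def IsPi1 (c : M) : Prop := ∃ a, IsSigma1 a ∧ IsNegCode a c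

/-- `c` is a `Σ₂` formula. -/
def IsSigma2 (c : M) : Prop := ExClosure IsPi1 c

/-! ### Satisfaction and elementarity -/

/-- `s` is an assignment of elements of `A` to the variables, i.e. `s : ω → A`. -/
def IsAssignment (s A : M) : Prop := ∃ w, IsOmega w ∧ IsFun s w A

/-- The assignments `s` and `t` agree except possibly at the variable `x_i`. -/
def AgreeOff (i s t : M) : Prop :=
  ∀ k, IsNat k → k ≠ i → ∀ x, App s k x ↔ App t k x

/-- `T` obeys Tarski's truth conditions for the structure `(A, ∈)`, where `(c, s) ∈ T` is read
as "the formula `c` is true in `(A, ∈)` under the assignment `s`". -/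
def IsTruthSet (A T : M) : Prop :=
  ∀ s, IsAssignment s A →
    (∀ i k c, IsNat i → IsNat k → IsMemCode i k c →
      (App T c s ↔ ∃ x y, App s i x ∧ App s k y ∧ x ∈ₘ y)) ∧
    (∀ i k c, IsNat i → IsNat k → IsEqCode i k c →
      (App T c s ↔ ∃ x, App s i x ∧ App s k x)) ∧
    (∀ a c, IsFormula a → IsNegCode a c → (App T c s ↔ ¬ App T a s)) ∧
    (∀ a b c, IsFormula a → IsFormula b → IsAndCode a b c →
      (App T c s ↔ App T a s ∧ App T b s)) ∧
    (∀ i a c, IsNat i → IsFormula a → IsExCode i a c →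
      (App T c s ↔ ∃ t, IsAssignment t A ∧ AgreeOff i s t ∧ App T a t))

/-- `(A, ∈) ⊨ c[s]`. -/
def Sat (A c s : M) : Prop := ∃ T, IsTruthSet A T ∧ App T c s

/-- `j : A → A` preserves, in both directions, the truth in `(A, ∈)` of all formulas with the
property `P`. -/
def PreservesOn (P : M → Prop) (A j : M) : Prop :=
  IsFun j A A ∧
    ∀ c s t, P c → IsAssignment s A → IsAssignment t A →
      (∀ i x y, App s i x → App j x y → App t i y) → (Sat A c s ↔ Sat A c t)

/-- `j ∈ ℰ(A)`: `j : (A, ∈) → (A, ∈)` is (fully) elementary. -/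
def IsElementary (A j : M) : Prop := PreservesOn IsFormula A j

/-- `j ∈ ℰ₁(A)`: `j : (A, ∈) → (A, ∈)` is `Σ₁`-elementary. -/
def IsSigma1Elementary (A j : M) : Prop := PreservesOn IsSigma1 A j

/-- `j ∈ ℰ₂(A)`: `j : (A, ∈) → (A, ∈)` is `Σ₂`-elementary. -/
def IsSigma2Elementary (A j : M) : Prop := PreservesOn IsSigma2 A j

/-! ### Critical sequence and iterates -/

/-- `j(a) > a`. -/
def MovesUp (j a : M) : Prop := ∃ b, App j a b ∧ a ∈ₘ b

/-- `c = crit(j)`, the least ordinal `a` with `j(a) > a`. -/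
def IsCrit (j c : M) : Prop := IsOrd c ∧ MovesUp j c ∧ ∀ a, a ∈ₘ c → ¬ MovesUp j a

/-- `l = κ_ω(j)`: there is a function `f` on `ω` with `f(0) = crit(j)`, `f(i+1) = j(f(i))`, and
`l = sup_i f(i)`. -/
def IsCritSup (j l : M) : Prop :=
  ∃ w f, IsOmega w ∧ IsFunOn f w ∧
    (∃ o c, IsEmp o ∧ App f o c ∧ IsCrit j c) ∧
    (∀ i i' x y, i ∈ₘ w → IsSucc i i' → App f i x → App f i' y → App j x y) ∧
    ∀ z, z ∈ₘ l ↔ ∃ i x, App f i x ∧ z ∈ₘ x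

/-- `j '' d ⊆ d`. -/
def ClosedUnder (j d : M) : Prop := ∀ a b, a ∈ₘ d → App j a b → b ∈ₘ d

/-- `k = j ↾ v`. -/
def IsRestriction (j v k : M) : Prop :=
  ∀ p, p ∈ₘ k ↔ p ∈ₘ j ∧ ∃ x y, x ∈ₘ v ∧ IsOPair x y p

/-- `Y = k⁺(X)`, where `k : V_d → V_d`, `X ⊆ V_d` and `k⁺(X) = ⋃_{a < d} k(X ∩ V_a)`. -/
def IsCanonicalExt (d k X Y : M) : Prop :=
  ∀ z, z ∈ₘ Y ↔ ∃ a v u y, a ∈ₘ d ∧ IsRank a v ∧ (∀ x, x ∈ₘ u ↔ x ∈ₘ X ∧ x ∈ₘ v) ∧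
    App k u y ∧ z ∈ₘ y

/-- `f` is the sequence `(k_i)_{i < ω}` of iterates of `k : V_d → V_d`: `k_0 = k` and
`k_{i+1} = k⁺(k_i)`. -/
def IsIterateSeq (d k f : M) : Prop :=
  ∃ w, IsOmega w ∧ IsFunOn f w ∧
    (∃ o, IsEmp o ∧ App f o k) ∧
    ∀ i i' x y, i ∈ₘ w → IsSucc i i' → App f i x → App f i' y → IsCanonicalExt d k x y

end Model

end RankToRank

open RankToRank

set_option linter.unusedSectionVars false

/-! The ordinal `δ` is the `κ_n`-th member of a tower of ordinals below `λ⁺`. Put `a_ζ = λ ∪ ⋃_{η<ζ}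
(j(a_η) + 1)` for `ζ < λ` and `δ = a_{κ_n}`. As `κ_n` is a limit, `δ` is a limit ordinal closed
under `j`, and `δ` is the supremum of the `a_ξ` with `ξ < κ_n`. To see without Choice that `a_ζ <
λ⁺`, the recursion builds partial surjections `e_ζ` from `λ` onto `a_ζ` along with the ordinals.
Since `j(λ) = λ`, the set `j(e_η)` is a partial surjection from `λ` onto `j(a_η)`, so `e_ζ` can be
assembled from the `j(e_η)` by a pairing function on `λ`, and nothing has to be chosen
(`RR.exists_pairing`, `RR.exists_tower`). The `e_ζ` increase with `ζ`.

`Σ₁`-elementarity of `k = j ↾ V_δ` needs only that `δ` is a limit closed under `j`: `j` is fully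
elementary from `V_b` to `V_{j(b)}` for every `b < δ`, and `Σ₁` truth in `V_δ` is the union of `Σ₁`
truth in the `V_b` (`RR.sat_J`, `RR.sigma1_restriction`).

The obstacle to `Σ₂`-elementarity is discontinuity at `κ_n`. The `κ_i` are regular, so `sup j''κ_i <
κ_{i+1} = j(κ_i)` and `k_0` is discontinuous at every `κ_i` (`RR.exists_bound_J`). Passing from
`k_m` to `k_{m+1} = k⁺(k_m)` moves a discontinuity at `κ_i` to one at `κ_{i+1}`
(`RR.discont_canonicalExt`). Hence `k_0, …, k_n` are all discontinuous at `κ_n`.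

Suppose `K : V_δ → V_δ` is discontinuous at `κ = κ_n` and `Σ₂`-elementary (`Tower.not_sigma2`). Let
`p ∈ V_δ` consist of all `(ξ, x, y)` with `ξ < κ` and `e_ξ(x) < e_ξ(y)`. In `V_δ` every section
`p_ξ` has a ranking into an ordinal, and this is a `Π₂` statement, so every section of `K(p)` below
`K(κ)` has one too. Take `η < K(κ)` above all `K(ξ)`, and a ranking of `K(p)_η` into some `b < δ`.
The sections increase, so `K(p)_η` contains every `K(p)_{K(ξ)}`, which is a copy of the order of
`K(a_ξ)`. Thus `b` bounds these order types. But `b < a_ξ ≤ K(a_ξ) < K(a_{ξ+1})` for some `ξ < κ`, a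
contradiction.

The model need not be well-founded or have only standard naturals. All inductions and recursions are
therefore carried out inside it, for predicates whose definability is supplied by the classes `Dfn`
and `DefFun`. The class `D0` recognises bounded formulas, the ones that elementary maps are shown to
preserve. -/

namespace RankToRank

open FirstOrder FirstOrder.Language

/-! ### First-order definability with parameters, as a type class. -/

section Definability

variable {M : Type*} [setLang.Structure M] {n : ℕ}

/-- `P` is first-order definable over `M`, with parameters. -/
class Dfn (P : (Fin n → M) → Prop) : Prop where
  out : ∃ ψ : setLang.Formula (Fin n ⊕ M), ∀ v, P v ↔ ψ.Realize (Sum.elim v id)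

/-- `t` is a function which is first-order definable over `M`, with parameters. -/
class DefFun (t : (Fin n → M) → M) : Prop where
  out : Dfn fun w : Fin (n + 1) → M => w (Fin.last n) = t fun i => w i.castSucc

namespace Dfn

theorem congr {P Q : (Fin n → M) → Prop} (hQ : Dfn Q) (h : ∀ v, P v ↔ Q v) : Dfn P :=
  ⟨hQ.out.imp fun _ hψ v => (h v).trans (hψ v)⟩

theorem of_terms_mem (s t : Fin n ⊕ M) :
    Dfn fun v : Fin n → M => Mem (Sum.elim v id s) (Sum.elim v id t) :=
  ⟨Relations.formula₂ (L := setLang) (show setLang.Relations 2 from MemRel.mem) (Term.var s)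
    (Term.var t), fun v => by rw [Formula.realize_rel₂]; rfl⟩

theorem of_terms_eq (s t : Fin n ⊕ M) :
    Dfn fun v : Fin n → M => Sum.elim v id s = Sum.elim v id t :=
  ⟨Term.equal (L := setLang) (Term.var s) (Term.var t), fun v => by
    rw [Formula.realize_equal]; rfl⟩

instance and {P Q : (Fin n → M) → Prop} [hP : Dfn P] [hQ : Dfn Q] :
    Dfn fun v => P v ∧ Q v := by
  obtain ⟨φ, hφ⟩ := hP.out
  obtain ⟨ψ, hψ⟩ := hQ.out
  exact ⟨φ ⊓ ψ, fun v => by rw [Formula.realize_inf, hφ, hψ]⟩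

instance not {P : (Fin n → M) → Prop} [hP : Dfn P] : Dfn fun v => ¬ P v := by
  obtain ⟨φ, hφ⟩ := hP.out
  exact ⟨∼φ, fun v => by rw [Formula.realize_not, hφ]⟩

instance or {P Q : (Fin n → M) → Prop} [Dfn P] [Dfn Q] : Dfn fun v => P v ∨ Q v :=
  congr (Q := fun v => ¬ (¬ P v ∧ ¬ Q v)) inferInstance fun v => by tauto

instance imp {P Q : (Fin n → M) → Prop} [Dfn P] [Dfn Q] : Dfn fun v => P v → Q v :=
  congr (Q := fun v => ¬ (P v ∧ ¬ Q v)) inferInstance fun v => by tauto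

instance iff {P Q : (Fin n → M) → Prop} [Dfn P] [Dfn Q] : Dfn fun v => P v ↔ Q v :=
  congr (Q := fun v => (P v → Q v) ∧ (Q v → P v)) inferInstance fun v => by tauto

theorem reindex {m : ℕ} {P : (Fin n → M) → Prop} (hP : Dfn P) (σ : Fin n → Fin m) :
    Dfn fun v : Fin m → M => P fun i => v (σ i) := by
  obtain ⟨φ, hφ⟩ := hP.out
  refine ⟨φ.relabel (Sum.map σ id), fun v => ?_⟩
  rw [Formula.realize_relabel, hφ]
  exact iff_of_eq (congrArg _ (by ext (x | x) <;> rfl))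

/-- The bound variable is the last coordinate of a longer tuple, so instance search can follow the
syntax of a predicate through its quantifiers. -/
instance ex {Q : (Fin n → M) → M → Prop}
    [h : Dfn fun w : Fin (n + 1) → M => Q (fun i => w i.castSucc) (w (Fin.last n))] :
    Dfn fun v => ∃ x, Q v x := by
  obtain ⟨φ, hφ⟩ := h.out
  let σ : Fin (n + 1) ⊕ M → (Fin n ⊕ M) ⊕ Fin 1 :=
    Sum.elim (Fin.lastCases (Sum.inr 0) fun i => Sum.inl (Sum.inl i)) fun c => Sum.inl (Sum.inr c)
  refine ⟨(φ.relabel σ).iExs (Fin 1), fun v => ?_⟩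
  rw [Formula.realize_iExs]
  constructor
  · rintro ⟨x, hx⟩
    refine ⟨fun _ => x, ?_⟩
    rw [Formula.realize_relabel]
    have := (hφ (Fin.snoc (α := fun _ => M) v x)).1 (by simpa using hx)
    convert this using 1
    ext (i | c)
    · refine Fin.lastCases ?_ (fun i => ?_) i <;> simp [σ]
    · simp [σ]
  · rintro ⟨x, hx⟩
    rw [Formula.realize_relabel] at hx
    have := (hφ (Fin.snoc (α := fun _ => M) v (x 0))).2 (by
      convert hx using 1
      ext (i | c)
      · refine Fin.lastCases ?_ (fun i => ?_) i <;> simp [σ]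
      · simp [σ])
    exact ⟨x 0, by simpa using this⟩

instance all {Q : (Fin n → M) → M → Prop}
    [Dfn fun w : Fin (n + 1) → M => Q (fun i => w i.castSucc) (w (Fin.last n))] :
    Dfn fun v => ∀ x, Q v x :=
  congr (Q := fun v => ¬ ∃ x, ¬ Q v x) inferInstance fun v => by simp

instance const (p : Prop) : Dfn fun _ : Fin n → M => p := by
  by_cases h : p
  · exact ⟨⊤, fun v => by simp [h]⟩
  · exact ⟨⊥, fun v => by simp [h]⟩

end Dfn

namespace DefFun

instance var (i : Fin n) : DefFun fun v : Fin n → M => v i :=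
  ⟨Dfn.of_terms_eq (Sum.inl _) (Sum.inl i.castSucc)⟩

instance const (c : M) : DefFun fun _ : Fin n → M => c :=
  ⟨Dfn.of_terms_eq (Sum.inl _) (Sum.inr c)⟩

end DefFun

/-- A term is eliminated through its graph: `P (a v)` says that some `x` equal to `a v` satisfies
`P`. The versions with more arguments repeat this for one argument after another. -/
theorem Dfn.comp_one {P : M → Prop} (hP : Dfn fun v : Fin 1 → M => P (v 0))
    {a : (Fin n → M) → M} [ha : DefFun a] : Dfn fun v => P (a v) := by
  have h : Dfn fun v : Fin n → M => ∃ x, x = a v ∧ P x := by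
    have := hP.reindex (fun _ => Fin.last n)
    have := ha.out
    exact Dfn.ex (Q := fun v x => x = a v ∧ P x)
  exact h.congr fun v => by simp

theorem DefFun.lift {t : (Fin n → M) → M} (ht : DefFun t) :
    DefFun fun w : Fin (n + 1) → M => t fun i => w i.castSucc :=
  ⟨(ht.out.reindex (Fin.lastCases (Fin.last (n + 1)) fun i => i.castSucc.castSucc)).congr
    fun v => by simp⟩

theorem Dfn.comp_two {P : M → M → Prop} (hP : Dfn fun v : Fin 2 → M => P (v 0) (v 1))
    {a b : (Fin n → M) → M} [ha : DefFun a] [hb : DefFun b] : Dfn fun v => P (a v) (b v) :=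
  congr (Q := fun v => ∃ y, y = b v ∧ ∃ x, x = a v ∧ P x y)
    (@ex _ _ _ _ (@and _ _ _ _ _ hb.out (@ex _ _ _ _ (@and _ _ _ _ _ ha.lift.out
      (hP.reindex ![Fin.last _, (Fin.last n).castSucc])))))
    fun v => by simp

theorem Dfn.comp_three {P : M → M → M → Prop}
    (hP : Dfn fun v : Fin 3 → M => P (v 0) (v 1) (v 2))
    {a b c : (Fin n → M) → M} [ha : DefFun a] [hb : DefFun b] [hc : DefFun c] :
    Dfn fun v => P (a v) (b v) (c v) :=
  congr (Q := fun v => ∃ z, z = c v ∧ ∃ y, y = b v ∧ ∃ x, x = a v ∧ P x y z)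
    (@ex _ _ _ _ (@and _ _ _ _ _ hc.out (@ex _ _ _ _ (@and _ _ _ _ _ hb.lift.out
      (@ex _ _ _ _ (@and _ _ _ _ _ ha.lift.lift.out
      (hP.reindex ![Fin.last _, (Fin.last _).castSucc, (Fin.last n).castSucc.castSucc])))))))
    fun v => by simp

theorem Dfn.comp_four {P : M → M → M → M → Prop}
    (hP : Dfn fun v : Fin 4 → M => P (v 0) (v 1) (v 2) (v 3))
    {a b c d : (Fin n → M) → M} [ha : DefFun a] [hb : DefFun b] [hc : DefFun c] [hd : DefFun d] :
    Dfn fun v => P (a v) (b v) (c v) (d v) :=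
  congr (Q := fun v => ∃ u, u = d v ∧ ∃ z, z = c v ∧ ∃ y, y = b v ∧ ∃ x, x = a v ∧ P x y z u)
    (@ex _ _ _ _ (@and _ _ _ _ _ hd.out (@ex _ _ _ _ (@and _ _ _ _ _ hc.lift.out
      (@ex _ _ _ _ (@and _ _ _ _ _ hb.lift.lift.out
      (@ex _ _ _ _ (@and _ _ _ _ _ ha.lift.lift.lift.out
      (hP.reindex ![Fin.last _, (Fin.last _).castSucc, (Fin.last _).castSucc.castSucc,
        (Fin.last n).castSucc.castSucc.castSucc])))))))))
    fun v => by simp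

instance Dfn.eq {a b : (Fin n → M) → M} [ha : DefFun a] [hb : DefFun b] :
    Dfn fun v => a v = b v :=
  Dfn.comp_two (P := fun x y => x = y) (Dfn.of_terms_eq (Sum.inl 0) (Sum.inl 1))

instance Dfn.mem {a b : (Fin n → M) → M} [ha : DefFun a] [hb : DefFun b] :
    Dfn fun v => Mem (a v) (b v) :=
  Dfn.comp_two (P := fun x y => Mem x y) (Dfn.of_terms_mem (Sum.inl 0) (Sum.inl 1))

instance Dfn.exUnique {Q : (Fin n → M) → M → Prop}
    [Dfn fun v => ∃ x, Q v x ∧ ∀ y, Q v y → y = x] : Dfn fun v => ∃! x, Q v x :=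
  Dfn.congr (Q := fun v => ∃ x, Q v x ∧ ∀ y, Q v y → y = x) inferInstance fun _ => Iff.rfl

theorem DefFun.comp_one {f : M → M} (hf : Dfn fun v : Fin 2 → M => v 1 = f (v 0))
    {a : (Fin n → M) → M} [ha : DefFun a] : DefFun fun v => f (a v) :=
  ⟨by
    have := ha.lift
    exact Dfn.comp_two (P := fun x y => y = f x) hf (a := fun w => a fun i => w i.castSucc)
      (b := fun w => w (Fin.last n))⟩

theorem DefFun.comp_two {f : M → M → M} (hf : Dfn fun v : Fin 3 → M => v 2 = f (v 0) (v 1))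
    {a b : (Fin n → M) → M} [ha : DefFun a] [hb : DefFun b] : DefFun fun v => f (a v) (b v) :=
  ⟨by
    have := ha.lift
    have := hb.lift
    exact Dfn.comp_three (P := fun x y z => z = f x y) hf (a := fun w => a fun i => w i.castSucc)
      (b := fun w => b fun i => w i.castSucc) (c := fun w => w (Fin.last n))⟩

theorem DefFun.comp_three {f : M → M → M → M}
    (hf : Dfn fun v : Fin 4 → M => v 3 = f (v 0) (v 1) (v 2))
    {a b c : (Fin n → M) → M} [ha : DefFun a] [hb : DefFun b] [hc : DefFun c] :
    DefFun fun v => f (a v) (b v) (c v) :=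
  ⟨by
    have := ha.lift
    have := hb.lift
    have := hc.lift
    exact Dfn.comp_four (P := fun x y z u => u = f x y z) hf
      (a := fun w => a fun i => w i.castSucc)
      (b := fun w => b fun i => w i.castSucc) (c := fun w => c fun i => w i.castSucc)
      (d := fun w => w (Fin.last n))⟩

end Definability

/-! ### Definability of the set-theoretic notions of the statement. -/

section Notions

variable {M : Type*} [setLang.Structure M] {n : ℕ} {a b c d : (Fin n → M) → M}
  [DefFun a] [DefFun b] [DefFun c] [DefFun d]

instance : Dfn fun v => IsSubset (a v) (b v) :=
  Dfn.comp_two (P := IsSubset) (by unfold IsSubset; infer_instance)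
instance : Dfn fun v => IsEmp (a v) :=
  Dfn.comp_one (P := IsEmp) (by unfold IsEmp; infer_instance)
instance : Dfn fun v => IsSucc (a v) (b v) :=
  Dfn.comp_two (P := IsSucc) (by unfold IsSucc; infer_instance)
instance : Dfn fun v => IsUPair (a v) (b v) (c v) :=
  Dfn.comp_three (P := IsUPair) (by unfold IsUPair; infer_instance)
instance : Dfn fun v => IsOPair (a v) (b v) (c v) :=
  Dfn.comp_three (P := IsOPair) (by unfold IsOPair; infer_instance)
instance : Dfn fun v => App (a v) (b v) (c v) :=
  Dfn.comp_three (P := App) (by unfold App; infer_instance)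
instance : Dfn fun v => IsFunOn (a v) (b v) :=
  Dfn.comp_two (P := IsFunOn) (by unfold IsFunOn; infer_instance)
instance : Dfn fun v => IsFun (a v) (b v) (c v) :=
  Dfn.comp_three (P := IsFun) (by unfold IsFun; infer_instance)
instance : Dfn fun v => IsOrd (a v) :=
  Dfn.comp_one (P := IsOrd) (by unfold IsOrd; infer_instance)
instance : Dfn fun v => IsLimit (a v) :=
  Dfn.comp_one (P := IsLimit) (by unfold IsLimit; infer_instance)
instance : Dfn fun v => IsOmega (a v) :=
  Dfn.comp_one (P := IsOmega) (by unfold IsOmega; infer_instance)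
instance : Dfn fun v => IsNat (a v) :=
  Dfn.comp_one (P := IsNat) (by unfold IsNat; infer_instance)
instance : Dfn fun v => IsRank (a v) (b v) :=
  Dfn.comp_two (P := IsRank) (by unfold IsRank; infer_instance)
theorem dfn_isNumeral (k : ℕ) : Dfn fun v : Fin 1 → M => IsNumeral k (v 0) := by
  induction k with
  | zero => unfold IsNumeral; infer_instance
  | succ k ih =>
    unfold IsNumeral
    have h : Dfn fun v : Fin 2 → M => IsNumeral k (v (Fin.last 1)) := Dfn.comp_one ih
    exact @Dfn.ex _ _ _ _ (@Dfn.and _ _ _ _ _ h inferInstance)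
instance (k : ℕ) : Dfn fun v => IsNumeral k (a v) :=
  Dfn.comp_one (dfn_isNumeral k)
instance (k : ℕ) : Dfn fun v => IsTagged k (a v) (b v) (c v) :=
  Dfn.comp_three (P := IsTagged k) (by unfold IsTagged; infer_instance)
instance : Dfn fun v => IsMemCode (a v) (b v) (c v) :=
  Dfn.comp_three (P := IsMemCode) (by unfold IsMemCode; infer_instance)
instance : Dfn fun v => IsEqCode (a v) (b v) (c v) :=
  Dfn.comp_three (P := IsEqCode) (by unfold IsEqCode; infer_instance)
instance : Dfn fun v => IsAndCode (a v) (b v) (c v) :=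
  Dfn.comp_three (P := IsAndCode) (by unfold IsAndCode; infer_instance)
instance : Dfn fun v => IsExCode (a v) (b v) (c v) :=
  Dfn.comp_three (P := IsExCode) (by unfold IsExCode; infer_instance)
instance : Dfn fun v => IsNegCode (a v) (b v) :=
  Dfn.comp_two (P := IsNegCode) (by unfold IsNegCode; infer_instance)
instance : Dfn fun v => IsBddExCode (a v) (b v) (c v) (d v) :=
  Dfn.comp_four (P := IsBddExCode) (by unfold IsBddExCode; infer_instance)
instance : Dfn fun v => BoolClosed (a v) :=
  Dfn.comp_one (P := BoolClosed) (by unfold BoolClosed; infer_instance)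
instance : Dfn fun v => IsFormula (a v) :=
  Dfn.comp_one (P := IsFormula) (by unfold IsFormula; infer_instance)
instance : Dfn fun v => IsSigma0 (a v) :=
  Dfn.comp_one (P := IsSigma0) (by unfold IsSigma0; infer_instance)
instance : Dfn fun v => IsSigma1 (a v) :=
  Dfn.comp_one (P := IsSigma1) (by unfold IsSigma1 ExClosure; infer_instance)
instance : Dfn fun v => IsAssignment (a v) (b v) :=
  Dfn.comp_two (P := IsAssignment) (by unfold IsAssignment; infer_instance)
instance : Dfn fun v => AgreeOff (a v) (b v) (c v) :=
  Dfn.comp_three (P := AgreeOff) (by unfold AgreeOff; infer_instance)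
set_option synthInstance.maxSize 2000 in
set_option synthInstance.maxHeartbeats 400000 in
instance : Dfn fun v => IsTruthSet (a v) (b v) :=
  Dfn.comp_two (P := IsTruthSet) (by unfold IsTruthSet; infer_instance)
instance : Dfn fun v => Sat (a v) (b v) (c v) :=
  Dfn.comp_three (P := Sat) (by unfold Sat; infer_instance)

end Notions
end RankToRank

namespace RankToRank

open FirstOrder FirstOrder.Language

/-- Models of ZF, as a class. -/
class ZF (M : Type*) [setLang.Structure M] : Prop where
  out : IsModelZF M

/-! ### Elementary set theory inside a model of ZF. -/

section Basic

variable {M : Type*} [setLang.Structure M]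

/-- `Dfn` admits arbitrary elements of `M` as parameters, whereas the ZF schemes take a finite list.
Only the free variables of `ψ` matter, and these are listed by `Fin k`. The slots of the list that
belong to genuine variables, not to parameters, hold the dummy `x₀`. -/
theorem exists_finite_parameters {n : ℕ} (ψ : setLang.Formula (Fin n ⊕ M)) (x₀ : M) :
    ∃ (k : ℕ) (p : Fin k → M), ∀ {T : Type} (f : Fin n → T) (g : Fin k → T),
      ∃ χ : setLang.Formula T, ∀ w : T → M, (∀ i, w (g i) = p i) →
        (χ.Realize w ↔ ψ.Realize (Sum.elim (fun i => w (f i)) id)) := by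
  classical
  let e := ψ.freeVarFinset.equivFin
  refine ⟨ψ.freeVarFinset.card, fun i => Sum.elim (fun _ => x₀) id (e.symm i).1, ?_⟩
  intro T f g
  refine ⟨BoundedFormula.restrictFreeVar ψ
    fun s => Sum.elim f (fun _ => g (e s)) s.1, fun w hw => ?_⟩
  unfold Formula.Realize
  rw [BoundedFormula.realize_restrictFreeVar]
  rintro ⟨s | s, hs⟩
  · simp
  · simp [hw]

variable [hZ : ZF M]

theorem ext {x y : M} (h : ∀ z, z ∈ₘ x ↔ z ∈ₘ y) : x = y := hZ.out.extensionality x y h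

theorem exists_sep (a : M) (P : M → Prop) [hP : Dfn fun v : Fin 1 → M => P (v 0)] :
    ∃ b, ∀ x, x ∈ₘ b ↔ x ∈ₘ a ∧ P x := by
  obtain ⟨ψ, hψ⟩ := hP.out
  obtain ⟨k, p, h⟩ := exists_finite_parameters ψ a
  obtain ⟨χ, hχ⟩ := h (T := Fin (k + 1)) (fun _ => 0) Fin.succ
  obtain ⟨b, hb⟩ := hZ.out.separation k χ p a
  refine ⟨b, fun x => (hb x).trans (and_congr_right fun _ => ?_)⟩
  rw [hχ _ (by simp), ← hψ]
  rfl

theorem exists_collection (a : M) (P : M → M → Prop)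
    [hP : Dfn fun v : Fin 2 → M => P (v 0) (v 1)] (hex : ∀ x, x ∈ₘ a → ∃ y, P x y) :
    ∃ b, ∀ x, x ∈ₘ a → ∃ y, y ∈ₘ b ∧ P x y := by
  obtain ⟨ψ, hψ⟩ := hP.out
  obtain ⟨k, p, h⟩ := exists_finite_parameters ψ a
  obtain ⟨χ, hχ⟩ := h (T := Fin (k + 2)) (fun i => ![0, 1] i) (fun i => i.succ.succ)
  have key : ∀ x y, χ.Realize (Fin.cons x (Fin.cons y p) : Fin (k + 2) → M) ↔ P x y := fun x y => by
    rw [hχ _ (by simp), ← hψ]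
    rfl
  obtain ⟨b, hb⟩ := hZ.out.collection k χ p a fun x hx => by simpa only [key] using hex x hx
  exact ⟨b, by simpa only [key] using hb⟩

/-- `{x ∈ a | P x}`. -/
noncomputable def sep (a : M) (P : M → Prop) : M :=
  @Classical.epsilon M ⟨a⟩ fun b => ∀ x, x ∈ₘ b ↔ x ∈ₘ a ∧ P x

theorem mem_sep {a x : M} {P : M → Prop} [Dfn fun v : Fin 1 → M => P (v 0)] :
    x ∈ₘ sep a P ↔ x ∈ₘ a ∧ P x :=
  Classical.epsilon_spec (exists_sep a P) x

/-- `{x, y}`. -/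
noncomputable def upair (x y : M) : M := @Classical.epsilon M ⟨x⟩ (IsUPair x y)

theorem mem_upair {x y z : M} : z ∈ₘ upair x y ↔ z = x ∨ z = y :=
  Classical.epsilon_spec (hZ.out.pairing x y) z

theorem isUPair_iff {x y p : M} : IsUPair x y p ↔ p = upair x y :=
  ⟨fun h => ext fun z => (h z).trans mem_upair.symm, fun h _ => h ▸ mem_upair⟩

theorem upair_inj {x y z w : M} :
    upair x y = upair z w ↔ x = z ∧ y = w ∨ x = w ∧ y = z := by
  constructor
  · intro h
    have key : ∀ u, (u = x ∨ u = y) ↔ (u = z ∨ u = w) := fun u => by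
      rw [← mem_upair, h, mem_upair]
    have h1 := key x
    have h2 := key y
    have h3 := key z
    have h4 := key w
    grind
  · rintro (⟨rfl, rfl⟩ | ⟨rfl, rfl⟩)
    · rfl
    · exact ext fun u => by simp only [mem_upair, or_comm]

/-- `(x, y)`. -/
noncomputable def pr (x y : M) : M := upair (upair x x) (upair x y)

theorem isOPair_iff {x y p : M} : IsOPair x y p ↔ p = pr x y := by
  simp only [IsOPair, isUPair_iff]
  exact ⟨fun ⟨a, b, ha, hb, hp⟩ => by rw [hp, ha, hb, pr], fun h => ⟨_, _, rfl, rfl, h⟩⟩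

@[simp] theorem pr_inj {x y z w : M} : pr x y = pr z w ↔ x = z ∧ y = w := by
  simp only [pr, upair_inj]
  grind

theorem app_iff {f x y : M} : App f x y ↔ pr x y ∈ₘ f := by simp [App, isOPair_iff]

/-- `⋃ x`. -/
noncomputable def sUn (x : M) : M :=
  @Classical.epsilon M ⟨x⟩ fun u => ∀ z, z ∈ₘ u ↔ ∃ y, y ∈ₘ x ∧ z ∈ₘ y

theorem mem_sUn {x z : M} : z ∈ₘ sUn x ↔ ∃ y, y ∈ₘ x ∧ z ∈ₘ y :=
  Classical.epsilon_spec (hZ.out.union x) z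

/-- The power set. -/
noncomputable def pow (x : M) : M :=
  @Classical.epsilon M ⟨x⟩ fun u => ∀ z, z ∈ₘ u ↔ IsSubset z x

theorem mem_pow {x z : M} : z ∈ₘ pow x ↔ IsSubset z x :=
  Classical.epsilon_spec (hZ.out.powerset x) z

/-- `x ∪ y`. -/
noncomputable def un (x y : M) : M := sUn (upair x y)

theorem mem_un {x y z : M} : z ∈ₘ un x y ↔ z ∈ₘ x ∨ z ∈ₘ y := by
  simp only [un, mem_sUn, mem_upair]
  grind

/-- `x ∪ {x}`. -/
noncomputable def suc (x : M) : M := un x (upair x x)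

theorem mem_suc {x z : M} : z ∈ₘ suc x ↔ z ∈ₘ x ∨ z = x := by simp [suc, mem_un, mem_upair]

theorem isSucc_iff {x y : M} : IsSucc x y ↔ y = suc x :=
  ⟨fun h => ext fun z => (h z).trans mem_suc.symm, fun h _ => h ▸ mem_suc⟩

theorem self_mem_suc (x : M) : x ∈ₘ suc x := mem_suc.2 (Or.inr rfl)

variable (M) in
theorem exists_isEmp : ∃ e : M, IsEmp e := by
  obtain ⟨w, ⟨e, he, -⟩, -⟩ := hZ.out.infinity
  exact ⟨e, he⟩

variable (M) in
/-- The empty set. -/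
noncomputable def emp : M := Classical.choose (exists_isEmp M)

@[simp] theorem not_mem_emp {z : M} : ¬ z ∈ₘ emp M := Classical.choose_spec (exists_isEmp M) z

theorem isEmp_iff {x : M} : IsEmp x ↔ x = emp M :=
  ⟨fun h => ext fun z => by simp [h z], fun h z => h ▸ not_mem_emp⟩

theorem exists_mem_of_ne_emp {x : M} (h : x ≠ emp M) : ∃ y, y ∈ₘ x := by
  by_contra! h'
  exact h (isEmp_iff.1 h')

section
variable {n : ℕ} {a b : (Fin n → M) → M} [DefFun a] [DefFun b]

instance : DefFun fun v => upair (a v) (b v) :=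
  DefFun.comp_two ((inferInstance : Dfn fun v : Fin 3 → M => IsUPair (v 0) (v 1) (v 2)).congr
    fun _ => isUPair_iff.symm)
instance : DefFun fun v => pr (a v) (b v) :=
  DefFun.comp_two ((inferInstance : Dfn fun v : Fin 3 → M => IsOPair (v 0) (v 1) (v 2)).congr
    fun _ => isOPair_iff.symm)
instance : DefFun fun v => suc (a v) :=
  DefFun.comp_one ((inferInstance : Dfn fun v : Fin 2 → M => IsSucc (v 0) (v 1)).congr
    fun _ => isSucc_iff.symm)
instance : DefFun fun v => sUn (a v) :=
  DefFun.comp_one ((inferInstance : Dfn fun v : Fin 2 → M =>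
    ∀ z, z ∈ₘ v 1 ↔ ∃ y, y ∈ₘ v 0 ∧ z ∈ₘ y).congr fun _ =>
    ⟨fun h _ => h ▸ mem_sUn, fun h => ext fun z => (h z).trans mem_sUn.symm⟩)
instance : DefFun fun v => un (a v) (b v) := inferInstanceAs (DefFun fun v => sUn (upair (a v) (b v)))
end

/-- `x × y`. -/
noncomputable def prod (x y : M) : M :=
  sep (pow (pow (un x y))) fun p => ∃ a b, a ∈ₘ x ∧ b ∈ₘ y ∧ p = pr a b

theorem mem_prod {x y p : M} : p ∈ₘ prod x y ↔ ∃ a b, a ∈ₘ x ∧ b ∈ₘ y ∧ p = pr a b := by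
  rw [prod, mem_sep, and_iff_right_iff_imp]
  rintro ⟨a, b, ha, hb, rfl⟩
  rw [mem_pow]
  intro z hz
  rw [mem_pow]
  intro u hu
  rw [pr, mem_upair] at hz
  rw [mem_un]
  rcases hz with rfl | rfl <;> rw [mem_upair] at hu <;> grind

theorem pr_mem_prod {x y a b : M} : pr a b ∈ₘ prod x y ↔ a ∈ₘ x ∧ b ∈ₘ y := by
  simp [mem_prod]

/-! ### Foundation -/

/-- Foundation speaks only of sets of the model, so minimal elements are available for definable
predicates only. This is why the induction principles built on it ask for a `Dfn` instance. -/
theorem exists_min (a : M) (P : M → Prop) [Dfn fun v : Fin 1 → M => P (v 0)]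
    (h : ∃ x, x ∈ₘ a ∧ P x) : ∃ x, x ∈ₘ a ∧ P x ∧ ∀ y, y ∈ₘ a → P y → ¬ y ∈ₘ x := by
  obtain ⟨x, hx⟩ := h
  obtain ⟨y, hy, hy'⟩ := hZ.out.foundation (sep a P) ⟨x, mem_sep.2 hx⟩
  exact ⟨y, (mem_sep.1 hy).1, (mem_sep.1 hy).2, fun z hz hP hzy => hy' z hzy (mem_sep.2 ⟨hz, hP⟩)⟩

theorem mem_asymm {x y : M} (h : x ∈ₘ y) : ¬ y ∈ₘ x := by
  intro h'
  obtain ⟨z, hz, hz'⟩ := hZ.out.foundation (upair x y) ⟨x, by simp [mem_upair]⟩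
  rw [mem_upair] at hz
  rcases hz with rfl | rfl
  · exact hz' y h' (by simp [mem_upair])
  · exact hz' x h (by simp [mem_upair])

theorem mem_irrefl (x : M) : ¬ x ∈ₘ x := fun h => mem_asymm h h

theorem suc_inj {x y : M} : suc x = suc y ↔ x = y := by
  refine ⟨fun h => ?_, fun h => h ▸ rfl⟩
  have h1 : x ∈ₘ suc y := h ▸ self_mem_suc x
  have h2 : y ∈ₘ suc x := h ▸ self_mem_suc y
  rw [mem_suc] at h1 h2
  rcases h1 with h1 | h1
  · rcases h2 with h2 | h2
    · exact absurd h2 (mem_asymm h1)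
    · exact h2.symm
  · exact h1

theorem suc_ne_emp (x : M) : suc x ≠ emp M := fun h => not_mem_emp (h ▸ self_mem_suc x)

theorem IsSubset.refl (x : M) : IsSubset x x := fun _ h => h

theorem IsSubset.trans {x y z : M} (h : IsSubset x y) (h' : IsSubset y z) : IsSubset x z :=
  fun _ hu => h' _ (h _ hu)

theorem IsSubset.antisymm {x y : M} (h : IsSubset x y) (h' : IsSubset y x) : x = y :=
  ext fun _ => ⟨h _, h' _⟩

/-! ### Ordinals -/

theorem IsOrd.mem {a b : M} (ha : IsOrd a) (hb : b ∈ₘ a) : IsOrd b := by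
  refine ⟨fun y hy z hz => ?_, fun y z hy hz =>
    ha.2 y z (ha.1 b hb y hy) (ha.1 b hb z hz)⟩
  have hya := ha.1 b hb y hy
  rcases ha.2 z b (ha.1 y hya z hz) hb with h | rfl | h
  · exact h
  · exact absurd hz (mem_asymm hy)
  · exfalso
    -- Foundation for `{y, z, b}` excludes the cycle `z ∈ y ∈ b ∈ z`.
    obtain ⟨m, hm, hm'⟩ := hZ.out.foundation (un (upair y z) (upair b b)) ⟨b, by simp [mem_un, mem_upair]⟩
    simp only [mem_un, mem_upair, or_self] at hm hm'
    rcases hm with (rfl | rfl) | rfl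
    · exact hm' z hz (by simp)
    · exact hm' b h (by simp)
    · exact hm' y hy (by simp)

theorem IsOrd.trans {a b c : M} (ha : IsOrd a) (h : c ∈ₘ b) (h' : b ∈ₘ a) : c ∈ₘ a :=
  ha.1 b h' c h

theorem IsOrd.induction {a : M} (ha : IsOrd a) (P : M → Prop)
    [Dfn fun v : Fin 1 → M => P (v 0)]
    (h : ∀ b, IsOrd b → (∀ c, c ∈ₘ b → P c) → P b) : P a := by
  by_contra hP
  obtain ⟨b, hb, hb', hmin⟩ := exists_min (suc a) (fun x => ¬ P x)
    ⟨a, self_mem_suc a, hP⟩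
  have hbo : IsOrd b := by
    rcases mem_suc.1 hb with hb | rfl
    exacts [ha.mem hb, ha]
  refine hb' (h b hbo fun c hc => ?_)
  by_contra hc'
  refine hmin c ?_ hc' hc
  rcases mem_suc.1 hb with hb | rfl
  exacts [mem_suc.2 (Or.inl (ha.trans hc hb)), mem_suc.2 (Or.inl hc)]

/-- If the inclusion is proper, an `∈`-minimal element of `b \ a` equals `a`. -/
theorem IsOrd.subset_cases {a b : M} (ha : IsOrd a) (hb : IsOrd b) (h : IsSubset a b) :
    a = b ∨ a ∈ₘ b := by
  by_cases h' : IsSubset b a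
  · exact Or.inl (h.antisymm h')
  · right
    simp only [IsSubset, not_forall] at h'
    obtain ⟨z, hz, hza⟩ := h'
    obtain ⟨m, hm, hma, hmin⟩ := exists_min b (fun x => ¬ x ∈ₘ a) ⟨z, hz, hza⟩
    have : a = m := by
      refine IsSubset.antisymm (fun x hx => ?_) (fun x hx => ?_)
      · rcases hb.2 x m (h x hx) hm with h1 | rfl | h1
        · exact h1
        · exact absurd hx hma
        · exact absurd (ha.trans h1 hx) hma
      · by_contra hxa
        exact hmin x (hb.trans hx hm) hxa hx
    exact this ▸ hm

/-- The intersection is an ordinal contained in both. Were it proper in both, it would belong to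
both and so to itself. -/
theorem IsOrd.trichotomy {a b : M} (ha : IsOrd a) (hb : IsOrd b) : a ∈ₘ b ∨ a = b ∨ b ∈ₘ a := by
  have hc : IsOrd (sep a (fun x => x ∈ₘ b)) := by
    refine ⟨fun y hy z hz => ?_, fun y z hy hz => ?_⟩
    · rw [mem_sep] at hy ⊢
      exact ⟨ha.trans hz hy.1, hb.trans hz hy.2⟩
    · exact ha.2 y z (mem_sep.1 hy).1 (mem_sep.1 hz).1
  have h1 := hc.subset_cases ha fun x hx => (mem_sep.1 hx).1
  have h2 := hc.subset_cases hb fun x hx => (mem_sep.1 hx).2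
  rcases h1 with h1 | h1
  · rw [h1] at h2
    exact h2.elim (fun h => Or.inr (Or.inl h)) Or.inl
  · rcases h2 with h2 | h2
    · exact Or.inr (Or.inr (h2 ▸ h1))
    · exact absurd (mem_sep.2 ⟨h1, h2⟩) (mem_irrefl _)

theorem IsOrd.subset_iff {a b : M} (ha : IsOrd a) (hb : IsOrd b) :
    IsSubset a b ↔ a = b ∨ a ∈ₘ b :=
  ⟨ha.subset_cases hb, fun h => h.elim (fun h => h ▸ IsSubset.refl a) (hb.1 a)⟩

theorem IsOrd.not_mem_iff {a b : M} (ha : IsOrd a) (hb : IsOrd b) : ¬ a ∈ₘ b ↔ IsSubset b a := by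
  rw [hb.subset_iff ha]
  have := ha.trichotomy hb
  constructor
  · intro h
    rcases this with h1 | h1 | h1
    exacts [absurd h1 h, Or.inl h1.symm, Or.inr h1]
  · rintro (rfl | h)
    exacts [mem_irrefl _, mem_asymm h]

theorem isOrd_of_forall {a : M} (h : ∀ y, y ∈ₘ a → IsSubset y a) (h' : ∀ y, y ∈ₘ a → IsOrd y) :
    IsOrd a :=
  ⟨h, fun y z hy hz => (h' y hy).trichotomy (h' z hz)⟩

theorem isOrd_suc {a : M} (ha : IsOrd a) : IsOrd (suc a) := by
  refine isOrd_of_forall (fun y hy z hz => ?_) fun y hy => ?_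
  · rw [mem_suc] at hy ⊢
    rcases hy with hy | rfl
    exacts [Or.inl (ha.trans hz hy), Or.inl hz]
  · rcases mem_suc.1 hy with hy | rfl
    exacts [ha.mem hy, ha]

theorem isOrd_emp : IsOrd (emp M) :=
  ⟨fun _ h => absurd h not_mem_emp, fun _ _ h => absurd h not_mem_emp⟩

theorem IsOrd.suc_cases {a b : M} (ha : IsOrd a) (hb : IsOrd b) (h : a ∈ₘ b) :
    suc a = b ∨ suc a ∈ₘ b := by
  refine (isOrd_suc ha).subset_cases hb fun z hz => ?_
  rcases mem_suc.1 hz with hz | rfl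
  exacts [hb.trans hz h, h]

theorem IsLimit.suc_mem {a b : M} (ha : IsLimit a) (hb : b ∈ₘ a) : suc b ∈ₘ a := by
  obtain ⟨z, hz, hbz⟩ := ha.2.2 b hb
  rcases (ha.1.mem hb).suc_cases (ha.1.mem hz) hbz with h | h
  exacts [h ▸ hz, ha.1.trans h hz]

theorem isLimit_of_suc_mem {a : M} (ha : IsOrd a) (h0 : ∃ y, y ∈ₘ a)
    (h : ∀ b, b ∈ₘ a → suc b ∈ₘ a) : IsLimit a :=
  ⟨ha, h0, fun b hb => ⟨suc b, h b hb, self_mem_suc b⟩⟩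

theorem IsLimit.emp_mem {a : M} (ha : IsLimit a) : emp M ∈ₘ a := by
  obtain ⟨y, hy⟩ := ha.2.1
  rcases isOrd_emp.trichotomy ha.1 with h | rfl | h
  exacts [h, absurd hy not_mem_emp, absurd h not_mem_emp]

theorem IsOrd.cases {a : M} (ha : IsOrd a) : a = emp M ∨ (∃ b, b ∈ₘ a ∧ a = suc b) ∨ IsLimit a := by
  by_cases h0 : a = emp M
  · exact Or.inl h0
  · by_cases h : ∃ b, b ∈ₘ a ∧ a = suc b
    · exact Or.inr (Or.inl h)
    · refine Or.inr (Or.inr (isLimit_of_suc_mem ha (exists_mem_of_ne_emp h0) fun b hb => ?_))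
      rcases (ha.mem hb).suc_cases ha hb with h' | h'
      exacts [absurd ⟨b, hb, h'.symm⟩ h, h']

/-! ### The natural numbers -/

-- The axiom of infinity provides an inductive set `w`, not a limit ordinal. Without limit ordinals,
-- every ordinal would lie in `w` by induction, and the ordinals would form a set, as in the
-- Burali-Forti paradox.
variable (M) in
theorem exists_isOmega : ∃ w : M, IsOmega w := by
  obtain ⟨w, ⟨e, he, hew⟩, hw⟩ := hZ.out.infinity
  have hs : ∀ x, x ∈ₘ w → suc x ∈ₘ w := fun x hx => by
    obtain ⟨y, hy, hyw⟩ := hw x hx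
    exact isSucc_iff.1 hy ▸ hyw
  rw [isEmp_iff] at he
  subst he
  have key : ∃ a : M, IsLimit a := by
    by_contra! hno
    -- otherwise every ordinal lies in `w`
    have hall : ∀ a : M, IsOrd a → a ∈ₘ w := fun a ha => by
      refine ha.induction (fun x => x ∈ₘ w) fun b hb ih => ?_
      rcases hb.cases with rfl | ⟨c, hc, rfl⟩ | hl
      exacts [hew, hs c (ih c hc), absurd hl (hno b)]
    have ho : IsOrd (sep w fun x => IsOrd x) := by
      refine isOrd_of_forall (fun y hy z hz => ?_) fun y hy => (mem_sep.1 hy).2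
      have := (mem_sep.1 hy).2.mem hz
      exact mem_sep.2 ⟨hall z this, this⟩
    exact mem_irrefl _ (mem_sep.2 ⟨hall _ ho, ho⟩)
  obtain ⟨a, ha⟩ := key
  obtain ⟨b, hb, hbl, hmin⟩ := exists_min (suc a) (fun x => IsLimit x) ⟨a, self_mem_suc a, ha⟩
  refine ⟨b, hbl, fun x hx hxl => hmin x ?_ hxl hx⟩
  exact (isOrd_suc ha.1).trans hx hb

variable (M) in
/-- `ω`. -/
noncomputable def om : M := Classical.choose (exists_isOmega M)

theorem isOmega_om : IsOmega (om M) := Classical.choose_spec (exists_isOmega M)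

theorem isOmega_iff {w : M} : IsOmega w ↔ w = om M := by
  refine ⟨fun h => ?_, fun h => h ▸ isOmega_om⟩
  have h' := isOmega_om (M := M)
  rcases h.1.1.trichotomy h'.1.1 with h1 | h1 | h1
  exacts [absurd h.1 (h'.2 _ h1), h1, absurd h'.1 (h.2 _ h1)]

theorem isLimit_om : IsLimit (om M) := isOmega_om.1

theorem isNat_iff {i : M} : IsNat i ↔ i ∈ₘ om M := by simp [IsNat, isOmega_iff]

theorem om_induction (P : M → Prop) [Dfn fun v : Fin 1 → M => P (v 0)] (h0 : P (emp M))
    (hs : ∀ i, i ∈ₘ om M → P i → P (suc i)) {i : M} (hi : i ∈ₘ om M) : P i := by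
  by_contra hP
  obtain ⟨m, hm, hmP, hmin⟩ := exists_min (om M) (fun x => ¬ P x) ⟨i, hi, hP⟩
  rcases (isLimit_om.1.mem hm).cases with rfl | ⟨b, hb, rfl⟩ | hl
  · exact hmP h0
  · have hbo := isLimit_om.1.trans hb hm
    exact hmP (hs b hbo (by_contra fun h => hmin b hbo h hb))
  · exact isOmega_om.2 m hm hl

theorem IsLimit.om_subset {a : M} (ha : IsLimit a) : IsSubset (om M) a := by
  rw [← ha.1.not_mem_iff isLimit_om.1]
  exact fun h => isOmega_om.2 a h ha

/-! ### Functions -/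

open Classical in
/-- The unique `y` with `P y`, if there is one. -/
noncomputable def the (P : M → Prop) : M := if h : ∃! y, P y then h.choose else emp M

theorem the_spec {P : M → Prop} (h : ∃! y, P y) : P (the P) := by
  rw [the, dif_pos h]
  exact h.choose_spec.1

theorem eq_the_iff {P : M → Prop} {y : M} :
    y = the P ↔ (P y ∧ ∃! z, P z) ∨ (¬ (∃! z, P z) ∧ y = emp M) := by
  by_cases h : ∃! z, P z
  · simp only [h, and_true, not_true, false_and, or_false]
    exact ⟨fun h' => h' ▸ the_spec h, fun h' => h.unique h' (the_spec h)⟩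
  · simp [h, the]

/-- `f(x)`, if `f` is a function with `x` in its domain. -/
noncomputable def ap (f x : M) : M := the fun y => App f x y

instance {n : ℕ} {a b : (Fin n → M) → M} [DefFun a] [DefFun b] : DefFun fun v => ap (a v) (b v) :=
  DefFun.comp_two (Dfn.congr (Q := fun v : Fin 3 → M =>
    (App (v 0) (v 1) (v 2) ∧ ∃! z, App (v 0) (v 1) z) ∨
      (¬ (∃! z, App (v 0) (v 1) z) ∧ v 2 = emp M)) inferInstance fun _ => eq_the_iff)

theorem app_ap {f a x : M} (hf : IsFunOn f a) (hx : x ∈ₘ a) : App f x (ap f x) :=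
  the_spec (hf.2 x hx)

theorem IsFunOn.app_iff {f a x y : M} (hf : IsFunOn f a) (hx : x ∈ₘ a) : App f x y ↔ ap f x = y :=
  ⟨fun h => (hf.2 x hx).unique (app_ap hf hx) h, fun h => h ▸ app_ap hf hx⟩

theorem IsFunOn.mem_of_app {f a x y : M} (hf : IsFunOn f a) (h : App f x y) : x ∈ₘ a := by
  rw [RankToRank.app_iff] at h
  obtain ⟨x', y', hx', hp⟩ := hf.1 _ h
  rw [isOPair_iff, pr_inj] at hp
  exact hp.1 ▸ hx'

theorem IsFunOn.ext {f g a : M} (hf : IsFunOn f a) (hg : IsFunOn g a)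
    (h : ∀ x, x ∈ₘ a → ap f x = ap g x) : f = g := by
  have key : ∀ {f g : M}, IsFunOn f a → IsFunOn g a → (∀ x, x ∈ₘ a → ap f x = ap g x) →
      IsSubset f g := fun {f g} hf hg h p hp => by
    obtain ⟨x, y, hx, hp'⟩ := hf.1 p hp
    rw [isOPair_iff] at hp'
    subst hp'
    rw [← RankToRank.app_iff] at hp ⊢
    rw [hg.app_iff hx, ← h x hx, ← hf.app_iff hx]
    exact hp
  exact (key hf hg h).antisymm (key hg hf fun x hx => (h x hx).symm)

theorem IsFun.ap_mem {f a b x : M} (hf : IsFun f a b) (hx : x ∈ₘ a) : ap f x ∈ₘ b :=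
  hf.2 _ _ (app_ap hf.1 hx)

/-- With the codomain given in advance, Separation suffices and Replacement is not needed. -/
theorem exists_fun (a b : M) (F : M → M) (hF : Dfn fun v : Fin 2 → M => v 1 = F (v 0))
    (hab : ∀ x, x ∈ₘ a → F x ∈ₘ b) : ∃ f, IsFun f a b ∧ ∀ x, x ∈ₘ a → ap f x = F x := by
  have := fun (a : (Fin 3 → M) → M) [DefFun a] => DefFun.comp_one hF (a := a)
  obtain ⟨f, hf⟩ := exists_sep (prod a b) fun p => ∃ x y, p = pr x y ∧ y = F x
  have happ : ∀ x y, App f x y ↔ x ∈ₘ a ∧ y = F x := fun x y => by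
    rw [app_iff, hf, pr_mem_prod]
    constructor
    · rintro ⟨h1, x', y', h2, h3⟩
      rw [pr_inj] at h2
      exact ⟨h1.1, by rw [h2.1, h2.2, h3]⟩
    · rintro ⟨h1, rfl⟩
      exact ⟨⟨h1, hab x h1⟩, x, _, rfl, rfl⟩
  have hfun : IsFunOn f a := by
    refine ⟨fun p hp => ?_, fun x hx => ⟨F x, (happ _ _).2 ⟨hx, rfl⟩, fun y hy => ((happ _ _).1 hy).2⟩⟩
    obtain ⟨x, y, hx, -, rfl⟩ := mem_prod.1 ((hf p).1 hp).1
    exact ⟨x, y, hx, isOPair_iff.2 rfl⟩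
  exact ⟨f, ⟨hfun, fun x y h => ((happ _ _).1 h).2 ▸ hab x ((happ _ _).1 h).1⟩,
    fun x hx => (hfun.app_iff hx).1 ((happ _ _).2 ⟨hx, rfl⟩)⟩

end Basic
end RankToRank

namespace RankToRank

/-! ### Recursion inside the model. -/

section Recursion

variable {M : Type*} [setLang.Structure M] [hZ : ZF M]

/-- Recursion along a well-founded relation `R` on a set `A`, for a relation `G ⊆ A × B`. -/
theorem exists_recursion (A B : M) (R : M → M → Prop) (P : M → M → M → Prop)
    [hR : Dfn fun v : Fin 2 → M => R (v 0) (v 1)]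
    [hP : Dfn fun v : Fin 3 → M => P (v 0) (v 1) (v 2)]
    (hind : ∀ X : M, (∀ a, a ∈ₘ A → (∀ b, b ∈ₘ A → R b a → b ∈ₘ X) → a ∈ₘ X) →
      ∀ a, a ∈ₘ A → a ∈ₘ X)
    (hloc : ∀ a G G' : M, a ∈ₘ A →
      (∀ b, b ∈ₘ A → R b a → ∀ z, App G b z ↔ App G' b z) → ∀ z, P a G z ↔ P a G' z) :
    ∃ G, ∀ a z, App G a z ↔ a ∈ₘ A ∧ z ∈ₘ B ∧ P a G z := by
  have hR' := fun {n : ℕ} {a b : (Fin n → M) → M} [DefFun a] [DefFun b] =>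
    Dfn.comp_two hR (a := a) (b := b)
  have hP' := fun {n : ℕ} {a b c : (Fin n → M) → M} [DefFun a] [DefFun b] [DefFun c] =>
    Dfn.comp_three hP (a := a) (b := b) (c := c)
  -- The approximations: `g` obeys the recursion on a part `D` of `A` that is closed under
  -- `R`-predecessors. Any two of them agree on common arguments, so their union `G` obeys the
  -- recursion wherever some approximation is defined.
  let Good : M → M → Prop := fun D g => IsSubset D A ∧
    (∀ a b, a ∈ₘ D → b ∈ₘ A → R b a → b ∈ₘ D) ∧
    ∀ a z, a ∈ₘ D → (App g a z ↔ z ∈ₘ B ∧ P a g z)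
  have hGood : Dfn fun v : Fin 2 → M => Good (v 0) (v 1) := by
    simp only [Good]
    infer_instance
  have hGood' := fun {n : ℕ} {a b : (Fin n → M) → M} [DefFun a] [DefFun b] =>
    Dfn.comp_two hGood (a := a) (b := b)
  have huniq : ∀ {D g D' g' a : M}, Good D g → Good D' g' → a ∈ₘ D → a ∈ₘ D' →
      ∀ z, App g a z ↔ App g' a z := fun {D g D' g' a} h h' ha ha' => by
    have := hind (sep A fun a => a ∈ₘ D → a ∈ₘ D' → ∀ z, App g a z ↔ App g' a z)
      (fun a ha ih => mem_sep.2 ⟨ha, fun hD hD' z => by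
        rw [h.2.2 a z hD, h'.2.2 a z hD']
        exact and_congr_right fun _ => hloc a g g' ha (fun b hb hba =>
          (mem_sep.1 (ih b hb hba)).2 (h.2.1 a b hD hb hba) (h'.2.1 a b hD' hb hba)) z⟩) a (h.1 a ha)
    exact (mem_sep.1 this).2 ha ha'
  let D := sep A fun a => ∃ D g, Good D g ∧ a ∈ₘ D
  let G := sep (prod A B) fun q => ∃ a z D g, q = pr a z ∧ Good D g ∧ a ∈ₘ D ∧ App g a z
  have hD : ∀ a, a ∈ₘ D ↔ ∃ D g, Good D g ∧ a ∈ₘ D := fun a =>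
    mem_sep.trans (and_iff_right_of_imp fun ⟨E, g, h, ha⟩ => h.1 a ha)
  have hG : ∀ a z, App G a z ↔ ∃ D g, Good D g ∧ a ∈ₘ D ∧ App g a z := fun a z => by
    rw [app_iff]
    refine mem_sep.trans ⟨?_, ?_⟩
    · rintro ⟨-, a', z', E, g, h, h1⟩
      rw [pr_inj] at h
      rw [h.1, h.2]
      exact ⟨E, g, h1⟩
    · rintro ⟨E, g, h1, h2, h3⟩
      exact ⟨pr_mem_prod.2 ⟨h1.1 a h2, ((h1.2.2 a z h2).1 h3).1⟩, a, z, E, g, rfl, h1, h2, h3⟩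
  have hG' : ∀ {a E g}, Good E g → a ∈ₘ E → ∀ z, App G a z ↔ App g a z := fun {a E g} h ha z => by
    rw [hG]
    exact ⟨fun ⟨E', g', h', ha', hz⟩ => (huniq h h' ha ha' z).2 hz, fun hz => ⟨E, g, h, ha, hz⟩⟩
  have hDA : ∀ a, a ∈ₘ A → a ∈ₘ D := by
    refine hind D fun a ha ih => ?_
    by_contra haD
    refine haD ((hD a).2 ?_)
    -- As `a` is assumed to lie outside `D`, adding the values prescribed at `a` changes nothing on
    -- `D`. Hence `D ∪ {a}` carries an approximation, which puts `a` into `D`.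
    let g' := sep (prod A B) fun q => q ∈ₘ G ∨ ∃ z, q = pr a z ∧ P a G z
    have hg' : ∀ b z, App g' b z ↔ App G b z ∨ b = a ∧ z ∈ₘ B ∧ P a G z := fun b z => by
      rw [app_iff, app_iff]
      refine mem_sep.trans ⟨?_, ?_⟩
      · rintro ⟨h1, h2 | ⟨z', h2, h3⟩⟩
        · exact Or.inl h2
        · rw [pr_inj] at h2
          rw [pr_mem_prod] at h1
          rw [h2.2] at h1 ⊢
          exact Or.inr ⟨h2.1, h1.2, h3⟩
      · rintro (h | ⟨rfl, h1, h2⟩)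
        · exact ⟨(mem_sep.1 h).1, Or.inl h⟩
        · exact ⟨pr_mem_prod.2 ⟨ha, h1⟩, Or.inr ⟨z, rfl, h2⟩⟩
    have hg'D : ∀ b, b ∈ₘ D → ∀ z, App g' b z ↔ App G b z := fun b hb z => by
      rw [hg']
      exact or_iff_left fun h => haD (h.1 ▸ hb)
    refine ⟨un D (upair a a), g', ⟨fun b hb => ?_, fun b c hb hc hcb => ?_, fun b z hb => ?_⟩, ?_⟩
    · rw [mem_un, mem_upair, or_self] at hb
      rcases hb with hb | rfl
      exacts [(mem_sep.1 hb).1, ha]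
    · rw [mem_un, mem_upair, or_self] at hb ⊢
      left
      rcases hb with hb | rfl
      · obtain ⟨E, g, h, hbE⟩ := (hD b).1 hb
        exact (hD c).2 ⟨E, g, h, h.2.1 b c hbE hc hcb⟩
      · exact ih c hc hcb
    · rw [mem_un, mem_upair, or_self] at hb
      rcases hb with hb | rfl
      · obtain ⟨E, g, h, hbE⟩ := (hD b).1 hb
        rw [hg'D b hb, hG' h hbE, h.2.2 b z hbE]
        refine and_congr_right fun _ => hloc b g g' (h.1 b hbE) (fun c hc hcb z => ?_) z
        have hcE := h.2.1 b c hbE hc hcb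
        rw [hg'D c ((hD c).2 ⟨E, g, h, hcE⟩), hG' h hcE]
      · rw [hg', or_iff_right, and_iff_right rfl]
        · exact and_congr_right fun _ =>
            hloc b G g' ha (fun c hc hcb z => (hg'D c (ih c hc hcb) z).symm) z
        · intro h
          obtain ⟨E, g, h1, h2, -⟩ := (hG b z).1 h
          exact haD ((hD b).2 ⟨E, g, h1, h2⟩)
    · rw [mem_un, mem_upair]
      exact Or.inr (Or.inl rfl)
  refine ⟨G, fun a z => ⟨fun h => ?_, fun ⟨ha, hz, hp⟩ => ?_⟩⟩
  · obtain ⟨E, g, h1, h2, h3⟩ := (hG a z).1 h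
    have h4 := (h1.2.2 a z h2).1 h3
    exact ⟨h1.1 a h2, h4.1, (hloc a g G (h1.1 a h2) (fun b hb hba z =>
      (hG' h1 (h1.2.1 a b h2 hb hba) z).symm) z).1 h4.2⟩
  · obtain ⟨E, g, h1, h2⟩ := (hD a).1 (hDA a ha)
    rw [hG' h1 h2, h1.2.2 a z h2]
    exact ⟨hz, (hloc a g G ha (fun b hb hba z =>
      (hG' h1 (h1.2.1 a b h2 hb hba) z).symm) z).2 hp⟩

theorem IsOrd.set_induction {A : M} (hA : IsOrd A) (X : M)
    (h : ∀ a, a ∈ₘ A → (∀ b, b ∈ₘ A → b ∈ₘ a → b ∈ₘ X) → a ∈ₘ X) : ∀ a, a ∈ₘ A → a ∈ₘ X := by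
  intro a ha
  refine (hA.mem ha).induction (fun x => x ∈ₘ A → x ∈ₘ X) (fun b _ ih hbA =>
    h b hbA fun c hc hcb => ih c hcb hc) ha

end Recursion

/-! ### The cumulative hierarchy -/

section Rank

variable {M : Type*} [setLang.Structure M] [hZ : ZF M]

/-- `f` enumerates the cumulative hierarchy along `s`. -/
def RankFun (f s : M) : Prop :=
  IsFunOn f s ∧ ∀ b u, b ∈ₘ s → App f b u → ∀ z, z ∈ₘ u ↔ ∃ c w, c ∈ₘ b ∧ App f c w ∧ IsSubset z w

theorem isRank_iff {a v : M} :
    IsRank a v ↔ IsOrd a ∧ ∃ f, RankFun f (suc a) ∧ App f a v := by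
  simp only [IsRank, isSucc_iff, RankFun]
  grind

theorem RankFun.mem_ap_iff {f s b : M} (hs : IsOrd s) (hf : RankFun f s) (hb : b ∈ₘ s) (z : M) :
    z ∈ₘ ap f b ↔ ∃ c, c ∈ₘ b ∧ IsSubset z (ap f c) := by
  rw [hf.2 b _ hb (app_ap hf.1 hb)]
  constructor
  · rintro ⟨c, w, hc, hw, hz⟩
    rw [hf.1.app_iff (hs.trans hc hb)] at hw
    exact ⟨c, hc, hw ▸ hz⟩
  · rintro ⟨c, hc, hz⟩
    exact ⟨c, _, hc, app_ap hf.1 (hs.trans hc hb), hz⟩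

theorem RankFun.ap_eq {f s f' s' b : M} (hs : IsOrd s) (hf : RankFun f s) (hs' : IsOrd s')
    (hf' : RankFun f' s') (hb : b ∈ₘ s) (hb' : b ∈ₘ s') : ap f b = ap f' b := by
  refine (hs.mem hb).induction (fun b => b ∈ₘ s → b ∈ₘ s' → ap f b = ap f' b)
    (fun b _ ih hb hb' => ext fun z => ?_) hb hb'
  rw [hf.mem_ap_iff hs hb, hf'.mem_ap_iff hs' hb']
  refine exists_congr fun c => and_congr_right fun hc => ?_
  rw [ih c hc (hs.trans hc hb) (hs'.trans hc hb')]

theorem RankFun.restrict {f s s' : M} (hs : IsOrd s) (hf : RankFun f s) (hs' : IsOrd s')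
    (h : IsSubset s' s) : ∃ f', RankFun f' s' ∧ ∀ b, b ∈ₘ s' → ap f' b = ap f b := by
  obtain ⟨f', hf', hf'ap⟩ := exists_fun s' (sUn (sUn f)) (fun b => ap f b) inferInstance
    fun b hb => by
      have := app_ap hf.1 (h b hb)
      rw [app_iff] at this
      exact mem_sUn.2 ⟨upair b (ap f b), mem_sUn.2 ⟨_, this, by simp [pr, mem_upair]⟩,
        by simp [mem_upair]⟩
  refine ⟨f', ⟨hf'.1, fun b u hb hu z => ?_⟩, hf'ap⟩
  rw [hf'.1.app_iff hb, hf'ap b hb] at hu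
  rw [← hu, hf.mem_ap_iff hs (h b hb)]
  refine exists_congr fun c => ⟨fun ⟨hc, hz⟩ => ?_, fun ⟨w, hc, hw, hz⟩ => ?_⟩
  · have hc' := hs'.trans hc hb
    exact ⟨_, hc, app_ap hf'.1 hc', (hf'ap c hc').symm ▸ hz⟩
  · have hc' := hs'.trans hc hb
    rw [hf'.1.app_iff hc', hf'ap c hc'] at hw
    exact ⟨hc, hw ▸ hz⟩

theorem isRank_unique {a u u' : M} (h : IsRank a u) (h' : IsRank a u') : u = u' := by
  obtain ⟨ha, f, hf, hu⟩ := isRank_iff.1 h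
  obtain ⟨-, f', hf', hu'⟩ := isRank_iff.1 h'
  rw [hf.1.app_iff (self_mem_suc a)] at hu
  rw [hf'.1.app_iff (self_mem_suc a)] at hu'
  rw [← hu, ← hu']
  exact hf.ap_eq (isOrd_suc ha) (isOrd_suc ha) hf' (self_mem_suc a) (self_mem_suc a)

theorem RankFun.isRank {f s b : M} (hs : IsOrd s) (hf : RankFun f s) (hb : b ∈ₘ s) :
    IsRank b (ap f b) := by
  have hbo := hs.mem hb
  obtain ⟨f', hf', h⟩ := hf.restrict hs (isOrd_suc hbo) fun z hz => by
    rcases mem_suc.1 hz with hz | rfl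
    exacts [hs.trans hz hb, hb]
  exact isRank_iff.2 ⟨hbo, f', hf', (hf'.1.app_iff (self_mem_suc b)).2 (h b (self_mem_suc b))⟩

/-- Collection gathers the earlier stages into a set `C`. The new stage is then separated from the
power set of `⋃ C`, and the hierarchy up to `a` is the graph of the earlier stages with one more
value. -/
theorem exists_isRank {a : M} (ha : IsOrd a) : ∃ u, IsRank a u := by
  refine ha.induction (fun a => ∃ u, IsRank a u) fun a ha ih => ?_
  obtain ⟨C, hC⟩ := exists_collection a (fun b u => IsRank b u) ih
  let w := sep (pow (sUn C)) fun z => ∃ c x, c ∈ₘ a ∧ IsRank c x ∧ IsSubset z x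
  have hw : ∀ z, z ∈ₘ w ↔ ∃ c x, c ∈ₘ a ∧ IsRank c x ∧ IsSubset z x := fun z =>
    mem_sep.trans (and_iff_right_of_imp fun ⟨c, x, hc, hx, hz⟩ => mem_pow.2 fun u hu => by
      obtain ⟨y, hyC, hy⟩ := hC c hc
      rw [isRank_unique hx hy] at hz
      exact mem_sUn.2 ⟨y, hyC, hz u hu⟩)
  obtain ⟨f, hf⟩ := exists_sep (prod (suc a) (un C (upair w w))) fun p =>
    ∃ b u, p = pr b u ∧ (b ∈ₘ a ∧ IsRank b u ∨ b = a ∧ u = w)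
  have happ : ∀ b u, App f b u ↔ b ∈ₘ a ∧ IsRank b u ∨ b = a ∧ u = w := fun b u => by
    rw [app_iff, hf, pr_mem_prod]
    constructor
    · rintro ⟨-, b', u', h, h'⟩
      rw [pr_inj] at h
      rwa [h.1, h.2]
    · refine fun h => ⟨?_, b, u, rfl, h⟩
      rcases h with ⟨hb, hu⟩ | ⟨rfl, rfl⟩
      · obtain ⟨y, hyC, hy⟩ := hC b hb
        exact ⟨mem_suc.2 (Or.inl hb), mem_un.2 (Or.inl (isRank_unique hu hy ▸ hyC))⟩
      · exact ⟨self_mem_suc b, mem_un.2 (Or.inr (mem_upair.2 (Or.inl rfl)))⟩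
  have hfun : IsFunOn f (suc a) := by
    refine ⟨fun p hp => ?_, fun b hb => ?_⟩
    · obtain ⟨x, y, hx, -, rfl⟩ := mem_prod.1 ((hf p).1 hp).1
      exact ⟨x, y, hx, isOPair_iff.2 rfl⟩
    · simp only [happ]
      rcases mem_suc.1 hb with hb | rfl
      · obtain ⟨u, hu⟩ := ih b hb
        refine ⟨u, Or.inl ⟨hb, hu⟩, ?_⟩
        rintro y (⟨-, hy⟩ | ⟨rfl, -⟩)
        exacts [isRank_unique hy hu, absurd hb (mem_irrefl _)]
      · refine ⟨w, Or.inr ⟨rfl, rfl⟩, ?_⟩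
        rintro y (⟨hy, -⟩ | ⟨-, rfl⟩)
        exacts [absurd hy (mem_irrefl _), rfl]
  refine ⟨w, isRank_iff.2 ⟨ha, f, ⟨hfun, fun b u hb hu z => ?_⟩, (happ _ _).2 (Or.inr ⟨rfl, rfl⟩)⟩⟩
  rcases (happ b u).1 hu with ⟨hba, hr⟩ | ⟨rfl, rfl⟩
  · obtain ⟨hbo, g, hg, hgu⟩ := isRank_iff.1 hr
    rw [hg.2 b u (self_mem_suc b) hgu]
    refine exists_congr fun c => exists_congr fun x => and_congr_right fun hc => and_congr_left fun _ => ?_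
    have hcb : c ∈ₘ suc b := mem_suc.2 (Or.inl hc)
    have := hg.isRank (isOrd_suc hbo) hcb
    rw [happ, hg.1.app_iff hcb]
    constructor
    · rintro rfl
      exact Or.inl ⟨ha.trans hc hba, this⟩
    · rintro (⟨-, h⟩ | ⟨rfl, -⟩)
      exacts [isRank_unique this h, absurd hba (mem_asymm hc)]
  · rw [hw]
    refine exists_congr fun c => exists_congr fun x => and_congr_right fun hc => and_congr_left fun _ => ?_
    rw [happ]
    refine ⟨fun h => Or.inl ⟨hc, h⟩, ?_⟩
    rintro (h | ⟨rfl, -⟩)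
    exacts [h.2, absurd hc (mem_irrefl _)]

/-- `V_a`. -/
noncomputable def Vr (a : M) : M := the fun u => IsRank a u

instance {n : ℕ} {a : (Fin n → M) → M} [DefFun a] : DefFun fun v => Vr (a v) :=
  DefFun.comp_one (Dfn.congr (Q := fun v : Fin 2 → M =>
    (IsRank (v 0) (v 1) ∧ ∃! z, IsRank (v 0) z) ∨
      (¬ (∃! z, IsRank (v 0) z) ∧ v 1 = emp M)) inferInstance fun _ => eq_the_iff)

theorem isRank_Vr {a : M} (ha : IsOrd a) : IsRank a (Vr a) :=
  the_spec ((exists_isRank ha).elim fun u hu => ⟨u, hu, fun _ h => isRank_unique h hu⟩)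

theorem isRank_iff_eq {a u : M} : IsRank a u ↔ IsOrd a ∧ u = Vr a :=
  ⟨fun h => ⟨h.1, isRank_unique h (isRank_Vr h.1)⟩, fun h => h.2 ▸ isRank_Vr h.1⟩

theorem mem_Vr {a z : M} (ha : IsOrd a) : z ∈ₘ Vr a ↔ ∃ c, c ∈ₘ a ∧ IsSubset z (Vr c) := by
  obtain ⟨-, f, hf, hu⟩ := isRank_iff.1 (isRank_Vr ha)
  rw [hf.1.app_iff (self_mem_suc a)] at hu
  rw [← hu, hf.mem_ap_iff (isOrd_suc ha) (self_mem_suc a)]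
  refine exists_congr fun c => and_congr_right fun hc => ?_
  rw [(isRank_iff_eq.1 (hf.isRank (isOrd_suc ha) (mem_suc.2 (Or.inl hc)))).2]

theorem Vr_mono {a b : M} (ha : IsOrd a) (hb : IsOrd b) (h : IsSubset a b) :
    IsSubset (Vr a) (Vr b) := fun z hz => by
  rw [mem_Vr ha] at hz
  obtain ⟨c, hc, hz⟩ := hz
  exact (mem_Vr hb).2 ⟨c, h c hc, hz⟩

theorem Vr_mem_Vr {a b : M} (hb : IsOrd b) (h : a ∈ₘ b) : Vr a ∈ₘ Vr b :=
  (mem_Vr hb).2 ⟨a, h, IsSubset.refl _⟩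

theorem subset_mem_Vr {a x y : M} (ha : IsOrd a) (hx : x ∈ₘ Vr a) (h : IsSubset y x) :
    y ∈ₘ Vr a := by
  obtain ⟨c, hc, hx⟩ := (mem_Vr ha).1 hx
  exact (mem_Vr ha).2 ⟨c, hc, h.trans hx⟩

theorem Vr_trans {a x y : M} (ha : IsOrd a) (hx : x ∈ₘ Vr a) (hy : y ∈ₘ x) : y ∈ₘ Vr a := by
  obtain ⟨c, hc, hx⟩ := (mem_Vr ha).1 hx
  exact Vr_mono (ha.mem hc) ha (ha.1 c hc) y (hx y hy)

theorem mem_Vr_limit {a x : M} (ha : IsLimit a) : x ∈ₘ Vr a ↔ ∃ b, b ∈ₘ a ∧ x ∈ₘ Vr b := by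
  constructor
  · intro h
    obtain ⟨c, hc, hx⟩ := (mem_Vr ha.1).1 h
    exact ⟨suc c, ha.suc_mem hc, (mem_Vr (isOrd_suc (ha.1.mem hc))).2 ⟨c, self_mem_suc c, hx⟩⟩
  · rintro ⟨b, hb, hx⟩
    exact Vr_mono (ha.1.mem hb) ha.1 (ha.1.1 b hb) x hx

theorem subset_Vr_mem {a b x : M} (ha : IsOrd a) (hb : b ∈ₘ a) (h : IsSubset x (Vr b)) :
    x ∈ₘ Vr a :=
  (mem_Vr ha).2 ⟨b, hb, h⟩

theorem exists_Vr_two {a x y : M} (ha : IsLimit a) (hx : x ∈ₘ Vr a) (hy : y ∈ₘ Vr a) :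
    ∃ b, b ∈ₘ a ∧ x ∈ₘ Vr b ∧ y ∈ₘ Vr b := by
  obtain ⟨b, hb, hx⟩ := (mem_Vr_limit ha).1 hx
  obtain ⟨c, hc, hy⟩ := (mem_Vr_limit ha).1 hy
  have hbo := ha.1.mem hb
  have hco := ha.1.mem hc
  rcases hbo.trichotomy hco with h | rfl | h
  · exact ⟨c, hc, Vr_mono hbo hco (hco.1 _ h) x hx, hy⟩
  · exact ⟨b, hb, hx, hy⟩
  · exact ⟨b, hb, hx, Vr_mono hco hbo (hbo.1 _ h) y hy⟩

theorem upair_mem_Vr {a x y : M} (ha : IsLimit a) (hx : x ∈ₘ Vr a) (hy : y ∈ₘ Vr a) :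
    upair x y ∈ₘ Vr a := by
  obtain ⟨b, hb, hx, hy⟩ := exists_Vr_two ha hx hy
  refine subset_Vr_mem ha.1 hb fun z hz => ?_
  rcases mem_upair.1 hz with rfl | rfl
  exacts [hx, hy]

theorem pr_mem_Vr {a x y : M} (ha : IsLimit a) (hx : x ∈ₘ Vr a) (hy : y ∈ₘ Vr a) :
    pr x y ∈ₘ Vr a :=
  upair_mem_Vr ha (upair_mem_Vr ha hx hx) (upair_mem_Vr ha hx hy)

theorem of_pr_mem_Vr {a x y : M} (ha : IsOrd a) (h : pr x y ∈ₘ Vr a) : x ∈ₘ Vr a ∧ y ∈ₘ Vr a := by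
  have h1 : upair x y ∈ₘ Vr a := Vr_trans ha h (by simp [pr, mem_upair])
  exact ⟨Vr_trans ha h1 (by simp [mem_upair]), Vr_trans ha h1 (by simp [mem_upair])⟩

theorem sUn_mem_Vr {a x : M} (ha : IsOrd a) (hx : x ∈ₘ Vr a) : sUn x ∈ₘ Vr a := by
  obtain ⟨c, hc, hx⟩ := (mem_Vr ha).1 hx
  refine subset_Vr_mem ha hc fun z hz => ?_
  obtain ⟨y, hy, hz⟩ := mem_sUn.1 hz
  exact Vr_trans (ha.mem hc) (hx y hy) hz

theorem un_mem_Vr {a x y : M} (ha : IsLimit a) (hx : x ∈ₘ Vr a) (hy : y ∈ₘ Vr a) :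
    un x y ∈ₘ Vr a :=
  sUn_mem_Vr ha.1 (upair_mem_Vr ha hx hy)

theorem pow_mem_Vr {a x : M} (ha : IsLimit a) (hx : x ∈ₘ Vr a) : pow x ∈ₘ Vr a := by
  obtain ⟨b, hb, hx⟩ := (mem_Vr_limit ha).1 hx
  exact subset_Vr_mem ha.1 hb fun z hz => subset_mem_Vr (ha.1.mem hb) hx (mem_pow.1 hz)

theorem prod_mem_Vr {a x y : M} (ha : IsLimit a) (hx : x ∈ₘ Vr a) (hy : y ∈ₘ Vr a) :
    prod x y ∈ₘ Vr a := by
  refine subset_mem_Vr ha.1 (pow_mem_Vr ha (pow_mem_Vr ha (un_mem_Vr ha hx hy))) fun z hz => ?_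
  exact (mem_sep.1 hz).1

theorem ord_mem_Vr {a b : M} (ha : IsOrd a) (hb : b ∈ₘ a) : b ∈ₘ Vr a := by
  refine ha.induction (fun a => ∀ b, b ∈ₘ a → b ∈ₘ Vr a) (fun a ha ih b hb => ?_) b hb
  exact subset_Vr_mem ha hb (ih b hb)

theorem mem_of_mem_Vr {a b : M} (ha : IsOrd a) (hb : IsOrd b) (h : b ∈ₘ Vr a) : b ∈ₘ a := by
  refine ha.induction (fun a => ∀ b, IsOrd b → b ∈ₘ Vr a → b ∈ₘ a) (fun a ha ih b hb h => ?_) b hb h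
  obtain ⟨c, hc, hbc⟩ := (mem_Vr ha).1 h
  have : IsSubset b c := fun z hz => ih c hc z (hb.mem hz) (hbc z hz)
  rcases hb.subset_cases (ha.mem hc) this with rfl | h
  exacts [hc, ha.trans h hc]

end Rank
end RankToRank

namespace RankToRank

/-! ### Codes of formulas and induction on them. -/

section Formulas

variable {M : Type*} [setLang.Structure M] [hZ : ZF M]

variable (M) in
/-- The numeral `n`. -/
noncomputable def nm : ℕ → M
  | 0 => emp M
  | n + 1 => suc (nm n)

theorem isNumeral_iff {n : ℕ} {x : M} : IsNumeral n x ↔ x = nm M n := by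
  induction n generalizing x with
  | zero => exact isEmp_iff
  | succ n ih => simp [IsNumeral, ih, isSucc_iff, nm]

theorem nm_mem_om (n : ℕ) : nm M n ∈ₘ om M := by
  induction n with
  | zero => exact isLimit_om.emp_mem
  | succ n ih => exact isLimit_om.suc_mem ih

@[simp] theorem nm_inj {m n : ℕ} : nm M m = nm M n ↔ m = n := by
  refine ⟨fun h => ?_, fun h => h ▸ rfl⟩
  induction m generalizing n with
  | zero =>
    cases n with
    | zero => rfl
    | succ n => exact absurd h.symm (suc_ne_emp _)
  | succ m ih =>
    cases n with
    | zero => exact absurd h (suc_ne_emp _)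
    | succ n => rw [ih (suc_inj.1 h)]

/-- The formula with tag `n` and immediate constituents `x` and `y`. -/
noncomputable def tg (n : ℕ) (x y : M) : M := pr (nm M n) (pr x y)

@[simp] theorem tg_inj {m n : ℕ} {x y x' y' : M} :
    tg m x y = tg n x' y' ↔ m = n ∧ x = x' ∧ y = y' := by simp [tg]

instance {k n : ℕ} {a b : (Fin n → M) → M} [DefFun a] [DefFun b] :
    DefFun fun v => tg k (a v) (b v) :=
  inferInstanceAs (DefFun fun v => pr (nm M k) (pr (a v) (b v)))

theorem isTagged_iff {n : ℕ} {x y c : M} : IsTagged n x y c ↔ c = tg n x y := by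
  simp [IsTagged, isNumeral_iff, isOPair_iff, tg]

theorem tg_mem_Vr {a x y : M} (ha : IsLimit a) (n : ℕ) (hx : x ∈ₘ Vr a) (hy : y ∈ₘ Vr a) :
    tg n x y ∈ₘ Vr a :=
  pr_mem_Vr ha (ord_mem_Vr ha.1 (ha.om_subset _ (nm_mem_om n))) (pr_mem_Vr ha hx hy)

@[simp] theorem isMemCode_iff {i k c : M} : IsMemCode i k c ↔ c = tg 0 i k := isTagged_iff
@[simp] theorem isEqCode_iff {i k c : M} : IsEqCode i k c ↔ c = tg 1 i k := isTagged_iff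
@[simp] theorem isNegCode_iff {a c : M} : IsNegCode a c ↔ c = tg 2 a a := isTagged_iff
@[simp] theorem isAndCode_iff {a b c : M} : IsAndCode a b c ↔ c = tg 3 a b := isTagged_iff
@[simp] theorem isExCode_iff {i a c : M} : IsExCode i a c ↔ c = tg 4 i a := isTagged_iff

@[simp] theorem isBddExCode_iff {i k a c : M} :
    IsBddExCode i k a c ↔ c = tg 4 i (tg 3 (tg 0 i k) a) := by
  simp [IsBddExCode]

theorem boolClosed_iff {X : M} : BoolClosed X ↔
    (∀ i k, i ∈ₘ om M → k ∈ₘ om M → tg 0 i k ∈ₘ X) ∧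
    (∀ i k, i ∈ₘ om M → k ∈ₘ om M → tg 1 i k ∈ₘ X) ∧
    (∀ a, a ∈ₘ X → tg 2 a a ∈ₘ X) ∧ ∀ a b, a ∈ₘ X → b ∈ₘ X → tg 3 a b ∈ₘ X := by
  simp [BoolClosed, isNat_iff]
  grind

theorem isFormula_iff {c : M} : IsFormula c ↔ ∀ X : M, BoolClosed X →
    (∀ i a, i ∈ₘ om M → a ∈ₘ X → tg 4 i a ∈ₘ X) → c ∈ₘ X := by
  simp [IsFormula, isNat_iff]
  grind

theorem isSigma0_iff {c : M} : IsSigma0 c ↔ ∀ X : M, BoolClosed X →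
    (∀ i k a, i ∈ₘ om M → k ∈ₘ om M → i ≠ k → a ∈ₘ X → tg 4 i (tg 3 (tg 0 i k) a) ∈ₘ X) →
    c ∈ₘ X := by
  simp [IsSigma0, isNat_iff]
  grind

theorem exClosure_iff {P : M → Prop} {c : M} : ExClosure P c ↔ ∀ X : M, (∀ a, P a → a ∈ₘ X) →
    (∀ i a, i ∈ₘ om M → a ∈ₘ X → tg 4 i a ∈ₘ X) → c ∈ₘ X := by
  simp [ExClosure, isNat_iff]
  grind

section closure
variable {i k a b : M}

theorem isFormula_tg_zero (hi : i ∈ₘ om M) (hk : k ∈ₘ om M) : IsFormula (tg 0 i k) :=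
  isFormula_iff.2 fun _ hX _ => (boolClosed_iff.1 hX).1 i k hi hk
theorem isFormula_tg_one (hi : i ∈ₘ om M) (hk : k ∈ₘ om M) : IsFormula (tg 1 i k) :=
  isFormula_iff.2 fun _ hX _ => (boolClosed_iff.1 hX).2.1 i k hi hk
theorem isFormula_tg_two (ha : IsFormula a) : IsFormula (tg 2 a a) :=
  isFormula_iff.2 fun X hX hX' => (boolClosed_iff.1 hX).2.2.1 a (isFormula_iff.1 ha X hX hX')
theorem isFormula_tg_three (ha : IsFormula a) (hb : IsFormula b) : IsFormula (tg 3 a b) :=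
  isFormula_iff.2 fun X hX hX' => (boolClosed_iff.1 hX).2.2.2 a b (isFormula_iff.1 ha X hX hX')
    (isFormula_iff.1 hb X hX hX')
theorem isFormula_tg_four (hi : i ∈ₘ om M) (ha : IsFormula a) : IsFormula (tg 4 i a) :=
  isFormula_iff.2 fun X hX hX' => hX' i a hi (isFormula_iff.1 ha X hX hX')

theorem isSigma0_tg_zero (hi : i ∈ₘ om M) (hk : k ∈ₘ om M) : IsSigma0 (tg 0 i k) :=
  isSigma0_iff.2 fun _ hX _ => (boolClosed_iff.1 hX).1 i k hi hk
theorem isSigma0_tg_one (hi : i ∈ₘ om M) (hk : k ∈ₘ om M) : IsSigma0 (tg 1 i k) :=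
  isSigma0_iff.2 fun _ hX _ => (boolClosed_iff.1 hX).2.1 i k hi hk
theorem isSigma0_tg_two (ha : IsSigma0 a) : IsSigma0 (tg 2 a a) :=
  isSigma0_iff.2 fun X hX hX' => (boolClosed_iff.1 hX).2.2.1 a (isSigma0_iff.1 ha X hX hX')
theorem isSigma0_tg_three (ha : IsSigma0 a) (hb : IsSigma0 b) : IsSigma0 (tg 3 a b) :=
  isSigma0_iff.2 fun X hX hX' => (boolClosed_iff.1 hX).2.2.2 a b (isSigma0_iff.1 ha X hX hX')
    (isSigma0_iff.1 hb X hX hX')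
theorem isSigma0_tg_four (hi : i ∈ₘ om M) (hk : k ∈ₘ om M) (h : i ≠ k) (ha : IsSigma0 a) :
    IsSigma0 (tg 4 i (tg 3 (tg 0 i k) a)) :=
  isSigma0_iff.2 fun X hX hX' => hX' i k a hi hk h (isSigma0_iff.1 ha X hX hX')

theorem exClosure_of {P : M → Prop} (ha : P a) : ExClosure P a :=
  exClosure_iff.2 fun _ hX _ => hX a ha
theorem exClosure_tg_four {P : M → Prop} (hi : i ∈ₘ om M) (ha : ExClosure P a) :
    ExClosure P (tg 4 i a) :=
  exClosure_iff.2 fun X hX hX' => hX' i a hi (exClosure_iff.1 ha X hX hX')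

end closure

/-- `V_ω` is closed under the formation of codes, so the codes in `V_ω` that are formulas with
property `P` form a set, to which the definition of a formula as a member of every closed set
applies. Induction inside `M` also reaches nonstandard codes. -/
theorem formula_induction (P : M → Prop) [Dfn fun v : Fin 1 → M => P (v 0)]
    (h0 : ∀ i k, i ∈ₘ om M → k ∈ₘ om M → P (tg 0 i k))
    (h1 : ∀ i k, i ∈ₘ om M → k ∈ₘ om M → P (tg 1 i k))
    (h2 : ∀ a, IsFormula a → P a → P (tg 2 a a))
    (h3 : ∀ a b, IsFormula a → IsFormula b → P a → P b → P (tg 3 a b))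
    (h4 : ∀ i a, i ∈ₘ om M → IsFormula a → P a → P (tg 4 i a)) {c : M} (hc : IsFormula c) :
    P c := by
  have hom : ∀ {i : M}, i ∈ₘ om M → i ∈ₘ Vr (om M) := fun hi => ord_mem_Vr isLimit_om.1 hi
  have := isFormula_iff.1 hc (sep (Vr (om M)) fun x => IsFormula x ∧ P x)
    (boolClosed_iff.2 ⟨?_, ?_, ?_, ?_⟩) ?_
  · exact (mem_sep.1 this).2.2
  · exact fun i k hi hk => mem_sep.2 ⟨tg_mem_Vr isLimit_om 0 (hom hi) (hom hk),
      isFormula_tg_zero hi hk, h0 i k hi hk⟩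
  · exact fun i k hi hk => mem_sep.2 ⟨tg_mem_Vr isLimit_om 1 (hom hi) (hom hk),
      isFormula_tg_one hi hk, h1 i k hi hk⟩
  · intro a ha
    obtain ⟨ha, hf, hp⟩ := mem_sep.1 ha
    exact mem_sep.2 ⟨tg_mem_Vr isLimit_om 2 ha ha, isFormula_tg_two hf, h2 a hf hp⟩
  · intro a b ha hb
    obtain ⟨ha, hf, hp⟩ := mem_sep.1 ha
    obtain ⟨hb, hf', hp'⟩ := mem_sep.1 hb
    exact mem_sep.2 ⟨tg_mem_Vr isLimit_om 3 ha hb, isFormula_tg_three hf hf', h3 a b hf hf' hp hp'⟩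
  · intro i a hi ha
    obtain ⟨ha, hf, hp⟩ := mem_sep.1 ha
    exact mem_sep.2 ⟨tg_mem_Vr isLimit_om 4 (hom hi) ha, isFormula_tg_four hi hf, h4 i a hi hf hp⟩

theorem formula_mem_Vr_om {c : M} (hc : IsFormula c) : c ∈ₘ Vr (om M) := by
  have hom : ∀ {i : M}, i ∈ₘ om M → i ∈ₘ Vr (om M) := fun hi => ord_mem_Vr isLimit_om.1 hi
  exact formula_induction (fun c => c ∈ₘ Vr (om M))
    (fun i k hi hk => tg_mem_Vr isLimit_om 0 (hom hi) (hom hk))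
    (fun i k hi hk => tg_mem_Vr isLimit_om 1 (hom hi) (hom hk))
    (fun a _ ha => tg_mem_Vr isLimit_om 2 ha ha)
    (fun a b _ _ ha hb => tg_mem_Vr isLimit_om 3 ha hb)
    (fun i a hi _ ha => tg_mem_Vr isLimit_om 4 (hom hi) ha) hc

variable (M) in
/-- The set of all formulas. -/
noncomputable def Fml : M := sep (Vr (om M)) fun c => IsFormula c

theorem mem_Fml {c : M} : c ∈ₘ Fml M ↔ IsFormula c :=
  mem_sep.trans (and_iff_right_of_imp formula_mem_Vr_om)

theorem sigma0_induction (P : M → Prop) [Dfn fun v : Fin 1 → M => P (v 0)]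
    (h0 : ∀ i k, i ∈ₘ om M → k ∈ₘ om M → P (tg 0 i k))
    (h1 : ∀ i k, i ∈ₘ om M → k ∈ₘ om M → P (tg 1 i k))
    (h2 : ∀ a, IsFormula a → P a → P (tg 2 a a))
    (h3 : ∀ a b, IsFormula a → IsFormula b → P a → P b → P (tg 3 a b))
    (h4 : ∀ i k a, i ∈ₘ om M → k ∈ₘ om M → i ≠ k → IsFormula a → P a →
      P (tg 4 i (tg 3 (tg 0 i k) a))) {c : M} (hc : IsSigma0 c) : IsFormula c ∧ P c := by
  have key := isSigma0_iff.1 hc (sep (Fml M) fun x => P x)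
    (boolClosed_iff.2 ⟨?_, ?_, ?_, ?_⟩) ?_
  · exact ⟨mem_Fml.1 (mem_sep.1 key).1, (mem_sep.1 key).2⟩
  all_goals simp only [mem_sep, mem_Fml]
  · exact fun i k hi hk => ⟨isFormula_tg_zero hi hk, h0 i k hi hk⟩
  · exact fun i k hi hk => ⟨isFormula_tg_one hi hk, h1 i k hi hk⟩
  · exact fun a ha => ⟨isFormula_tg_two ha.1, h2 a ha.1 ha.2⟩
  · exact fun a b ha hb => ⟨isFormula_tg_three ha.1 hb.1, h3 a b ha.1 hb.1 ha.2 hb.2⟩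
  · exact fun i k a hi hk hik ha => ⟨isFormula_tg_four hi (isFormula_tg_three
      (isFormula_tg_zero hi hk) ha.1), h4 i k a hi hk hik ha.1 ha.2⟩

theorem IsSigma0.isFormula {c : M} (hc : IsSigma0 c) : IsFormula c :=
  (sigma0_induction (fun _ => True) (by simp) (by simp) (by simp) (by simp) (by simp) hc).1

theorem exClosure_induction {Q : M → Prop} (hQ : ∀ a, Q a → IsFormula a) (P : M → Prop)
    [Dfn fun v : Fin 1 → M => P (v 0)] (h : ∀ a, Q a → P a)
    (h4 : ∀ i a, i ∈ₘ om M → IsFormula a → P a → P (tg 4 i a)) {c : M} (hc : ExClosure Q c) :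
    IsFormula c ∧ P c := by
  have key := exClosure_iff.1 hc (sep (Fml M) fun x => P x) ?_ ?_
  · exact ⟨mem_Fml.1 (mem_sep.1 key).1, (mem_sep.1 key).2⟩
  all_goals simp only [mem_sep, mem_Fml]
  · exact fun a ha => ⟨hQ a ha, h a ha⟩
  · exact fun i a hi ha => ⟨isFormula_tg_four hi ha.1, h4 i a hi ha.1 ha.2⟩

end Formulas

/-! ### Assignments and satisfaction -/

section Satisfaction

variable {M : Type*} [setLang.Structure M] [hZ : ZF M]

theorem isAssignment_iff {s A : M} : IsAssignment s A ↔ IsFun s (om M) A := by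
  simp [IsAssignment, isOmega_iff]

theorem IsFun.subset_prod {s a b : M} (h : IsFun s a b) : IsSubset s (prod a b) := fun p hp => by
  obtain ⟨x, y, hx, hp'⟩ := h.1.1 p hp
  rw [isOPair_iff] at hp'
  subst hp'
  exact pr_mem_prod.2 ⟨hx, h.2 x y (app_iff.2 hp)⟩

theorem IsFun.mono {s a b c : M} (h : IsFun s a b) (hbc : IsSubset b c) : IsFun s a c :=
  ⟨h.1, fun x y hxy => hbc y (h.2 x y hxy)⟩

/-- The set of all functions from `a` to `b`. -/
noncomputable def funs (a b : M) : M := sep (pow (prod a b)) fun s => IsFun s a b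

theorem mem_funs {a b s : M} : s ∈ₘ funs a b ↔ IsFun s a b :=
  mem_sep.trans (and_iff_right_of_imp fun h => mem_pow.2 h.subset_prod)

/-- The function `s` with its value at `i` changed to `x`. -/
noncomputable def upd (s i x : M) : M :=
  un (sep s fun p => ∃ k y, k ≠ i ∧ p = pr k y) (upair (pr i x) (pr i x))

theorem mem_upd {s i x p : M} :
    p ∈ₘ upd s i x ↔ (p ∈ₘ s ∧ ∃ k y, k ≠ i ∧ p = pr k y) ∨ p = pr i x := by
  rw [upd, mem_un, mem_sep, mem_upair, or_self]

instance {n : ℕ} {a b c : (Fin n → M) → M} [DefFun a] [DefFun b] [DefFun c] :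
    DefFun fun v => upd (a v) (b v) (c v) :=
  DefFun.comp_three (Dfn.congr (Q := fun v : Fin 4 → M => ∀ p, p ∈ₘ v 3 ↔
    (p ∈ₘ v 0 ∧ ∃ k y, k ≠ v 1 ∧ p = pr k y) ∨ p = pr (v 1) (v 2)) inferInstance
    fun _ => ⟨fun h _ => h ▸ mem_upd, fun h => ext fun p => (h p).trans mem_upd.symm⟩)

theorem app_upd {s i x k y : M} :
    App (upd s i x) k y ↔ (k ≠ i ∧ App s k y) ∨ (k = i ∧ y = x) := by
  rw [app_iff, app_iff, mem_upd]
  simp only [pr_inj]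
  constructor
  · rintro (⟨h, k', y', h1, h2, -⟩ | h)
    exacts [Or.inl ⟨h2 ▸ h1, h⟩, Or.inr h]
  · rintro (⟨h1, h2⟩ | h)
    exacts [Or.inl ⟨h2, k, y, h1, rfl, rfl⟩, Or.inr h]

theorem IsFun.upd {s i x a b : M} (hs : IsFun s a b) (hi : i ∈ₘ a) (hx : x ∈ₘ b) :
    IsFun (upd s i x) a b := by
  refine ⟨⟨fun p hp => ?_, fun k hk => ?_⟩, fun k y hy => ?_⟩
  · rcases mem_upd.1 hp with ⟨h, -⟩ | rfl
    exacts [hs.1.1 p h, ⟨i, x, hi, isOPair_iff.2 rfl⟩]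
  · simp only [app_upd]
    by_cases hki : k = i
    · exact ⟨x, by simp [hki], by simp [hki]⟩
    · simpa [hki] using hs.1.2 k hk
  · rcases app_upd.1 hy with ⟨-, h⟩ | ⟨-, rfl⟩
    exacts [hs.2 k y h, hx]

theorem ap_upd_self {s i x a b : M} (hs : IsFun s a b) (hi : i ∈ₘ a) (hx : x ∈ₘ b) :
    ap (upd s i x) i = x :=
  ((hs.upd hi hx).1.app_iff hi).1 (app_upd.2 (by simp))

theorem ap_upd_of_ne {s i x a b k : M} (hs : IsFun s a b) (hi : i ∈ₘ a) (hx : x ∈ₘ b)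
    (hk : k ∈ₘ a) (h : k ≠ i) : ap (upd s i x) k = ap s k :=
  ((hs.upd hi hx).1.app_iff hk).1 (app_upd.2 (Or.inl ⟨h, app_ap hs.1 hk⟩))

theorem agreeOff_iff {s t i A : M} (hs : IsFun s (om M) A) (ht : IsFun t (om M) A)
    (hi : i ∈ₘ om M) : AgreeOff i s t ↔ t = upd s i (ap t i) := by
  have hx := ht.ap_mem hi
  constructor
  · intro h
    refine ht.1.ext (hs.upd hi hx).1 fun k hk => ?_
    by_cases hki : k = i
    · rw [hki, ap_upd_self hs hi hx]
    · rw [ap_upd_of_ne hs hi hx hk hki]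
      exact (ht.1.app_iff hk).1 ((h k (isNat_iff.2 hk) hki _).1 (app_ap hs.1 hk))
  · intro h k hk hki x
    rw [h, app_upd]
    simp [hki]

/-- `b` is an immediate subformula of `c`. -/
def ImmSub (b c : M) : Prop :=
  c = tg 2 b b ∨ (∃ a, c = tg 3 b a ∨ c = tg 3 a b) ∨ ∃ i, c = tg 4 i b

/-- One step of Tarski's recursion. -/
def TruthStep (A c T s : M) : Prop :=
  (∃ i k, i ∈ₘ om M ∧ k ∈ₘ om M ∧ c = tg 0 i k ∧ ap s i ∈ₘ ap s k) ∨
  (∃ i k, i ∈ₘ om M ∧ k ∈ₘ om M ∧ c = tg 1 i k ∧ ap s i = ap s k) ∨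
  (∃ a, IsFormula a ∧ c = tg 2 a a ∧ ¬ App T a s) ∨
  (∃ a b, IsFormula a ∧ IsFormula b ∧ c = tg 3 a b ∧ App T a s ∧ App T b s) ∨
  ∃ i a, i ∈ₘ om M ∧ IsFormula a ∧ c = tg 4 i a ∧ ∃ x, x ∈ₘ A ∧ App T a (upd s i x)

/-- Tarski's clauses, for assignments into `A`. -/
theorem isTruthSet_iff {A T : M} : IsTruthSet A T ↔ ∀ s, IsFun s (om M) A →
    (∀ i k, i ∈ₘ om M → k ∈ₘ om M → (App T (tg 0 i k) s ↔ ap s i ∈ₘ ap s k)) ∧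
    (∀ i k, i ∈ₘ om M → k ∈ₘ om M → (App T (tg 1 i k) s ↔ ap s i = ap s k)) ∧
    (∀ a, IsFormula a → (App T (tg 2 a a) s ↔ ¬ App T a s)) ∧
    (∀ a b, IsFormula a → IsFormula b → (App T (tg 3 a b) s ↔ App T a s ∧ App T b s)) ∧
    ∀ i a, i ∈ₘ om M → IsFormula a →
      (App T (tg 4 i a) s ↔ ∃ x, x ∈ₘ A ∧ App T a (upd s i x)) := by
  unfold IsTruthSet
  simp only [isAssignment_iff, isNat_iff, isMemCode_iff, isEqCode_iff, isNegCode_iff,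
    isAndCode_iff, isExCode_iff]
  refine forall_congr' fun s => imp_congr_right fun hs => and_congr ?_ (and_congr ?_ (and_congr ?_
    (and_congr ?_ ?_)))
  · refine forall_congr' fun i => forall_congr' fun k => ⟨fun h hi hk => ?_, fun h c hi hk hc => ?_⟩
    · rw [h _ hi hk rfl]
      simp [hs.1.app_iff hi, hs.1.app_iff hk]
    · subst hc
      rw [h hi hk]
      simp [hs.1.app_iff hi, hs.1.app_iff hk]
  · refine forall_congr' fun i => forall_congr' fun k => ⟨fun h hi hk => ?_, fun h c hi hk hc => ?_⟩
    · rw [h _ hi hk rfl]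
      simp [hs.1.app_iff hi, hs.1.app_iff hk, eq_comm]
    · subst hc
      rw [h hi hk]
      simp [hs.1.app_iff hi, hs.1.app_iff hk, eq_comm]
  · exact ⟨fun h a ha => h a _ ha rfl, fun h a c ha hc => hc ▸ h a ha⟩
  · exact ⟨fun h a b ha hb => h a b _ ha hb rfl, fun h a b c ha hb hc => hc ▸ h a b ha hb⟩
  · refine forall_congr' fun i => forall_congr' fun a => ?_
    have key : i ∈ₘ om M → ((∃ t, IsFun t (om M) A ∧ AgreeOff i s t ∧ App T a t) ↔
        ∃ x, x ∈ₘ A ∧ App T a (upd s i x)) := fun hi => by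
      constructor
      · rintro ⟨t, ht, h1, h2⟩
        rw [agreeOff_iff hs ht hi] at h1
        exact ⟨_, ht.ap_mem hi, h1 ▸ h2⟩
      · rintro ⟨x, hx, h⟩
        exact ⟨_, hs.upd hi hx, (agreeOff_iff hs (hs.upd hi hx) hi).2
          (by rw [ap_upd_self hs hi hx]), h⟩
    exact ⟨fun h hi ha => (h _ hi ha rfl).trans (key hi),
      fun h c hi ha hc => hc ▸ (h hi ha).trans (key hi).symm⟩

/-- Recursion along immediate subformulas. The object constructed is a relation, not a function: the
values at a code are the assignments that satisfy it. -/
theorem exists_isTruthSet (A : M) : ∃ T, IsTruthSet A T := by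
  have h1 : Dfn fun v : Fin 2 → M => ImmSub (v 0) (v 1) := by unfold ImmSub; infer_instance
  have h2 : Dfn fun v : Fin 3 → M => TruthStep A (v 0) (v 1) (v 2) := by
    unfold TruthStep
    infer_instance
  obtain ⟨T, hT⟩ := exists_recursion (Fml M) (funs (om M) A) ImmSub (TruthStep A)
    (fun X hX a ha => formula_induction (fun a => a ∈ₘ X)
      (fun i k hi hk => hX _ (mem_Fml.2 (isFormula_tg_zero hi hk)) (by simp [ImmSub]))
      (fun i k hi hk => hX _ (mem_Fml.2 (isFormula_tg_one hi hk)) (by simp [ImmSub]))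
      (fun a ha hX' => hX _ (mem_Fml.2 (isFormula_tg_two ha)) (by simp [ImmSub]; grind))
      (fun a b ha hb hX' hX'' => hX _ (mem_Fml.2 (isFormula_tg_three ha hb)) (by
        simp [ImmSub]; grind))
      (fun i a hi ha hX' => hX _ (mem_Fml.2 (isFormula_tg_four hi ha)) (by
        simp [ImmSub]; grind)) (mem_Fml.1 ha))
    (fun c G G' hc h s => by
      unfold TruthStep
      refine or_congr Iff.rfl (or_congr Iff.rfl (or_congr ?_ (or_congr ?_ ?_)))
      · refine exists_congr fun a => and_congr_right fun ha => and_congr_right fun hca => ?_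
        rw [h a (mem_Fml.2 ha) (Or.inl hca)]
      · refine exists_congr fun a => exists_congr fun b => and_congr_right fun ha =>
          and_congr_right fun hb => and_congr_right fun hca => ?_
        rw [h a (mem_Fml.2 ha) (Or.inr (Or.inl ⟨b, Or.inl hca⟩)),
          h b (mem_Fml.2 hb) (Or.inr (Or.inl ⟨a, Or.inr hca⟩))]
      · refine exists_congr fun i => exists_congr fun a => and_congr_right fun hi =>
          and_congr_right fun ha => and_congr_right fun hca => ?_
        simp only [h a (mem_Fml.2 ha) (Or.inr (Or.inr ⟨i, hca⟩))])
  refine ⟨T, isTruthSet_iff.2 fun s hs => ?_⟩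
  have hs' := mem_funs.2 hs
  refine ⟨fun i k hi hk => ?_, fun i k hi hk => ?_, fun a ha => ?_, fun a b ha hb => ?_,
    fun i a hi ha => ?_⟩
  · rw [hT, and_iff_right (mem_Fml.2 (isFormula_tg_zero hi hk)), and_iff_right hs']
    simp [TruthStep, hi, hk]
  · rw [hT, and_iff_right (mem_Fml.2 (isFormula_tg_one hi hk)), and_iff_right hs']
    simp [TruthStep, hi, hk]
  · rw [hT, and_iff_right (mem_Fml.2 (isFormula_tg_two ha)), and_iff_right hs']
    simp [TruthStep, ha]
  · rw [hT, and_iff_right (mem_Fml.2 (isFormula_tg_three ha hb)), and_iff_right hs']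
    simp [TruthStep]
    grind
  · rw [hT, and_iff_right (mem_Fml.2 (isFormula_tg_four hi ha)), and_iff_right hs']
    simp [TruthStep]
    grind

/-- Makes `Sat`, which asks for some truth set, computable from any given one. -/
theorem IsTruthSet.unique {A T T' c : M} (hT : IsTruthSet A T) (hT' : IsTruthSet A T')
    (hc : IsFormula c) : ∀ s, IsFun s (om M) A → (App T c s ↔ App T' c s) := by
  rw [isTruthSet_iff] at hT hT'
  refine formula_induction (fun c => ∀ s, IsFun s (om M) A → (App T c s ↔ App T' c s))
    (fun i k hi hk s hs => ?_) (fun i k hi hk s hs => ?_) (fun a ha ih s hs => ?_)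
    (fun a b ha hb iha ihb s hs => ?_) (fun i a hi ha ih s hs => ?_) hc
  · rw [(hT s hs).1 i k hi hk, (hT' s hs).1 i k hi hk]
  · rw [(hT s hs).2.1 i k hi hk, (hT' s hs).2.1 i k hi hk]
  · rw [(hT s hs).2.2.1 a ha, (hT' s hs).2.2.1 a ha, ih s hs]
  · rw [(hT s hs).2.2.2.1 a b ha hb, (hT' s hs).2.2.2.1 a b ha hb, iha s hs, ihb s hs]
  · rw [(hT s hs).2.2.2.2 i a hi ha, (hT' s hs).2.2.2.2 i a hi ha]
    exact exists_congr fun x => and_congr_right fun hx => ih _ (hs.upd hi hx)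

theorem IsTruthSet.sat_iff {A T c s : M} (hT : IsTruthSet A T) (hc : IsFormula c)
    (hs : IsFun s (om M) A) : Sat A c s ↔ App T c s :=
  ⟨fun ⟨_, hT', h⟩ => (hT'.unique hT hc s hs).1 h, fun h => ⟨T, hT, h⟩⟩

section
variable {A s i k a b : M}

theorem sat_tg_zero (hs : IsFun s (om M) A) (hi : i ∈ₘ om M) (hk : k ∈ₘ om M) :
    Sat A (tg 0 i k) s ↔ ap s i ∈ₘ ap s k := by
  obtain ⟨T, hT⟩ := exists_isTruthSet A
  rw [hT.sat_iff (isFormula_tg_zero hi hk) hs]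
  exact (isTruthSet_iff.1 hT s hs).1 i k hi hk

theorem sat_tg_one (hs : IsFun s (om M) A) (hi : i ∈ₘ om M) (hk : k ∈ₘ om M) :
    Sat A (tg 1 i k) s ↔ ap s i = ap s k := by
  obtain ⟨T, hT⟩ := exists_isTruthSet A
  rw [hT.sat_iff (isFormula_tg_one hi hk) hs]
  exact (isTruthSet_iff.1 hT s hs).2.1 i k hi hk

theorem sat_tg_two (hs : IsFun s (om M) A) (ha : IsFormula a) : Sat A (tg 2 a a) s ↔ ¬ Sat A a s := by
  obtain ⟨T, hT⟩ := exists_isTruthSet A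
  rw [hT.sat_iff (isFormula_tg_two ha) hs, hT.sat_iff ha hs]
  exact (isTruthSet_iff.1 hT s hs).2.2.1 a ha

theorem sat_tg_three (hs : IsFun s (om M) A) (ha : IsFormula a)
    (hb : IsFormula b) :
    Sat A (tg 3 a b) s ↔ Sat A a s ∧ Sat A b s := by
  obtain ⟨T, hT⟩ := exists_isTruthSet A
  rw [hT.sat_iff (isFormula_tg_three ha hb) hs, hT.sat_iff ha hs, hT.sat_iff hb hs]
  exact (isTruthSet_iff.1 hT s hs).2.2.2.1 a b ha hb

theorem sat_tg_four (hs : IsFun s (om M) A) (hi : i ∈ₘ om M) (ha : IsFormula a) :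
    Sat A (tg 4 i a) s ↔ ∃ x, x ∈ₘ A ∧ Sat A a (upd s i x) := by
  obtain ⟨T, hT⟩ := exists_isTruthSet A
  rw [hT.sat_iff (isFormula_tg_four hi ha) hs, (isTruthSet_iff.1 hT s hs).2.2.2.2 i a hi ha]
  exact exists_congr fun x => and_congr_right fun hx =>
    (hT.sat_iff ha (hs.upd hi hx)).symm

end

end Satisfaction
end RankToRank

namespace RankToRank

/-! ### Standard formulas and their codes -/

/-- Formulas of the language of set theory, with named variables. -/
inductive Fm : Type
  | mem (i k : ℕ) : Fm
  | eq (i k : ℕ) : Fm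
  | neg (a : Fm) : Fm
  | and (a b : Fm) : Fm
  | ex (i : ℕ) (a : Fm) : Fm

/-- Bounded formulas. -/
inductive Fm.Bdd : Fm → Prop
  | mem (i k : ℕ) : Bdd (Fm.mem i k)
  | eq (i k : ℕ) : Bdd (Fm.eq i k)
  | neg {a : Fm} : Bdd a → Bdd a.neg
  | and {a b : Fm} : Bdd a → Bdd b → Bdd (a.and b)
  | bex {i k : ℕ} {a : Fm} : i ≠ k → Bdd a → Bdd (Fm.ex i ((Fm.mem i k).and a))

section Standard

variable {M : Type*} [setLang.Structure M]

/-- Truth of a formula, with all quantifiers relativized to `D`. -/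
def Fm.Real (D : M → Prop) : Fm → (ℕ → M) → Prop
  | mem i k, v => v i ∈ₘ v k
  | eq i k, v => v i = v k
  | neg a, v => ¬ a.Real D v
  | and a b, v => a.Real D v ∧ b.Real D v
  | ex i a, v => ∃ x, D x ∧ a.Real D (Function.update v i x)

theorem Fm.Bdd.absolute {A : M} (hA : ∀ x y, x ∈ₘ A → y ∈ₘ x → y ∈ₘ A) {φ : Fm} (hφ : φ.Bdd) :
    ∀ v : ℕ → M, (∀ i, v i ∈ₘ A) → (φ.Real (· ∈ₘ A) v ↔ φ.Real (fun _ => True) v) := by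
  induction hφ with
  | mem i k => exact fun v _ => Iff.rfl
  | eq i k => exact fun v _ => Iff.rfl
  | neg _ ih => exact fun v hv => not_congr (ih v hv)
  | and _ _ ih ih' => exact fun v hv => and_congr (ih v hv) (ih' v hv)
  | @bex i k a hik _ ih =>
    intro v hv
    simp only [Fm.Real, Function.update_self, Function.update_of_ne hik.symm, true_and]
    have hupd : ∀ x, x ∈ₘ A → ∀ m, Function.update v i x m ∈ₘ A := fun x hx m => by
      by_cases h : m = i
      · subst h; simpa using hx
      · simpa [Function.update_of_ne h] using hv m
    constructor
    · rintro ⟨x, hx, hxk, h⟩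
      exact ⟨x, hxk, (ih _ (hupd x hx)).1 h⟩
    · rintro ⟨x, hxk, h⟩
      have hx := hA _ _ (hv k) hxk
      exact ⟨x, hx, hxk, (ih _ (hupd x hx)).2 h⟩

/-- `t` is a coordinate projection. -/
class IsVar {n : ℕ} (t : (Fin n → M) → M) : Prop where
  out : ∃ i, t = fun v => v i

/-- `P` is defined by a bounded formula, whatever names its variables are given. -/
class D0 {n : ℕ} (P : (Fin n → M) → Prop) : Prop where
  out : ∀ {k : ℕ} (σ : Fin n → Fin k), ∃ φ : Fm, φ.Bdd ∧
    ∀ v : ℕ → M, P (fun i => v (σ i)) ↔ φ.Real (fun _ => True) v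

namespace D0

variable {n : ℕ}

instance isVar (i : Fin n) : IsVar fun v : Fin n → M => v i := ⟨i, rfl⟩

theorem reindex {m : ℕ} {P : (Fin m → M) → Prop} (hP : D0 P) (σ : Fin m → Fin n) :
    D0 fun v => P fun i => v (σ i) :=
  ⟨fun τ => hP.out fun i => τ (σ i)⟩

theorem congr {P Q : (Fin n → M) → Prop} (hQ : D0 Q) (h : ∀ v, P v ↔ Q v) : D0 P :=
  ⟨fun σ => (hQ.out σ).imp fun _ hφ => ⟨hφ.1, fun v => (h _).trans (hφ.2 v)⟩⟩

variable {P Q : (Fin n → M) → Prop} {s t : (Fin n → M) → M}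

instance mem [hs : IsVar s] [ht : IsVar t] : D0 fun v => s v ∈ₘ t v := by
  obtain ⟨i, rfl⟩ := hs.out
  obtain ⟨k, rfl⟩ := ht.out
  exact ⟨fun σ => ⟨Fm.mem (σ i) (σ k), Fm.Bdd.mem _ _, fun v => Iff.rfl⟩⟩

instance eq [hs : IsVar s] [ht : IsVar t] : D0 fun v => s v = t v := by
  obtain ⟨i, rfl⟩ := hs.out
  obtain ⟨k, rfl⟩ := ht.out
  exact ⟨fun σ => ⟨Fm.eq (σ i) (σ k), Fm.Bdd.eq _ _, fun v => Iff.rfl⟩⟩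

instance not [hP : D0 P] : D0 fun v => ¬ P v :=
  ⟨fun σ => by
    obtain ⟨φ, hφ, h⟩ := hP.out σ
    exact ⟨φ.neg, hφ.neg, fun v => not_congr (h v)⟩⟩

instance and [hP : D0 P] [hQ : D0 Q] : D0 fun v => P v ∧ Q v :=
  ⟨fun σ => by
    obtain ⟨φ, hφ, h⟩ := hP.out σ
    obtain ⟨ψ, hψ, h'⟩ := hQ.out σ
    exact ⟨φ.and ψ, hφ.and hψ, fun v => and_congr (h v) (h' v)⟩⟩

instance or [D0 P] [D0 Q] : D0 fun v => P v ∨ Q v :=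
  congr (Q := fun v => ¬ (¬ P v ∧ ¬ Q v)) inferInstance fun v => by tauto

instance imp [D0 P] [D0 Q] : D0 fun v => P v → Q v :=
  congr (Q := fun v => ¬ (P v ∧ ¬ Q v)) inferInstance fun v => by tauto

instance iff [D0 P] [D0 Q] : D0 fun v => P v ↔ Q v :=
  congr (Q := fun v => (P v → Q v) ∧ (Q v → P v)) inferInstance fun v => by tauto

/-- All free variables have names below `k`, so `k` itself is a fresh name for the bound variable.
In particular it differs from the name of the bounding variable, as `Fm.Bdd.bex` demands. -/
instance bex {Q : (Fin n → M) → M → Prop} [ht : IsVar t]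
    [h : D0 fun w : Fin (n + 1) → M => Q (fun i => w i.castSucc) (w (Fin.last n))] :
    D0 fun v => ∃ x, x ∈ₘ t v ∧ Q v x := by
  obtain ⟨i₀, rfl⟩ := ht.out
  refine ⟨fun {k} σ => ?_⟩
  obtain ⟨φ, hφ, h⟩ := h.out (k := k + 1) (Fin.lastCases (Fin.last k) fun i => (σ i).castSucc)
  refine ⟨Fm.ex k ((Fm.mem k (σ i₀)).and φ), Fm.Bdd.bex (σ i₀).2.ne' hφ, fun v => ?_⟩
  simp only [Fm.Real, true_and, ← h, Function.update_self, Function.update_of_ne (σ i₀).2.ne]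
  have : ∀ x, (fun i : Fin n => Function.update v k x (σ i)) = fun i : Fin n => v (σ i) := by
    intro x
    ext i
    exact Function.update_of_ne (σ i).2.ne _ _
  simp only [Fin.lastCases_castSucc, Fin.lastCases_last, Fin.val_castSucc, this, Fin.val_last,
    Function.update_self]

instance ball {Q : (Fin n → M) → M → Prop} [IsVar t]
    [D0 fun w : Fin (n + 1) → M => Q (fun i => w i.castSucc) (w (Fin.last n))] :
    D0 fun v => ∀ x, x ∈ₘ t v → Q v x :=
  congr (Q := fun v => ¬ ∃ x, x ∈ₘ t v ∧ ¬ Q v x) inferInstance fun v => by simp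

section comp
variable {a b c d : (Fin n → M) → M} [ha : IsVar a] [hb : IsVar b] [hc : IsVar c] [hd : IsVar d]

theorem comp_one {P : M → Prop} (hP : D0 fun v : Fin 1 → M => P (v 0)) : D0 fun v => P (a v) := by
  obtain ⟨i, rfl⟩ := ha.out
  exact hP.reindex ![i]

theorem comp_two {P : M → M → Prop} (hP : D0 fun v : Fin 2 → M => P (v 0) (v 1)) :
    D0 fun v => P (a v) (b v) := by
  obtain ⟨i, rfl⟩ := ha.out
  obtain ⟨j, rfl⟩ := hb.out
  exact hP.reindex ![i, j]

theorem comp_three {P : M → M → M → Prop} (hP : D0 fun v : Fin 3 → M => P (v 0) (v 1) (v 2)) :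
    D0 fun v => P (a v) (b v) (c v) := by
  obtain ⟨i, rfl⟩ := ha.out
  obtain ⟨j, rfl⟩ := hb.out
  obtain ⟨k, rfl⟩ := hc.out
  exact hP.reindex ![i, j, k]

theorem comp_four {P : M → M → M → M → Prop}
    (hP : D0 fun v : Fin 4 → M => P (v 0) (v 1) (v 2) (v 3)) :
    D0 fun v => P (a v) (b v) (c v) (d v) := by
  obtain ⟨i, rfl⟩ := ha.out
  obtain ⟨j, rfl⟩ := hb.out
  obtain ⟨k, rfl⟩ := hc.out
  obtain ⟨l, rfl⟩ := hd.out
  exact hP.reindex ![i, j, k, l]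

end comp

end D0

/-- `(x, (y, z)) ∈ p`. -/
def Tri (p x y z : M) : Prop :=
  ∃ u, u ∈ₘ p ∧ ∃ a, a ∈ₘ u ∧ ∃ q, q ∈ₘ a ∧ IsOPair x q u ∧ IsOPair y z q

section
variable {n : ℕ} {a b c d : (Fin n → M) → M} [IsVar a] [IsVar b] [IsVar c] [IsVar d]
instance : D0 fun v => IsSubset (a v) (b v) :=
  D0.comp_two (P := IsSubset) (by unfold IsSubset; infer_instance)
instance : D0 fun v => IsUPair (a v) (b v) (c v) :=
  D0.comp_three (P := IsUPair)
  (D0.congr (Q := fun v : Fin 3 → M => v 0 ∈ₘ v 2 ∧ v 1 ∈ₘ v 2 ∧ ∀ z, z ∈ₘ v 2 → z = v 0 ∨ z = v 1)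
    inferInstance fun v => by unfold IsUPair; grind)
instance : D0 fun v => IsOPair (a v) (b v) (c v) :=
  D0.comp_three (P := IsOPair)
  (D0.congr (Q := fun v : Fin 3 → M => ∃ x, x ∈ₘ v 2 ∧ ∃ y, y ∈ₘ v 2 ∧
    IsUPair (v 0) (v 0) x ∧ IsUPair (v 0) (v 1) y ∧ IsUPair x y (v 2))
    inferInstance fun _ =>
    ⟨fun ⟨x, y, h⟩ => ⟨x, (h.2.2 x).2 (Or.inl rfl), y, (h.2.2 y).2 (Or.inr rfl), h⟩,
      fun ⟨x, _, y, _, h⟩ => ⟨x, y, h⟩⟩)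
instance : D0 fun v => App (a v) (b v) (c v) :=
  D0.comp_three (P := App)
  (D0.congr (Q := fun v : Fin 3 → M => ∃ p, p ∈ₘ v 0 ∧ IsOPair (v 1) (v 2) p) inferInstance
    fun v => by unfold App; simp only [and_comm])
instance : D0 fun v => Tri (a v) (b v) (c v) (d v) :=
  D0.comp_four (P := Tri) (by unfold Tri; infer_instance)
instance : D0 fun v => IsSucc (a v) (b v) :=
  D0.comp_two (P := IsSucc)
  (D0.congr (Q := fun v : Fin 2 → M => v 0 ∈ₘ v 1 ∧ (∀ z, z ∈ₘ v 0 → z ∈ₘ v 1) ∧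
    ∀ z, z ∈ₘ v 1 → z ∈ₘ v 0 ∨ z = v 0) inferInstance fun v => by unfold IsSucc; grind)
instance : D0 fun v => IsOrd (a v) :=
  D0.comp_one (P := IsOrd)
  (D0.congr (Q := fun v : Fin 1 → M => (∀ y, y ∈ₘ v 0 → IsSubset y (v 0)) ∧
    ∀ y, y ∈ₘ v 0 → ∀ z, z ∈ₘ v 0 → y ∈ₘ z ∨ y = z ∨ z ∈ₘ y) inferInstance
    fun v => by unfold IsOrd; grind)
instance : D0 fun v => IsLimit (a v) :=
  D0.comp_one (P := IsLimit)
  -- The conjunct `y = y` gives nonemptiness the shape of a bounded quantifier followed by a matrix.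
  (D0.congr (Q := fun v : Fin 1 → M => IsOrd (v 0) ∧ (∃ y, y ∈ₘ v 0 ∧ y = y) ∧
    ∀ y, y ∈ₘ v 0 → ∃ z, z ∈ₘ v 0 ∧ y ∈ₘ z) inferInstance fun v => by unfold IsLimit; simp)
instance : D0 fun v => IsOmega (a v) :=
  D0.comp_one (P := IsOmega) (by unfold IsOmega; infer_instance)
instance : D0 fun v => IsFunOn (a v) (b v) :=
  D0.comp_two (P := IsFunOn)
  -- The second coordinate of a Kuratowski pair `p` is an element of an element of `p`. Quantifiers
  -- over values can therefore be bounded in two membership steps.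
  (D0.congr (Q := fun v : Fin 2 → M =>
    (∀ p, p ∈ₘ v 0 → ∃ x, x ∈ₘ v 1 ∧ ∃ c, c ∈ₘ p ∧ ∃ y, y ∈ₘ c ∧ IsOPair x y p) ∧
    ∀ x, x ∈ₘ v 1 → (∃ p, p ∈ₘ v 0 ∧ ∃ c, c ∈ₘ p ∧ ∃ y, y ∈ₘ c ∧ IsOPair x y p) ∧
      ∀ p, p ∈ₘ v 0 → ∀ q, q ∈ₘ v 0 → ∀ c, c ∈ₘ p → ∀ y, y ∈ₘ c → ∀ d, d ∈ₘ q → ∀ z, z ∈ₘ d →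
        IsOPair x y p → IsOPair x z q → y = z) inferInstance fun v => by
    have key : ∀ {x y p : M}, IsOPair x y p → ∃ c, c ∈ₘ p ∧ y ∈ₘ c := fun {x y p} ⟨c, d, _, h, h'⟩ =>
      ⟨d, (h' d).2 (Or.inr rfl), (h y).2 (Or.inr rfl)⟩
    refine and_congr (forall_congr' fun p => imp_congr_right fun _ => ?_)
      (forall_congr' fun x => imp_congr_right fun _ => ?_)
    · constructor
      · rintro ⟨x, y, hx, hp⟩
        obtain ⟨c, hc, hy⟩ := key hp
        exact ⟨x, hx, c, hc, y, hy, hp⟩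
      · rintro ⟨x, hx, c, hc, y, hy, hp⟩
        exact ⟨x, y, hx, hp⟩
    · constructor
      · rintro ⟨y, ⟨p, hp, hpa⟩, hu⟩
        obtain ⟨c, hc, hy⟩ := key hp
        refine ⟨⟨p, hpa, c, hc, y, hy, hp⟩, fun p hp q hq c hc y hy d hd z hz h h' => ?_⟩
        rw [hu y ⟨p, h, hp⟩, hu z ⟨q, h', hq⟩]
      · rintro ⟨⟨p, hp, c, hc, y, hy, h⟩, hu⟩
        refine ⟨y, ⟨p, h, hp⟩, ?_⟩
        rintro z ⟨q, h', hq⟩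
        obtain ⟨d, hd, hz⟩ := key h'
        exact (hu p hp q hq c hc y hy d hd z hz h h').symm)
instance : D0 fun v => IsFun (a v) (b v) (c v) :=
  D0.comp_three (P := IsFun)
  (D0.congr (Q := fun v : Fin 3 → M => IsFunOn (v 0) (v 1) ∧ ∀ p, p ∈ₘ v 0 → ∀ d, d ∈ₘ p → ∀ y, y ∈ₘ d →
    ∀ x, x ∈ₘ v 1 → IsOPair x y p → y ∈ₘ v 2) inferInstance fun v => by
    refine and_congr_right fun hf => ⟨?_, ?_⟩
    · exact fun h p hp d hd y hy x hx hxy => h x y ⟨p, hxy, hp⟩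
    · rintro h x y ⟨p, hxy, hp⟩
      obtain ⟨x', y', hx', hp'⟩ := hf.1 p hp
      obtain ⟨c, d, h1, h2, h3⟩ := hxy
      obtain ⟨c', d', h1', h2', h3'⟩ := hp'
      refine h p hp d ((h3 d).2 (Or.inr rfl)) y ((h2 y).2 (Or.inr rfl)) x ?_ ⟨c, d, h1, h2, h3⟩
      have hc : c ∈ₘ p := (h3 c).2 (Or.inl rfl)
      rcases (h3' c).1 hc with rfl | rfl
      · exact (h1' x).1 ((h1 x).2 (Or.inl rfl)) |>.elim (fun h => h ▸ hx') fun h => h ▸ hx'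
      · have := (h1 x').1 ((h2' x').2 (Or.inl rfl))
        exact this.elim (fun h => h ▸ hx') fun h => h ▸ hx')
end

end Standard

/-! ### Transfer between external formulas and their codes in the model. -/

section Codes

variable {M : Type*} [setLang.Structure M] [hZ : ZF M]

theorem tri_iff {p x y z : M} : Tri p x y z ↔ pr x (pr y z) ∈ₘ p := by
  simp only [Tri, isOPair_iff]
  constructor
  · rintro ⟨u, hu, a, -, q, -, rfl, rfl⟩
    exact hu
  · exact fun h => ⟨_, h, upair x (pr y z), by simp [pr, mem_upair], _, by simp [mem_upair], rfl, rfl⟩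

variable (M) in
/-- The code in `M` of a standard formula. -/
noncomputable def Fm.code : Fm → M
  | mem i k => tg 0 (nm M i) (nm M k)
  | eq i k => tg 1 (nm M i) (nm M k)
  | neg a => tg 2 a.code a.code
  | and a b => tg 3 a.code b.code
  | ex i a => tg 4 (nm M i) a.code

theorem Fm.isFormula_code (φ : Fm) : IsFormula (φ.code M) := by
  induction φ with
  | mem i k => exact isFormula_tg_zero (nm_mem_om i) (nm_mem_om k)
  | eq i k => exact isFormula_tg_one (nm_mem_om i) (nm_mem_om k)
  | neg a ih => exact isFormula_tg_two ih
  | and a b ih ih' => exact isFormula_tg_three ih ih'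
  | ex i a ih => exact isFormula_tg_four (nm_mem_om i) ih

theorem Fm.Bdd.isSigma0_code {φ : Fm} (h : φ.Bdd) : IsSigma0 (φ.code M) := by
  induction h with
  | mem i k => exact isSigma0_tg_zero (nm_mem_om i) (nm_mem_om k)
  | eq i k => exact isSigma0_tg_one (nm_mem_om i) (nm_mem_om k)
  | neg _ ih => exact isSigma0_tg_two ih
  | and _ _ ih ih' => exact isSigma0_tg_three ih ih'
  | bex h _ ih => exact isSigma0_tg_four (nm_mem_om _) (nm_mem_om _) (mt nm_inj.1 h) ih

theorem Fm.sat_code {A : M} (φ : Fm) : ∀ s, IsFun s (om M) A →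
    (Sat A (φ.code M) s ↔ φ.Real (· ∈ₘ A) fun n => ap s (nm M n)) := by
  induction φ with
  | mem i k => exact fun s hs => sat_tg_zero hs (nm_mem_om i) (nm_mem_om k)
  | eq i k => exact fun s hs => sat_tg_one hs (nm_mem_om i) (nm_mem_om k)
  | neg a ih => exact fun s hs => (sat_tg_two hs a.isFormula_code).trans (not_congr (ih s hs))
  | and a b ih ih' =>
    exact fun s hs => (sat_tg_three hs a.isFormula_code b.isFormula_code).trans
      (and_congr (ih s hs) (ih' s hs))
  | ex i a ih =>
    intro s hs
    refine (sat_tg_four hs (nm_mem_om i) a.isFormula_code).trans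
      (exists_congr fun x => and_congr_right fun hx => ?_)
    rw [ih _ (hs.upd (nm_mem_om i) hx)]
    refine iff_of_eq (congrArg _ (funext fun n => ?_))
    by_cases h : n = i
    · subst h
      rw [Function.update_self, ap_upd_self hs (nm_mem_om n) hx]
    · rw [Function.update_of_ne h, ap_upd_of_ne hs (nm_mem_om i) hx (nm_mem_om n) (mt nm_inj.1 h)]

theorem exists_assignment {A x₀ : M} (h₀ : x₀ ∈ₘ A) {n : ℕ} (w : Fin n → M) (hw : ∀ i, w i ∈ₘ A) :
    ∃ s, IsFun s (om M) A ∧ ∀ i : Fin n, ap s (nm M i) = w i := by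
  induction n with
  | zero =>
    obtain ⟨s, hs, -⟩ := exists_fun (om M) A (fun _ => x₀) inferInstance fun _ _ => h₀
    exact ⟨s, hs, fun i => i.elim0⟩
  | succ n ih =>
    obtain ⟨s, hs, h⟩ := ih (fun i => w i.castSucc) fun i => hw _
    refine ⟨upd s (nm M n) (w (Fin.last n)), hs.upd (nm_mem_om n) (hw _), fun i => ?_⟩
    refine Fin.lastCases ?_ (fun i => ?_) i
    · exact ap_upd_self hs (nm_mem_om n) (hw _)
    · exact (ap_upd_of_ne hs (nm_mem_om n) (hw _) (nm_mem_om _) (mt nm_inj.1 i.2.ne)).trans (h i)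

theorem exists_comp {A K s : M} (hK : IsFun K A A) (hs : IsFun s (om M) A) :
    ∃ t, IsFun t (om M) A ∧ ∀ i, i ∈ₘ om M → ap t i = ap K (ap s i) :=
  exists_fun (om M) A (fun i => ap K (ap s i)) inferInstance fun _ hi => hK.ap_mem (hs.ap_mem hi)

theorem PreservesOn.sat_iff {P : M → Prop} {A K c s t : M} (h : PreservesOn P A K) (hc : P c)
    (hs : IsFun s (om M) A) (ht : IsFun t (om M) A)
    (hst : ∀ i, i ∈ₘ om M → ap t i = ap K (ap s i)) : Sat A c s ↔ Sat A c t := by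
  refine h.2 c s t hc (isAssignment_iff.2 hs) (isAssignment_iff.2 ht) fun i x y hx hy => ?_
  have hi := hs.1.mem_of_app hx
  rw [ht.1.app_iff hi, hst i hi, (hs.1.app_iff hi).1 hx]
  exact (h.1.1.app_iff (hs.2 i x hx)).1 hy

/-- Passage from internal elementarity to external truth: `v` is read off an assignment `s` of the
model that begins with the parameters `w`, and `v'` off the composite of `K` with `s`. -/
theorem PreservesOn.real {P : M → Prop} {A K : M} (h : PreservesOn P A K) {x₀ : M} (h₀ : x₀ ∈ₘ A)
    {n : ℕ} (w : Fin n → M) (hw : ∀ i, w i ∈ₘ A) : ∃ v v' : ℕ → M, (∀ i, v i ∈ₘ A) ∧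
      (∀ i, v' i ∈ₘ A) ∧ (∀ i : Fin n, v i = w i) ∧ (∀ i : Fin n, v' i = ap K (w i)) ∧
      ∀ φ : Fm, P (φ.code M) → (φ.Real (· ∈ₘ A) v ↔ φ.Real (· ∈ₘ A) v') := by
  obtain ⟨s, hs, hsw⟩ := exists_assignment h₀ w hw
  obtain ⟨t, ht, hst⟩ := exists_comp h.1 hs
  refine ⟨fun n => ap s (nm M n), fun n => ap t (nm M n), fun i => hs.ap_mem (nm_mem_om i),
    fun i => ht.ap_mem (nm_mem_om i), hsw, fun i => ?_, fun φ hφ => ?_⟩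
  · simp only [hst _ (nm_mem_om _), hsw]
  · rw [← φ.sat_code s hs, ← φ.sat_code t ht]
    exact h.sat_iff hφ hs ht hst

theorem D0.absolute {A : M} (hA : ∀ x y, x ∈ₘ A → y ∈ₘ x → y ∈ₘ A) {n : ℕ}
    {P : (Fin n → M) → Prop} (hP : D0 P) : ∃ φ : Fm, φ.Bdd ∧ ∀ v : ℕ → M, (∀ i, v i ∈ₘ A) →
      (φ.Real (· ∈ₘ A) v ↔ P fun i => v i) := by
  obtain ⟨φ, hφ, h⟩ := hP.out id
  exact ⟨φ, hφ, fun v hv => (hφ.absolute hA v hv).trans (h v).symm⟩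

theorem update_mem {A : M} {v : ℕ → M} (hv : ∀ i, v i ∈ₘ A) (n : ℕ) {x : M} (hx : x ∈ₘ A) (i : ℕ) :
    Function.update v n x i ∈ₘ A := by
  by_cases h : i = n
  · subst h; simpa using hx
  · simpa [Function.update_of_ne h] using hv i

theorem update_castSucc {n : ℕ} {v : ℕ → M} {w : Fin n → M} (h : ∀ i : Fin n, v i = w i) (x : M) :
    (fun i : Fin n => Function.update v n x i.castSucc) = w :=
  funext fun i => (Function.update_of_ne i.2.ne _ _).trans (h i)

section pres

variable {P : M → Prop} {A K : M} (h : PreservesOn P A K)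
  (hA : ∀ x y, x ∈ₘ A → y ∈ₘ x → y ∈ₘ A) {n : ℕ} (w : Fin n → M) (hw : ∀ i, w i ∈ₘ A)

/-- The hypothesis concerns negations because `Σ₂` formulas begin, below their quantifiers, with a
negation: a bounded formula need not itself be `Σ₂`, but its negation is. Preserving `¬ φ` in both
directions amounts to preserving `φ`. -/
theorem PreservesOn.d0 (hP : ∀ φ : Fm, φ.Bdd → P (φ.neg.code M)) (h : PreservesOn P A K)
    (hA : ∀ x y, x ∈ₘ A → y ∈ₘ x → y ∈ₘ A) {x₀ : M} (h₀ : x₀ ∈ₘ A) {n : ℕ} (w : Fin n → M)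
    (hw : ∀ i, w i ∈ₘ A) (Q : (Fin n → M) → Prop) [hQ : D0 Q] : Q w ↔ Q fun i => ap K (w i) := by
  obtain ⟨v, v', hv, hv', hvw, hvw', key⟩ := h.real h₀ w hw
  obtain ⟨φ, hφ, hφQ⟩ := hQ.absolute hA
  have := key φ.neg (hP φ hφ)
  simp only [Fm.Real, not_iff_not] at this
  rw [hφQ v hv, hφQ v' hv', funext hvw, funext hvw'] at this
  exact this

theorem PreservesOn.d0_ex (hP : ∀ φ : Fm, P (φ.code M)) (h : PreservesOn P A K)
    (hA : ∀ x y, x ∈ₘ A → y ∈ₘ x → y ∈ₘ A) {x₀ : M} (h₀ : x₀ ∈ₘ A) {n : ℕ} (w : Fin n → M)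
    (hw : ∀ i, w i ∈ₘ A) (Q : (Fin n → M) → M → Prop)
    [hQ : D0 fun w : Fin (n + 1) → M => Q (fun i => w i.castSucc) (w (Fin.last n))] :
    (∃ x, x ∈ₘ A ∧ Q w x) ↔ ∃ x, x ∈ₘ A ∧ Q (fun i => ap K (w i)) x := by
  obtain ⟨v, v', hv, hv', hvw, hvw', key⟩ := h.real h₀ w hw
  obtain ⟨φ, hφ, hφQ⟩ := hQ.absolute hA
  have h1 : ∀ {v w}, (∀ i, v i ∈ₘ A) → (∀ i : Fin n, v i = w i) →
      ((Fm.ex n φ).Real (· ∈ₘ A) v ↔ ∃ x, x ∈ₘ A ∧ Q w x) := fun {v w} hv hvw =>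
    exists_congr fun x => and_congr_right fun hx => by
      rw [hφQ _ (update_mem hv n hx), update_castSucc hvw]
      simp
  rw [← h1 hv hvw, ← h1 hv' hvw']
  exact key _ (hP _)

/-- The prefix `∃ ¬ ∃ ∃` is the one needed for the statement that some section of a relation has no
ranking, a ranking being a map together with its target ordinal. -/
theorem PreservesOn.sigma2 (h : IsSigma2Elementary A K)
    (hA : ∀ x y, x ∈ₘ A → y ∈ₘ x → y ∈ₘ A) {x₀ : M} (h₀ : x₀ ∈ₘ A) {n : ℕ} (w : Fin n → M)
    (hw : ∀ i, w i ∈ₘ A) (Q : (Fin n → M) → M → M → M → Prop)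
    [hQ : D0 fun w : Fin (n + 3) → M => Q (fun i => w i.castSucc.castSucc.castSucc)
      (w (Fin.last n).castSucc.castSucc) (w (Fin.last (n + 1)).castSucc) (w (Fin.last (n + 2)))] :
    (∃ x, x ∈ₘ A ∧ ¬ ∃ y, y ∈ₘ A ∧ ∃ z, z ∈ₘ A ∧ Q w x y z) ↔
      ∃ x, x ∈ₘ A ∧ ¬ ∃ y, y ∈ₘ A ∧ ∃ z, z ∈ₘ A ∧ Q (fun i => ap K (w i)) x y z := by
  obtain ⟨v, v', hv, hv', hvw, hvw', key⟩ := PreservesOn.real h h₀ w hw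
  obtain ⟨φ, hφ, hφQ⟩ := hQ.absolute hA
  have h1 : ∀ {v w}, (∀ i, v i ∈ₘ A) → (∀ i : Fin n, v i = w i) →
      ((Fm.ex n (Fm.ex (n + 1) (Fm.ex (n + 2) φ)).neg).Real (· ∈ₘ A) v ↔
        ∃ x, x ∈ₘ A ∧ ¬ ∃ y, y ∈ₘ A ∧ ∃ z, z ∈ₘ A ∧ Q w x y z) := fun {v w} hv hvw =>
    exists_congr fun x => and_congr_right fun hx => not_congr <|
      exists_congr fun y => and_congr_right fun hy =>
      exists_congr fun z => and_congr_right fun hz => by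
      have e1 := update_mem hv n hx
      have e2 := update_mem e1 (n + 1) hy
      rw [hφQ _ (update_mem e2 (n + 2) hz)]
      have e : (fun i : Fin n => Function.update (Function.update (Function.update v n x)
          (n + 1) y) (n + 2) z i.castSucc.castSucc.castSucc) = w := funext fun i => by
        have := i.2
        rw [← hvw i]
        simp only [Fin.val_castSucc]
        rw [Function.update_of_ne (by omega), Function.update_of_ne (by omega),
          Function.update_of_ne (by omega)]
      rw [e]
      simp
  rw [← h1 hv hvw, ← h1 hv' hvw']
  refine key _ (exClosure_tg_four (nm_mem_om n) (exClosure_of ⟨_, ?_, isNegCode_iff.2 rfl⟩))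
  exact exClosure_tg_four (nm_mem_om _) (exClosure_tg_four (nm_mem_om _)
    (exClosure_of hφ.isSigma0_code))

end pres

theorem isSigma2_neg_code {φ : Fm} (hφ : φ.Bdd) : IsSigma2 (φ.neg.code M) :=
  exClosure_of ⟨_, exClosure_of hφ.isSigma0_code, isNegCode_iff.2 rfl⟩

end Codes
end RankToRank

namespace RankToRank

/-! ### Absoluteness of `Σ₀` formulas and bounded approximation of `Σ₁` truth. -/

section Locality

variable {M : Type*} [setLang.Structure M] [hZ : ZF M]

/-- The internal counterpart of `Fm.Bdd.absolute`. It is proved by induction in the model since `c`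
may be nonstandard. -/
theorem IsSigma0.absolute {A B c : M} (hA : ∀ x y, x ∈ₘ A → y ∈ₘ x → y ∈ₘ A) (hAB : IsSubset A B)
    (hc : IsSigma0 c) : ∀ s, IsFun s (om M) A → (Sat A c s ↔ Sat B c s) := by
  refine (sigma0_induction (fun c => ∀ s, IsFun s (om M) A → (Sat A c s ↔ Sat B c s))
    (fun i k hi hk s hs => ?_) (fun i k hi hk s hs => ?_) (fun a ha ih s hs => ?_)
    (fun a b ha hb iha ihb s hs => ?_) (fun i k a hi hk hik ha ih s hs => ?_) hc).2
  · rw [sat_tg_zero hs hi hk, sat_tg_zero (hs.mono hAB) hi hk]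
  · rw [sat_tg_one hs hi hk, sat_tg_one (hs.mono hAB) hi hk]
  · rw [sat_tg_two hs ha, sat_tg_two (hs.mono hAB) ha, ih s hs]
  · rw [sat_tg_three hs ha hb, sat_tg_three (hs.mono hAB) ha hb, iha s hs, ihb s hs]
  · have hm := isFormula_tg_zero hi hk
    have hf := isFormula_tg_three hm ha
    have hs' := hs.mono hAB
    rw [sat_tg_four hs hi hf, sat_tg_four hs' hi hf]
    have key : ∀ {C x}, IsFun s (om M) C → x ∈ₘ C →
        (Sat C (tg 3 (tg 0 i k) a) (upd s i x) ↔ x ∈ₘ ap s k ∧ Sat C a (upd s i x)) :=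
      fun {C x} hs hx => by
        rw [sat_tg_three (hs.upd hi hx) hm ha, sat_tg_zero (hs.upd hi hx) hi hk,
          ap_upd_self hs hi hx, ap_upd_of_ne hs hi hx hk hik.symm]
    constructor
    · rintro ⟨x, hx, h⟩
      rw [key hs hx, ih _ (hs.upd hi hx)] at h
      exact ⟨x, hAB x hx, (key hs' (hAB x hx)).2 h⟩
    · rintro ⟨x, hx, h⟩
      rw [key hs' hx] at h
      have hxA := hA _ _ (hs.ap_mem hk) h.1
      rw [← ih _ (hs.upd hi hxA)] at h
      exact ⟨x, hxA, (key hs hxA).2 h⟩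

theorem IsSigma1.isFormula {c : M} (hc : IsSigma1 c) : IsFormula c :=
  (exClosure_induction (fun _ h => h.isFormula) (fun _ => True) (by simp) (by simp) hc).1

theorem IsSigma1.upward {A B c : M} (hA : ∀ x y, x ∈ₘ A → y ∈ₘ x → y ∈ₘ A) (hAB : IsSubset A B)
    (hc : IsSigma1 c) : ∀ s, IsFun s (om M) A → Sat A c s → Sat B c s := by
  refine (exClosure_induction (fun _ h => h.isFormula)
    (fun c => ∀ s, IsFun s (om M) A → Sat A c s → Sat B c s)
    (fun c hc s hs h => (hc.absolute hA hAB s hs).1 h) (fun i a hi ha ih s hs h => ?_) hc).2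
  rw [sat_tg_four hs hi ha] at h
  rw [sat_tg_four (hs.mono hAB) hi ha]
  obtain ⟨x, hx, h⟩ := h
  exact ⟨x, hAB x hx, ih _ (hs.upd hi hx) h⟩

/-- Each existential quantifier contributes one witness, which lies in some stage below `d`, and the
stage is enlarged accordingly. The assignment must be bounded at the start, since an assignment into
`V_d` can be cofinal when `d` has cofinality `ω`. -/
theorem IsSigma1.exists_Vr {d c : M} (hd : IsLimit d) (hc : IsSigma1 c) :
    ∀ s a, a ∈ₘ d → IsFun s (om M) (Vr a) → Sat (Vr d) c s →
      ∃ b, b ∈ₘ d ∧ IsFun s (om M) (Vr b) ∧ Sat (Vr b) c s := by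
  have hmono : ∀ {a}, a ∈ₘ d → IsSubset (Vr a) (Vr d) := fun {a} ha =>
    Vr_mono (hd.1.mem ha) hd.1 (hd.1.1 a ha)
  have htr : ∀ {a}, a ∈ₘ d → ∀ x y, x ∈ₘ Vr a → y ∈ₘ x → y ∈ₘ Vr a := fun {a} ha x y hx hy =>
    Vr_trans (hd.1.mem ha) hx hy
  -- enlarging the stage
  have hmax : ∀ {a b : M}, a ∈ₘ d → b ∈ₘ d →
      ∃ e, e ∈ₘ d ∧ IsSubset (Vr a) (Vr e) ∧ IsSubset (Vr b) (Vr e) := fun {a b} ha hb => by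
    have hao := hd.1.mem ha
    have hbo := hd.1.mem hb
    rcases hao.trichotomy hbo with h | rfl | h
    · exact ⟨b, hb, Vr_mono hao hbo (hbo.1 _ h), IsSubset.refl _⟩
    · exact ⟨a, ha, IsSubset.refl _, IsSubset.refl _⟩
    · exact ⟨a, ha, IsSubset.refl _, Vr_mono hbo hao (hao.1 _ h)⟩
  refine (exClosure_induction (fun _ h => h.isFormula)
    -- The induction carries `IsSigma1 c` along so that truth can be moved upward to the enlarged
    -- stage in the quantifier step.
    (fun c => IsSigma1 c ∧ ∀ s a, a ∈ₘ d → IsFun s (om M) (Vr a) → Sat (Vr d) c s →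
      ∃ b, b ∈ₘ d ∧ IsFun s (om M) (Vr b) ∧ Sat (Vr b) c s)
    (fun c hc => ⟨exClosure_of hc,
      fun s a ha hs h => ⟨a, ha, hs, (hc.absolute (htr ha) (hmono ha) s hs).2 h⟩⟩)
    (fun i a hi ha ih => ⟨exClosure_tg_four hi ih.1, fun s e he hs h => ?_⟩) hc).2.2
  rw [sat_tg_four (hs.mono (hmono he)) hi ha] at h
  obtain ⟨x, hx, h⟩ := h
  obtain ⟨e', he', hx⟩ := (mem_Vr_limit hd).1 hx
  obtain ⟨e₁, he₁, h1, h2⟩ := hmax he he'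
  obtain ⟨b, hb, hub, hsat⟩ := ih.2 _ e₁ he₁ ((hs.mono h1).upd hi (h2 x hx)) h
  obtain ⟨b₁, hb₁, h3, h4⟩ := hmax he₁ hb
  have hs₁ := hs.mono (h1.trans h3)
  refine ⟨b₁, hb₁, hs₁, (sat_tg_four hs₁ hi ha).2 ⟨x, h3 x (h2 x hx), ?_⟩⟩
  exact ih.1.upward (htr hb) h4 _ hub hsat

/-- The truth of a formula depends only on finitely many variables. -/
theorem exists_support {A c : M} (hc : IsFormula c) : ∃ N, N ∈ₘ om M ∧
    ∀ s t, IsFun s (om M) A → IsFun t (om M) A → (∀ i, i ∈ₘ N → ap s i = ap t i) →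
      (Sat A c s ↔ Sat A c t) := by
  have hmax : ∀ {i k : M}, i ∈ₘ om M → k ∈ₘ om M → ∃ N, N ∈ₘ om M ∧ IsSubset i N ∧ IsSubset k N :=
    fun {i k} hi hk => by
      have hio := isLimit_om.1.mem hi
      have hko := isLimit_om.1.mem hk
      rcases hio.trichotomy hko with h | rfl | h
      · exact ⟨k, hk, hko.1 _ h, IsSubset.refl _⟩
      · exact ⟨i, hi, IsSubset.refl _, IsSubset.refl _⟩
      · exact ⟨i, hi, IsSubset.refl _, hio.1 _ h⟩
  have hatom : ∀ {i k : M}, i ∈ₘ om M → k ∈ₘ om M → ∃ N, N ∈ₘ om M ∧ i ∈ₘ N ∧ k ∈ₘ N :=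
    fun {i k} hi hk => by
      obtain ⟨N, hN, h1, h2⟩ := hmax (isLimit_om.suc_mem hi) (isLimit_om.suc_mem hk)
      exact ⟨N, hN, h1 i (self_mem_suc i), h2 k (self_mem_suc k)⟩
  refine formula_induction (fun c => ∃ N, N ∈ₘ om M ∧
    ∀ s t, IsFun s (om M) A → IsFun t (om M) A → (∀ i, i ∈ₘ N → ap s i = ap t i) →
      (Sat A c s ↔ Sat A c t)) (fun i k hi hk => ?_) (fun i k hi hk => ?_) (fun a ha ih => ?_)
    (fun a b ha hb iha ihb => ?_) (fun i a hi ha ih => ?_) hc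
  · obtain ⟨N, hN, h1, h2⟩ := hatom hi hk
    refine ⟨N, hN, fun s t hs ht h => ?_⟩
    rw [sat_tg_zero hs hi hk, sat_tg_zero ht hi hk, h i h1, h k h2]
  · obtain ⟨N, hN, h1, h2⟩ := hatom hi hk
    refine ⟨N, hN, fun s t hs ht h => ?_⟩
    rw [sat_tg_one hs hi hk, sat_tg_one ht hi hk, h i h1, h k h2]
  · obtain ⟨N, hN, ih⟩ := ih
    refine ⟨N, hN, fun s t hs ht h => ?_⟩
    rw [sat_tg_two hs ha, sat_tg_two ht ha, ih s t hs ht h]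
  · obtain ⟨N₁, hN₁, iha⟩ := iha
    obtain ⟨N₂, hN₂, ihb⟩ := ihb
    obtain ⟨N, hN, h1, h2⟩ := hmax hN₁ hN₂
    refine ⟨N, hN, fun s t hs ht h => ?_⟩
    rw [sat_tg_three hs ha hb, sat_tg_three ht ha hb, iha s t hs ht fun i hi => h i (h1 i hi),
      ihb s t hs ht fun i hi => h i (h2 i hi)]
  · obtain ⟨N, hN, ih⟩ := ih
    refine ⟨N, hN, fun s t hs ht h => ?_⟩
    rw [sat_tg_four hs hi ha, sat_tg_four ht hi ha]
    refine exists_congr fun x => and_congr_right fun hx =>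
      ih _ _ (hs.upd hi hx) (ht.upd hi hx) fun k hk => ?_
    have hko := isLimit_om.1.trans hk hN
    by_cases hki : k = i
    · rw [hki, ap_upd_self hs hi hx, ap_upd_self ht hi hx]
    · rw [ap_upd_of_ne hs hi hx hko hki, ap_upd_of_ne ht hi hx hko hki, h k hk]

/-- Only the values below `N` can be bounded. Together with `exists_support` this reduces arbitrary
assignments to bounded ones. -/
theorem exists_Vr_bound {d s N : M} (hd : IsLimit d) (hs : IsFun s (om M) (Vr d))
    (hN : N ∈ₘ om M) : ∃ b, b ∈ₘ d ∧ ∀ i, i ∈ₘ N → ap s i ∈ₘ Vr b := by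
  refine om_induction (fun N => N ∈ₘ om M → ∃ b, b ∈ₘ d ∧ ∀ i, i ∈ₘ N → ap s i ∈ₘ Vr b)
    (fun _ => ⟨emp M, hd.emp_mem, by simp⟩) (fun N hN ih _ => ?_) hN hN
  obtain ⟨b, hb, h⟩ := ih hN
  obtain ⟨e, he, h1, h2⟩ := exists_Vr_two hd (Vr_mem_Vr hd.1 hb) (hs.ap_mem hN)
  refine ⟨e, he, fun i hi => ?_⟩
  rcases mem_suc.1 hi with hi | rfl
  · exact Vr_trans (hd.1.mem he) h1 (h i hi)
  · exact h2

/-- An assignment into `V_d` can be replaced by a bounded one which agrees with it below `N`. -/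
theorem exists_bounded_assignment {d s N : M} (hd : IsLimit d) (hs : IsFun s (om M) (Vr d))
    (hN : N ∈ₘ om M) : ∃ b s', b ∈ₘ d ∧ IsFun s' (om M) (Vr b) ∧
      ∀ i, i ∈ₘ N → ap s i = ap s' i := by
  classical
  obtain ⟨b, hb, h⟩ := exists_Vr_bound hd hs hN
  have hb' := hd.suc_mem hb
  have h0 : emp M ∈ₘ Vr (suc b) :=
    subset_Vr_mem (hd.1.mem hb') (self_mem_suc b) fun z hz => absurd hz not_mem_emp
  obtain ⟨s', hs', hs'ap⟩ := exists_fun (om M) (Vr (suc b))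
    (fun i => if i ∈ₘ N then ap s i else emp M)
    (Dfn.congr (Q := fun v : Fin 2 → M =>
      (v 0 ∈ₘ N ∧ v 1 = ap s (v 0)) ∨ (¬ v 0 ∈ₘ N ∧ v 1 = emp M)) inferInstance
      fun v => by split_ifs <;> simp_all)
    (fun i _ => by
      split_ifs with hi
      · exact Vr_mono (hd.1.mem hb) (hd.1.mem hb') (fun z hz => mem_suc.2 (Or.inl hz)) _ (h i hi)
      · exact h0)
  exact ⟨suc b, s', hb', hs', fun i hi => by rw [hs'ap i (isLimit_om.1.trans hi hN), if_pos hi]⟩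

end Locality
end RankToRank

namespace RankToRank

/-! ### The embedding `j` and its critical sequence. -/

section Setting

variable {M : Type*} [setLang.Structure M] [hZ : ZF M]

theorem injects_of {a b : M} (F : M → M) (hF : Dfn fun v : Fin 2 → M => v 1 = F (v 0))
    (hab : ∀ x, x ∈ₘ a → F x ∈ₘ b)
    (hinj : ∀ x y, x ∈ₘ a → y ∈ₘ a → F x = F y → x = y) : Injects a b := by
  obtain ⟨f, hf, hap⟩ := exists_fun a b F hF hab
  refine ⟨f, hf, fun x y z hx hy => ?_⟩
  have hxa := hf.1.mem_of_app hx
  have hya := hf.1.mem_of_app hy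
  rw [hf.1.app_iff hxa, hap x hxa] at hx
  rw [hf.1.app_iff hya, hap y hya] at hy
  exact hinj x y hxa hya (hx.trans hy.symm)

theorem Injects.exists_fun {a b : M} (h : Injects a b) : ∃ f, IsFun f a b ∧
    ∀ x y, x ∈ₘ a → y ∈ₘ a → ap f x = ap f y → x = y := by
  obtain ⟨f, hf, hinj⟩ := h
  refine ⟨f, hf, fun x y hx hy hxy => hinj x y (ap f x) (app_ap hf.1 hx) ?_⟩
  rw [hxy]
  exact app_ap hf.1 hy

/-- `j : V_{lp} → V_{lp}` is elementary, with critical sequence `K` and supremum `l`,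
and `lp = l⁺`. -/
structure RR (l lp j K : M) : Prop where
  ol : IsOrd l
  olp : IsOrd lp
  not_injects : ¬ Injects lp l
  injects : ∀ a, a ∈ₘ lp → Injects a l
  elem : IsElementary (Vr lp) j
  funK : IsFunOn K (om M)
  ord_crit : IsOrd (ap K (emp M))
  crit_mem : ap K (emp M) ∈ₘ ap j (ap K (emp M))
  crit_min : ∀ a, a ∈ₘ ap K (emp M) → ¬ a ∈ₘ ap j a
  step : ∀ i, i ∈ₘ om M → ap j (ap K i) = ap K (suc i)
  K_mem : ∀ i, i ∈ₘ om M → ap K i ∈ₘ Vr lp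
  mem_l : ∀ z, z ∈ₘ l ↔ ∃ i, i ∈ₘ om M ∧ z ∈ₘ ap K i

theorem exists_RR {l lp v j : M} (hlp : IsSuccCard l lp) (hv : IsRank lp v)
    (hj : IsElementary v j) (hl : IsCritSup j l) : v = Vr lp ∧ ∃ K, RR l lp j K := by
  obtain ⟨hlpo, rfl⟩ := isRank_iff_eq.1 hv
  refine ⟨rfl, ?_⟩
  obtain ⟨w, K, hw, hK, ⟨o, c, ho, hoc, hc⟩, hstep, hsup⟩ := hl
  rw [isOmega_iff] at hw
  subst hw
  rw [isEmp_iff] at ho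
  subst ho
  have h0 := isLimit_om.emp_mem (M := M)
  rw [hK.app_iff h0] at hoc
  subst hoc
  have hKj : ∀ i, i ∈ₘ om M → App j (ap K i) (ap K (suc i)) := fun i hi =>
    hstep i (suc i) _ _ hi (isSucc_iff.2 rfl) (app_ap hK hi) (app_ap hK (isLimit_om.suc_mem hi))
  have hKm : ∀ i, i ∈ₘ om M → ap K i ∈ₘ Vr lp := fun i hi => hj.1.1.mem_of_app (hKj i hi)
  have hmoves : ∀ a, a ∈ₘ Vr lp → (MovesUp j a ↔ a ∈ₘ ap j a) := fun a ha => by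
    simp [MovesUp, hj.1.1.app_iff ha]
  refine ⟨K, hlp.1, hlp.2.1, hlp.2.2.1, hlp.2.2.2, hj, hK, hc.1, ?_, fun a ha => ?_, fun i hi => ?_,
    hKm, fun z => ?_⟩
  · exact (hmoves _ (hKm _ h0)).1 hc.2.1
  · rw [← hmoves a (Vr_trans hlpo (hKm _ h0) ha)]
    exact hc.2.2 a ha
  · exact (hj.1.1.app_iff (hKm i hi)).1 (hKj i hi)
  · rw [hsup]
    constructor
    · rintro ⟨i, x, hx, hz⟩
      have hi := hK.mem_of_app hx
      exact ⟨i, hi, (hK.app_iff hi).1 hx ▸ hz⟩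
    · rintro ⟨i, hi, hz⟩
      exact ⟨i, _, app_ap hK hi, hz⟩

namespace RR

variable {l lp j K : M} (h : RR l lp j K)

include h

theorem tr (x y : M) (hx : x ∈ₘ Vr lp) (hy : y ∈ₘ x) : y ∈ₘ Vr lp := Vr_trans h.olp hx hy

theorem l_mem : l ∈ₘ lp := by
  by_contra hl
  rw [h.ol.not_mem_iff h.olp] at hl
  exact h.not_injects (injects_of (fun x => x) inferInstance hl fun _ _ _ _ h => h)

theorem lV : l ∈ₘ Vr lp := ord_mem_Vr h.olp h.l_mem

theorem J_mem {x : M} (hx : x ∈ₘ Vr lp) : ap j x ∈ₘ Vr lp := h.elem.1.ap_mem hx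

theorem app_j {x y : M} (hx : x ∈ₘ Vr lp) : App j x y ↔ ap j x = y := h.elem.1.1.app_iff hx

theorem d0 {n : ℕ} (w : Fin n → M) (hw : ∀ i, w i ∈ₘ Vr lp) (Q : (Fin n → M) → Prop)
    [hQ : D0 Q] : Q w ↔ Q fun i => ap j (w i) :=
  PreservesOn.d0 (fun φ _ => φ.neg.isFormula_code) h.elem h.tr h.lV w hw Q

theorem d0_ex {n : ℕ} (w : Fin n → M) (hw : ∀ i, w i ∈ₘ Vr lp) (Q : (Fin n → M) → M → Prop)
    [hQ : D0 fun w : Fin (n + 1) → M => Q (fun i => w i.castSucc) (w (Fin.last n))] :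
    (∃ x, x ∈ₘ Vr lp ∧ Q w x) ↔ ∃ x, x ∈ₘ Vr lp ∧ Q (fun i => ap j (w i)) x :=
  PreservesOn.d0_ex (fun φ => φ.isFormula_code) h.elem h.tr h.lV w hw Q

/-- In these fixed arities, preservation can be quoted for a curried predicate whose `D0` instance
is found by search. -/
theorem pres_1 (Q : M → Prop) [D0 fun v : Fin 1 → M => Q (v 0)] {x : M}
    (hx : x ∈ₘ Vr lp) : Q x ↔ Q (ap j x) :=
  h.d0 ![x] (by simp [hx]) fun v => Q (v 0)

theorem pres_2 (Q : M → M → Prop) [D0 fun v : Fin 2 → M => Q (v 0) (v 1)] {x y : M}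
    (hx : x ∈ₘ Vr lp) (hy : y ∈ₘ Vr lp) : Q x y ↔ Q (ap j x) (ap j y) :=
  h.d0 ![x, y] (by simp [Fin.forall_fin_succ, hx, hy]) fun v => Q (v 0) (v 1)

theorem pres_3 (Q : M → M → M → Prop) [D0 fun v : Fin 3 → M => Q (v 0) (v 1) (v 2)] {x y z : M}
    (hx : x ∈ₘ Vr lp) (hy : y ∈ₘ Vr lp) (hz : z ∈ₘ Vr lp) : Q x y z ↔ Q (ap j x) (ap j y) (ap j z) :=
  h.d0 ![x, y, z] (by simp [Fin.forall_fin_succ, hx, hy, hz]) fun v => Q (v 0) (v 1) (v 2)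

theorem pres_4 (Q : M → M → M → M → Prop) [D0 fun v : Fin 4 → M => Q (v 0) (v 1) (v 2) (v 3)] {x y z u : M}
    (hx : x ∈ₘ Vr lp) (hy : y ∈ₘ Vr lp) (hz : z ∈ₘ Vr lp) (hu : u ∈ₘ Vr lp) : Q x y z u ↔ Q (ap j x) (ap j y) (ap j z) (ap j u) :=
  h.d0 ![x, y, z, u] (by simp [Fin.forall_fin_succ, hx, hy, hz, hu]) fun v => Q (v 0) (v 1) (v 2) (v 3)

theorem pres_5 (Q : M → M → M → M → M → Prop) [D0 fun v : Fin 5 → M => Q (v 0) (v 1) (v 2) (v 3) (v 4)] {x y z u t : M}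
    (hx : x ∈ₘ Vr lp) (hy : y ∈ₘ Vr lp) (hz : z ∈ₘ Vr lp) (hu : u ∈ₘ Vr lp) (ht : t ∈ₘ Vr lp) : Q x y z u t ↔ Q (ap j x) (ap j y) (ap j z) (ap j u) (ap j t) :=
  h.d0 ![x, y, z, u, t] (by simp [Fin.forall_fin_succ, hx, hy, hz, hu, ht]) fun v => Q (v 0) (v 1) (v 2) (v 3) (v 4)

theorem pres_6 (Q : M → M → M → M → M → M → Prop) [D0 fun v : Fin 6 → M => Q (v 0) (v 1) (v 2) (v 3) (v 4) (v 5)] {x y z u t r : M}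
    (hx : x ∈ₘ Vr lp) (hy : y ∈ₘ Vr lp) (hz : z ∈ₘ Vr lp) (hu : u ∈ₘ Vr lp) (ht : t ∈ₘ Vr lp) (hr : r ∈ₘ Vr lp) : Q x y z u t r ↔ Q (ap j x) (ap j y) (ap j z) (ap j u) (ap j t) (ap j r) :=
  h.d0 ![x, y, z, u, t, r] (by simp [Fin.forall_fin_succ, hx, hy, hz, hu, ht, hr]) fun v => Q (v 0) (v 1) (v 2) (v 3) (v 4) (v 5)

theorem pres_ex_1 (Q : M → M → Prop) [D0 fun v : Fin 2 → M => Q (v 0) (v 1)] {x : M}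
    (hx : x ∈ₘ Vr lp) : (∃ a, a ∈ₘ Vr lp ∧ Q x a) ↔ ∃ a, a ∈ₘ Vr lp ∧ Q (ap j x) a :=
  have : D0 fun w : Fin (1 + 1) → M => (fun v a => Q (v 0) a) (fun i : Fin 1 => w i.castSucc)
    (w (Fin.last 1)) := inferInstanceAs (D0 fun v : Fin 2 → M => Q (v 0) (v 1))
  h.d0_ex ![x] (by simp [hx]) fun v a => Q (v 0) a

theorem pres_ex_3 (Q : M → M → M → M → Prop) [D0 fun v : Fin 4 → M => Q (v 0) (v 1) (v 2) (v 3)] {x y z : M}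
    (hx : x ∈ₘ Vr lp) (hy : y ∈ₘ Vr lp) (hz : z ∈ₘ Vr lp) : (∃ a, a ∈ₘ Vr lp ∧ Q x y z a) ↔ ∃ a, a ∈ₘ Vr lp ∧ Q (ap j x) (ap j y) (ap j z) a :=
  have : D0 fun w : Fin (3 + 1) → M => (fun v a => Q (v 0) (v 1) (v 2) a) (fun i : Fin 3 => w i.castSucc)
    (w (Fin.last 3)) := inferInstanceAs (D0 fun v : Fin 4 → M => Q (v 0) (v 1) (v 2) (v 3))
  h.d0_ex ![x, y, z] (by simp [Fin.forall_fin_succ, hx, hy, hz]) fun v a => Q (v 0) (v 1) (v 2) a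

/-! ### Ordinals and the critical sequence -/

theorem J_mem_J {x y : M} (hx : x ∈ₘ Vr lp) (hy : y ∈ₘ Vr lp) : x ∈ₘ y ↔ ap j x ∈ₘ ap j y :=
  h.pres_2 (fun x y => x ∈ₘ y) hx hy

theorem J_ord {x : M} (hx : x ∈ₘ Vr lp) : IsOrd x ↔ IsOrd (ap j x) :=
  h.pres_1 (fun x => IsOrd x) hx

theorem J_suc {x : M} (hx : x ∈ₘ Vr lp) (hx' : suc x ∈ₘ Vr lp) : ap j (suc x) = suc (ap j x) :=
  isSucc_iff.1 ((h.pres_2 (fun x y => IsSucc x y) hx hx').1 (isSucc_iff.2 rfl))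

theorem ordV {x : M} (hx : x ∈ₘ lp) : x ∈ₘ Vr lp := ord_mem_Vr h.olp hx

theorem J_lp {x : M} (hx : x ∈ₘ lp) : ap j x ∈ₘ lp :=
  mem_of_mem_Vr h.olp ((h.J_ord (h.ordV hx)).1 (h.olp.mem hx)) (h.J_mem (h.ordV hx))

theorem J_ordinal {x : M} (hx : x ∈ₘ lp) : IsOrd (ap j x) := h.olp.mem (h.J_lp hx)

/-- From `j(x) < x` elementarity gives `j(j(x)) < j(x)`, so there is no least such `x`. -/
theorem subset_J {x : M} (hx : x ∈ₘ lp) : IsSubset x (ap j x) := by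
  rw [← (h.J_ordinal hx).not_mem_iff (h.olp.mem hx)]
  refine (h.olp.mem hx).induction (fun x => x ∈ₘ lp → ¬ ap j x ∈ₘ x) (fun x hxo ih hx hJ => ?_) hx
  exact ih _ hJ (h.J_lp hx) ((h.J_mem_J (h.ordV (h.J_lp hx)) (h.ordV hx)).1 hJ)

theorem kap_lp {i : M} (hi : i ∈ₘ om M) : ap K i ∈ₘ lp ∧ IsOrd (ap K i) := by
  have key := om_induction (fun i => IsOrd (ap K i)) h.ord_crit (fun i hi ih => by
    rw [← h.step i hi]
    exact (h.J_ord (h.K_mem i hi)).1 ih) hi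
  exact ⟨mem_of_mem_Vr h.olp key (h.K_mem i hi), key⟩

theorem kap_mem_suc {i : M} (hi : i ∈ₘ om M) : ap K i ∈ₘ ap K (suc i) := by
  refine om_induction (fun i => ap K i ∈ₘ ap K (suc i)) ?_ (fun i hi ih => ?_) hi
  · rw [← h.step _ isLimit_om.emp_mem]
    exact h.crit_mem
  · have hi' := isLimit_om.suc_mem hi
    rw [← h.step i hi, ← h.step _ hi', h.step i hi]
    rw [h.J_mem_J (h.K_mem _ hi) (h.K_mem _ hi'), h.step i hi] at ih
    exact ih

theorem kap_mem_l {i : M} (hi : i ∈ₘ om M) : ap K i ∈ₘ l :=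
  (h.mem_l _).2 ⟨suc i, isLimit_om.suc_mem hi, h.kap_mem_suc hi⟩

theorem limit_l : IsLimit l :=
  ⟨h.ol, ⟨_, h.kap_mem_l isLimit_om.emp_mem⟩, fun y hy => by
    obtain ⟨i, hi, hy⟩ := (h.mem_l y).1 hy
    exact ⟨_, h.kap_mem_l hi, hy⟩⟩

theorem limit_lp : IsLimit lp := by
  classical
  refine isLimit_of_suc_mem h.olp ⟨_, h.l_mem⟩ fun a ha => ?_
  have hao := h.olp.mem ha
  by_contra hsa
  rw [(isOrd_suc hao).not_mem_iff h.olp] at hsa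
  obtain ⟨f, hf, hinj⟩ := (h.injects a ha).exists_fun
  have hl := h.limit_l
  -- If `lp ⊆ a + 1`, an injection of `a` into the limit ordinal `l` is shifted by one, which frees
  -- the value `0` for the extra point `a`.
  refine h.not_injects (injects_of (fun x => if x ∈ₘ a then suc (ap f x) else emp M)
    (Dfn.congr (Q := fun v : Fin 2 → M =>
      (v 0 ∈ₘ a ∧ v 1 = suc (ap f (v 0))) ∨ (¬ v 0 ∈ₘ a ∧ v 1 = emp M)) inferInstance
      fun v => by split_ifs <;> simp_all) (fun x hx => ?_) fun x y hx hy hxy => ?_)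
  · split_ifs with hxa
    exacts [hl.suc_mem (hf.ap_mem hxa), hl.emp_mem]
  · have hx := mem_suc.1 (hsa x hx)
    have hy := mem_suc.1 (hsa y hy)
    by_cases hxa : x ∈ₘ a <;> by_cases hya : y ∈ₘ a <;> simp only [hxa, hya, if_true, if_false] at hxy
    · exact hinj x y hxa hya (suc_inj.1 hxy)
    · exact absurd hxy (suc_ne_emp _)
    · exact absurd hxy.symm (suc_ne_emp _)
    · rw [hx.resolve_left hxa, hy.resolve_left hya]

theorem omV : om M ∈ₘ Vr lp := by
  refine h.ordV ?_
  rcases isLimit_om.1.subset_cases h.ol h.limit_l.om_subset with e | e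
  exacts [e ▸ h.l_mem, h.olp.trans e h.l_mem]

theorem natV {i : M} (hi : i ∈ₘ om M) : i ∈ₘ Vr lp := h.tr _ _ h.omV hi

theorem sucV {x : M} (hx : x ∈ₘ Vr lp) : suc x ∈ₘ Vr lp :=
  un_mem_Vr h.limit_lp hx (upair_mem_Vr h.limit_lp hx hx)

theorem J_suc' {x : M} (hx : x ∈ₘ Vr lp) : ap j (suc x) = suc (ap j x) := h.J_suc hx (h.sucV hx)

theorem J_app {f x y : M} (hf : f ∈ₘ Vr lp) (hx : x ∈ₘ Vr lp) (hy : y ∈ₘ Vr lp) :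
    App f x y ↔ App (ap j f) (ap j x) (ap j y) :=
  h.pres_3 (fun f x y => App f x y) hf hx hy

theorem J_om : ap j (om M) = om M :=
  isOmega_iff.1 ((h.pres_1 (fun x => IsOmega x) h.omV).1 isOmega_om)

theorem J_emp : ap j (emp M) = emp M := by
  have h0 := h.natV isLimit_om.emp_mem
  by_contra hne
  have := (h.pres_1 (fun x => ∀ y, y ∈ₘ x → ¬ y = y) h0).1 (by simp)
  obtain ⟨y, hy⟩ := exists_mem_of_ne_emp hne
  exact this y hy rfl

theorem J_nat {i : M} (hi : i ∈ₘ om M) : ap j i = i := by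
  refine om_induction (fun i => ap j i = i) h.J_emp (fun i hi ih => ?_) hi
  rw [h.J_suc' (h.natV hi), ih]

theorem J_crit {a : M} (ha : a ∈ₘ ap K (emp M)) : ap j a = a := by
  have halp := h.olp.trans ha (h.kap_lp isLimit_om.emp_mem).1
  exact (((h.olp.mem halp).subset_cases (h.J_ordinal halp) (h.subset_J halp)).resolve_right
    (h.crit_min a ha)).symm

theorem limit_kap {i : M} (hi : i ∈ₘ om M) : IsLimit (ap K i) := by
  refine om_induction (fun i => IsLimit (ap K i)) ?_ (fun i hi ih => ?_) hi
  · have h0 := isLimit_om.emp_mem (M := M)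
    have hne : ap K (emp M) ≠ emp M := fun e => by
      have := h.crit_mem
      rw [e, h.J_emp] at this
      exact not_mem_emp this
    refine isLimit_of_suc_mem h.ord_crit (exists_mem_of_ne_emp hne) fun b hb => ?_
    refine ((h.ord_crit.mem hb).suc_cases h.ord_crit hb).resolve_left fun e => ?_
    have hbV := h.tr _ _ (h.K_mem _ h0) hb
    have := h.crit_mem
    rw [← e, h.J_suc' hbV, h.J_crit hb] at this
    exact mem_irrefl _ this
  · rw [← h.step i hi]
    exact (h.pres_1 (fun x => IsLimit x) (h.K_mem i hi)).1 ih

theorem KV : K ∈ₘ Vr lp := by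
  refine subset_mem_Vr h.olp (prod_mem_Vr h.limit_lp h.omV h.lV) fun p hp => ?_
  obtain ⟨x, y, hx, hp'⟩ := h.funK.1 p hp
  rw [isOPair_iff] at hp'
  subst hp'
  rw [pr_mem_prod, ← (h.funK.app_iff hx).1 (app_iff.2 hp)]
  exact ⟨hx, h.kap_mem_l hx⟩

/-- By elementarity `j(λ)` is covered by the values of the sequence `j(K)` on `j(ω) = ω`, and
`j(K)(i) = j(K(i)) = K(i + 1) < λ`. -/
theorem J_l : ap j l = l := by
  refine IsSubset.antisymm (fun z hz => ?_) (h.subset_J h.l_mem)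
  have h1 := (h.pres_3 (fun l K w => ∀ z, z ∈ₘ l → ∃ i, i ∈ₘ w ∧ ∃ x, x ∈ₘ l ∧ App K i x ∧ z ∈ₘ x)
    h.lV h.KV h.omV).1 (fun z hz => by
      obtain ⟨i, hi, hz⟩ := (h.mem_l z).1 hz
      exact ⟨i, hi, _, h.kap_mem_l hi, app_ap h.funK hi, hz⟩) z hz
  have h2 := (h.pres_2 (fun K w => IsFunOn K w) h.KV h.omV).1 h.funK
  rw [h.J_om] at h1 h2
  obtain ⟨i, hi, x, hx, hx', hz⟩ := h1
  have h3 := (h.J_app h.KV (h.natV hi) (h.K_mem i hi)).1 (app_ap h.funK hi)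
  rw [h.J_nat hi, h.step i hi, h2.app_iff hi] at h3
  rw [h2.app_iff hi, h3] at hx'
  exact (h.mem_l z).2 ⟨suc i, isLimit_om.suc_mem hi, hx' ▸ hz⟩

/-- The `κ_i` are regular. -/
theorem regular_kap {i : M} (hi : i ∈ₘ om M) : ¬ ∃ f, f ∈ₘ Vr lp ∧ ∃ a, a ∈ₘ ap K i ∧
    (∀ x, x ∈ₘ a → ∀ y, y ∈ₘ ap K i → ∀ z, z ∈ₘ ap K i → App f x y → App f x z → y = z) ∧
    ∀ b, b ∈ₘ ap K i → ∃ x, x ∈ₘ a ∧ ∃ y, y ∈ₘ ap K i ∧ App f x y ∧ ¬ y ∈ₘ b := by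
  refine om_induction (fun i => ¬ ∃ f, f ∈ₘ Vr lp ∧ ∃ a, a ∈ₘ ap K i ∧
    (∀ x, x ∈ₘ a → ∀ y, y ∈ₘ ap K i → ∀ z, z ∈ₘ ap K i → App f x y → App f x z → y = z) ∧
    ∀ b, b ∈ₘ ap K i → ∃ x, x ∈ₘ a ∧ ∃ y, y ∈ₘ ap K i ∧ App f x y ∧ ¬ y ∈ₘ b) ?_
    (fun i hi ih => ?_) hi
  -- Suppose `f` maps some `a < κ₀` cofinally into `κ₀`. Below `κ₀` everything is fixed, so `j(f)`
  -- takes on `j(a) = a` the same values as `f`, all below `κ₀`. But `j(f)` is cofinal in `j(κ₀) >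
  -- κ₀` and takes a value that is not below `κ₀`.
  · rintro ⟨f, hf, a, ha, h1, h2⟩
    have h0 := isLimit_om.emp_mem (M := M)
    have hκ := h.K_mem _ h0
    have haV := h.tr _ _ hκ ha
    have h1' := (h.pres_3 (fun f a k => ∀ x, x ∈ₘ a → ∀ y, y ∈ₘ k → ∀ z, z ∈ₘ k →
      App f x y → App f x z → y = z) hf haV hκ).1 h1
    have h2' := (h.pres_3 (fun f a k => ∀ b, b ∈ₘ k → ∃ x, x ∈ₘ a ∧ ∃ y, y ∈ₘ k ∧
      App f x y ∧ ¬ y ∈ₘ b) hf haV hκ).1 h2 _ h.crit_mem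
    rw [h.J_crit ha] at h1' h2'
    obtain ⟨x, hx, y, hy, hxy, hyκ⟩ := h2'
    have hxκ := h.ord_crit.trans hx ha
    have hxV := h.tr _ _ hκ hxκ
    have h3 := (h.pres_3 (fun f k x => ∃ y, y ∈ₘ k ∧ App f x y) hf hκ hxV).2
      ⟨y, hy, by rw [h.J_crit hxκ]; exact hxy⟩
    obtain ⟨z, hz, hxz⟩ := h3
    have hzV := h.tr _ _ hκ hz
    rw [h.J_app hf hxV hzV, h.J_crit hxκ, h.J_crit hz] at hxz
    have := (h.J_mem_J hzV hκ).1 hz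
    rw [h.J_crit hz] at this
    exact hyκ (h1' x hx y hy z this hxy hxz ▸ hz)
  · rw [← h.step i hi]
    exact fun h' => ih ((h.pres_ex_1 (fun k f => ∃ a, a ∈ₘ k ∧
      (∀ x, x ∈ₘ a → ∀ y, y ∈ₘ k → ∀ z, z ∈ₘ k → App f x y → App f x z → y = z) ∧
      ∀ b, b ∈ₘ k → ∃ x, x ∈ₘ a ∧ ∃ y, y ∈ₘ k ∧ App f x y ∧ ¬ y ∈ₘ b) (h.K_mem i hi)).2 h')

/-- `j` is discontinuous at each `κ_i`. -/
theorem exists_bound_J {i : M} (hi : i ∈ₘ om M) :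
    ∃ b, b ∈ₘ ap K (suc i) ∧ ∀ x, x ∈ₘ ap K i → ap j x ∈ₘ b := by
  have hi' := isLimit_om.suc_mem hi
  have hκ := h.K_mem i hi
  by_contra! hno
  -- Without a bound, `j ↾ κ_i` would be a cofinal map from `κ_i` into the regular `κ_{i+1}`. Only
  -- its graph within `κ_i × κ_{i+1}` is taken, which is a set in `V_{lp}`.
  refine h.regular_kap hi' ⟨sep j fun p => p ∈ₘ prod (ap K i) (ap K (suc i)), ?_, ap K i,
    h.kap_mem_suc hi, fun x hx y hy z hz hxy hxz => ?_, fun b hb => ?_⟩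
  · exact subset_mem_Vr h.olp (prod_mem_Vr h.limit_lp hκ (h.K_mem _ hi')) fun p hp => (mem_sep.1 hp).2
  · rw [app_iff, mem_sep, ← app_iff, h.app_j (h.tr _ _ hκ hx)] at hxy hxz
    exact hxy.1.symm.trans hxz.1
  · obtain ⟨x, hx, hxb⟩ := hno b hb
    have hxV := h.tr _ _ hκ hx
    have hy : ap j x ∈ₘ ap K (suc i) := by
      rw [← h.step i hi]
      exact (h.J_mem_J hxV hκ).1 hx
    refine ⟨x, hx, _, hy, ?_, hxb⟩
    rw [app_iff, mem_sep, ← app_iff, h.app_j hxV, pr_mem_prod]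
    exact ⟨rfl, hx, hy⟩

/-! ### Images of stages of the hierarchy and of function spaces -/

theorem funs_mem {A : M} (hA : A ∈ₘ Vr lp) : funs (om M) A ∈ₘ Vr lp := by
  refine subset_mem_Vr h.olp (pow_mem_Vr h.limit_lp (prod_mem_Vr h.limit_lp h.omV hA)) fun s hs => ?_
  exact (mem_sep.1 hs).1

/-- That members are functions is a bounded statement. That no function is missing quantifies over
all of `V_{lp}`, which needs one unbounded quantifier. -/
theorem J_funs {A : M} (hA : A ∈ₘ Vr lp) : ap j (funs (om M) A) = funs (om M) (ap j A) := by
  have hF := h.funs_mem hA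
  refine ext fun s => ?_
  rw [mem_funs]
  constructor
  · intro hs
    have := (h.pres_3 (fun F w A => ∀ s, s ∈ₘ F → IsFun s w A) hF h.omV hA).1
      (fun s hs => mem_funs.1 hs) s hs
    rwa [h.J_om] at this
  · intro hs
    by_contra hno
    have := (h.pres_ex_3 (fun F w A s => IsFun s w A ∧ ¬ s ∈ₘ F) hF h.omV hA).2
      ⟨s, h.tr _ _ (h.funs_mem (h.J_mem hA)) (mem_funs.2 hs), by rw [h.J_om]; exact ⟨hs, hno⟩⟩
    obtain ⟨t, -, ht, htF⟩ := this
    exact htF (mem_funs.2 ht)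

/-- The function `f` that enumerates the stages up to `a` belongs to `V_{lp}`, and `j(f)` is shown
to enumerate them up to `j(a)`. With `V_{a+2}` as a bound for the values, one half of the recursion
clause is a bounded statement. The other half, that no subset of an earlier stage is missing, uses
an unbounded quantifier. -/
theorem J_Vr {a : M} (ha : a ∈ₘ lp) : ap j (Vr a) = Vr (ap j a) := by
  have hlim := h.limit_lp
  have hao := h.olp.mem ha
  have hsa := hlim.suc_mem ha
  have hso := isOrd_suc hao
  obtain ⟨-, f, hf, hfa⟩ := isRank_iff.1 (isRank_Vr hao)
  have hap : ∀ b, b ∈ₘ suc a → ap f b = Vr b := fun b hb => (isRank_iff_eq.1 (hf.isRank hso hb)).2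
  have hmem : ∀ b, b ∈ₘ suc a → Vr b ∈ₘ Vr (suc (suc a)) := fun b hb =>
    Vr_mem_Vr (isOrd_suc hso) ((isOrd_suc hso).trans hb (self_mem_suc _))
  have hVm := Vr_mem_Vr h.olp (hlim.suc_mem hsa)
  have hfV : f ∈ₘ Vr lp := by
    refine subset_mem_Vr h.olp (prod_mem_Vr hlim (h.ordV hsa) hVm) fun p hp => ?_
    obtain ⟨x, y, hx, hp'⟩ := hf.1.1 p hp
    rw [isOPair_iff] at hp'
    subst hp'
    rw [pr_mem_prod, ← (hf.1.app_iff hx).1 (app_iff.2 hp), hap x hx]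
    exact ⟨hx, hmem x hx⟩
  have hfun := (h.pres_2 (fun f s => IsFunOn f s) hfV (h.ordV hsa)).1 hf.1
  have h1 := (h.pres_3 (fun f s B => ∀ b, b ∈ₘ s → ∀ u, u ∈ₘ B → App f b u →
    ∀ z, z ∈ₘ u → ∃ c, c ∈ₘ b ∧ ∃ w, w ∈ₘ B ∧ App f c w ∧ IsSubset z w) hfV (h.ordV hsa) hVm).1
    (fun b hb u hu hbu z hz => by
      obtain ⟨c, w, hc, hw, hz⟩ := (hf.2 b u hb hbu z).1 hz
      have hcs := hso.trans hc hb
      refine ⟨c, hc, w, ?_, hw, hz⟩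
      rw [← (hf.1.app_iff hcs).1 hw, hap c hcs]
      exact hmem c hcs)
  have h2 : ¬ ∃ z, z ∈ₘ Vr lp ∧ _ := mt (h.pres_ex_3 (fun f s B z => ∃ b, b ∈ₘ s ∧ ∃ u, u ∈ₘ B ∧
    App f b u ∧ ¬ z ∈ₘ u ∧ ∃ c, c ∈ₘ b ∧ ∃ w, w ∈ₘ B ∧ App f c w ∧ IsSubset z w)
    hfV (h.ordV hsa) hVm).2 (by
      rintro ⟨z, -, b, hb, u, -, hbu, hzu, c, hc, w, -, hcw, hzw⟩
      exact hzu ((hf.2 b u hb hbu z).2 ⟨c, w, hc, hcw, hzw⟩))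
  have h3 := (h.pres_3 (fun f s B => ∀ b, b ∈ₘ s → ∃ u, u ∈ₘ B ∧ App f b u) hfV (h.ordV hsa) hVm).1
    (fun b hb => ⟨_, hmem b hb, hap b hb ▸ app_ap hf.1 hb⟩)
  rw [h.J_suc' (h.ordV ha)] at hfun h1 h2 h3
  have hJo := h.J_ordinal ha
  have hmemJ : ∀ b u, b ∈ₘ suc (ap j a) → App (ap j f) b u → u ∈ₘ ap j (Vr (suc (suc a))) :=
    fun b u hb hu => by
      obtain ⟨u', hu', hbu⟩ := h3 b hb
      rw [hfun.app_iff hb] at hu hbu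
      rwa [← hu, hbu]
  have hR : RankFun (ap j f) (suc (ap j a)) := by
    refine ⟨hfun, fun b u hb hu z => ⟨fun hz => ?_, ?_⟩⟩
    · obtain ⟨c, hc, w, -, hw⟩ := h1 b hb u (hmemJ b u hb hu) hu z hz
      exact ⟨c, w, hc, hw⟩
    · rintro ⟨c, w, hc, hw, hz⟩
      by_contra hzu
      have hwm := hmemJ c w ((isOrd_suc hJo).trans hc hb) hw
      have hwV := h.tr _ _ (h.J_mem hVm) hwm
      exact h2 ⟨z, subset_mem_Vr h.olp hwV hz, b, hb, u, hmemJ b u hb hu, hu, hzu, c, hc, w, hwm, hw, hz⟩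
  have h4 := (h.J_app hfV (h.ordV ha) (Vr_mem_Vr h.olp ha)).1 hfa
  rw [hfun.app_iff (self_mem_suc _)] at h4
  rw [← h4]
  exact (isRank_iff_eq.1 (hR.isRank (isOrd_suc hJo) (self_mem_suc _))).2

end RR
end Setting
end RankToRank

namespace RankToRank

/-! ### Restrictions of `j` to stages closed under `j` are `Σ₁`-elementary. -/

section Restriction

variable {M : Type*} [setLang.Structure M] [hZ : ZF M]

/-- `u` is the set of assignments which satisfy `c` in `A`. -/
def IsSatSet (A c u : M) : Prop := ∀ s, s ∈ₘ u ↔ IsFun s (om M) A ∧ Sat A c s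

instance {n : ℕ} {a b c : (Fin n → M) → M} [DefFun a] [DefFun b] [DefFun c] :
    Dfn fun v => IsSatSet (a v) (b v) (c v) :=
  Dfn.comp_three (P := IsSatSet) (by unfold IsSatSet; infer_instance)

theorem exists_isSatSet (A c : M) : ∃ u, IsSatSet A c u :=
  ⟨sep (funs (om M) A) fun s => Sat A c s, fun s => by rw [mem_sep, mem_funs]⟩

theorem eq_upd_iff {s t i x A : M} (hs : IsFun s (om M) A) (ht : IsFun t (om M) A)
    (hi : i ∈ₘ om M) (hx : x ∈ₘ A) : t = upd s i x ↔ App t i x ∧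
      ∀ k, k ∈ₘ om M → ∀ y, y ∈ₘ A → k ≠ i → (App s k y ↔ App t k y) := by
  have hu := hs.upd hi hx
  constructor
  · rintro rfl
    refine ⟨app_upd.2 (Or.inr ⟨rfl, rfl⟩), fun k hk y hy hki => ?_⟩
    simp [app_upd, hki]
  · rintro ⟨h1, h2⟩
    refine ht.1.ext hu.1 fun k hk => ?_
    by_cases hki : k = i
    · subst hki
      rw [ap_upd_self hs hi hx]
      exact (ht.1.app_iff hi).1 h1
    · rw [ap_upd_of_ne hs hi hx hk hki]
      exact (ht.1.app_iff hk).1 ((h2 k hk _ (hs.ap_mem hk) hki).1 (app_ap hs.1 hk))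

namespace RR

variable {l lp j K : M} (h : RR l lp j K)

include h

theorem isSatSet_mem {A c u : M} (hA : A ∈ₘ Vr lp) (hu : IsSatSet A c u) : u ∈ₘ Vr lp :=
  subset_mem_Vr h.olp (h.funs_mem hA) fun s hs => mem_funs.2 ((hu s).1 hs).1

theorem isSatSet_image {A c u : M} (hA : A ∈ₘ Vr lp) (hu : IsSatSet A c u)
    (hJ : ∀ s, IsFun s (om M) (ap j A) → (s ∈ₘ ap j u ↔ Sat (ap j A) c s)) :
    IsSatSet (ap j A) c (ap j u) := by
  have hsub := (h.pres_2 (fun u F => IsSubset u F) (h.isSatSet_mem hA hu) (h.funs_mem hA)).1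
    fun s hs => mem_funs.2 ((hu s).1 hs).1
  rw [h.J_funs hA] at hsub
  exact fun s => ⟨fun hs => ⟨mem_funs.1 (hsub s hs), (hJ s (mem_funs.1 (hsub s hs))).1 hs⟩,
    fun hs => (hJ s hs.1).2 hs.2⟩

/-- Induction on the code inside the model: each Tarski clause is a bounded statement relating the
satisfaction sets of `c` and of its immediate subformulas, so `j` transfers it. The clauses mention
variables and function spaces, whence the need for `j(i) = i`, `j(ω) = ω` and `RR.J_funs`. -/
theorem J_isSatSet {A c : M} (hA : A ∈ₘ Vr lp) (hc : IsFormula c) :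
    ∀ u, IsSatSet A c u → IsSatSet (ap j A) c (ap j u) := by
  have hF := h.funs_mem hA
  have hmF : ∀ {s}, s ∈ₘ funs (om M) A ↔ IsFun s (om M) A := mem_funs
  refine formula_induction (fun c => ∀ u, IsSatSet A c u → IsSatSet (ap j A) c (ap j u))
    (fun i k hi hk u hu => ?_) (fun i k hi hk u hu => ?_) (fun a ha ih u hu => ?_)
    (fun a b ha hb iha ihb u hu => ?_) (fun i a hi ha ih u hu => ?_) hc <;>
    have hU := h.isSatSet_mem hA hu <;> refine h.isSatSet_image hA hu fun s hs => ?_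
  · have key := (h.pres_5 (fun F u A i k => ∀ s, s ∈ₘ F → (s ∈ₘ u ↔ ∃ x, x ∈ₘ A ∧ ∃ y, y ∈ₘ A ∧
      App s i x ∧ App s k y ∧ x ∈ₘ y)) hF hU hA (h.natV hi) (h.natV hk)).1 (fun s hs => by
        have hs := hmF.1 hs
        rw [hu s, sat_tg_zero hs hi hk, and_iff_right hs]
        exact ⟨fun hm => ⟨_, hs.ap_mem hi, _, hs.ap_mem hk, app_ap hs.1 hi, app_ap hs.1 hk, hm⟩,
          by simp only [hs.1.app_iff hi, hs.1.app_iff hk]; rintro ⟨_, -, _, -, rfl, rfl, hm⟩; exact hm⟩)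
    rw [h.J_funs hA, h.J_nat hi, h.J_nat hk] at key
    rw [key s (mem_funs.2 hs), sat_tg_zero hs hi hk]
    exact ⟨by simp only [hs.1.app_iff hi, hs.1.app_iff hk]; rintro ⟨_, -, _, -, rfl, rfl, hm⟩; exact hm,
      fun hm => ⟨_, hs.ap_mem hi, _, hs.ap_mem hk, app_ap hs.1 hi, app_ap hs.1 hk, hm⟩⟩
  · have key := (h.pres_5 (fun F u A i k => ∀ s, s ∈ₘ F → (s ∈ₘ u ↔ ∃ x, x ∈ₘ A ∧
      App s i x ∧ App s k x)) hF hU hA (h.natV hi) (h.natV hk)).1 (fun s hs => by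
        have hs := hmF.1 hs
        rw [hu s, sat_tg_one hs hi hk, and_iff_right hs]
        exact ⟨fun hm => ⟨_, hs.ap_mem hi, app_ap hs.1 hi, hm ▸ app_ap hs.1 hk⟩,
          by simp only [hs.1.app_iff hi, hs.1.app_iff hk]; rintro ⟨_, -, rfl, hm⟩; exact hm.symm⟩)
    rw [h.J_funs hA, h.J_nat hi, h.J_nat hk] at key
    rw [key s (mem_funs.2 hs), sat_tg_one hs hi hk]
    exact ⟨by simp only [hs.1.app_iff hi, hs.1.app_iff hk]; rintro ⟨_, -, rfl, hm⟩; exact hm.symm,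
      fun hm => ⟨_, hs.ap_mem hi, app_ap hs.1 hi, hm ▸ app_ap hs.1 hk⟩⟩
  · obtain ⟨w, hw⟩ := exists_isSatSet A a
    have key := (h.pres_3 (fun F u w => ∀ s, s ∈ₘ F → (s ∈ₘ u ↔ ¬ s ∈ₘ w)) hF hU
      (h.isSatSet_mem hA hw)).1 (fun s hs => by
        have hs := hmF.1 hs
        rw [hu s, hw s, sat_tg_two hs ha]
        tauto)
    rw [h.J_funs hA] at key
    rw [key s (mem_funs.2 hs), ih w hw s, sat_tg_two hs ha]
    tauto
  · obtain ⟨w, hw⟩ := exists_isSatSet A a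
    obtain ⟨w', hw'⟩ := exists_isSatSet A b
    have key := (h.pres_4 (fun F u w w' => ∀ s, s ∈ₘ F → (s ∈ₘ u ↔ s ∈ₘ w ∧ s ∈ₘ w')) hF hU
      (h.isSatSet_mem hA hw) (h.isSatSet_mem hA hw')).1 (fun s hs => by
        have hs := hmF.1 hs
        rw [hu s, hw s, hw' s, sat_tg_three hs ha hb]
        tauto)
    rw [h.J_funs hA] at key
    rw [key s (mem_funs.2 hs), iha w hw s, ihb w' hw' s, sat_tg_three hs ha hb]
    tauto
  · obtain ⟨w, hw⟩ := exists_isSatSet A a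
    have hup : ∀ {B v s : M}, IsSatSet B a v → IsFun s (om M) B →
        ((∃ x, x ∈ₘ B ∧ ∃ t, t ∈ₘ v ∧ App t i x ∧ ∀ k, k ∈ₘ om M → ∀ y, y ∈ₘ B → k ≠ i →
          (App s k y ↔ App t k y)) ↔ Sat B (tg 4 i a) s) := fun {B v s} hv hs => by
      rw [sat_tg_four hs hi ha]
      refine exists_congr fun x => and_congr_right fun hx => ?_
      constructor
      · rintro ⟨t, ht, h1⟩
        rw [hv] at ht
        rw [← (eq_upd_iff hs ht.1 hi hx).2 h1]
        exact ht.2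
      · intro h1
        have hu := hs.upd hi hx
        exact ⟨_, (hv _).2 ⟨hu, h1⟩, (eq_upd_iff hs hu hi hx).1 rfl⟩
    have key := (h.pres_6 (fun F u w A i o => ∀ s, s ∈ₘ F → (s ∈ₘ u ↔ ∃ x, x ∈ₘ A ∧ ∃ t, t ∈ₘ w ∧
      App t i x ∧ ∀ k, k ∈ₘ o → ∀ y, y ∈ₘ A → k ≠ i → (App s k y ↔ App t k y))) hF hU
      (h.isSatSet_mem hA hw) hA (h.natV hi) h.omV).1 (fun s hs => by
        have hs := hmF.1 hs
        rw [hup hw hs, hu s, and_iff_right hs])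
    rw [h.J_funs hA, h.J_nat hi, h.J_om] at key
    rw [key s (mem_funs.2 hs), hup (ih w hw) hs]

theorem J_assignment {A s : M} (hA : A ∈ₘ Vr lp) (hs : IsFun s (om M) A) :
    IsFun (ap j s) (om M) (ap j A) ∧ ∀ i, i ∈ₘ om M → ap (ap j s) i = ap j (ap s i) := by
  have hF := h.funs_mem hA
  have hsF := mem_funs.2 hs
  have hsV := h.tr _ _ hF hsF
  have h1 := (h.J_mem_J hsV hF).1 hsF
  rw [h.J_funs hA, mem_funs] at h1
  refine ⟨h1, fun i hi => (h1.1.app_iff hi).1 ?_⟩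
  have := (h.J_app hsV (h.natV hi) (h.tr _ _ hA (hs.ap_mem hi))).1 (app_ap hs.1 hi)
  rwa [h.J_nat hi] at this

theorem sat_J {A c s : M} (hA : A ∈ₘ Vr lp) (hc : IsFormula c) (hs : IsFun s (om M) A) :
    Sat A c s ↔ Sat (ap j A) c (ap j s) := by
  obtain ⟨u, hu⟩ := exists_isSatSet A c
  have h1 := hu s
  have h2 := h.J_isSatSet hA hc u hu (ap j s)
  rw [and_iff_right hs] at h1
  rw [and_iff_right (h.J_assignment hA hs).1] at h2
  rw [← h1, ← h2]
  exact h.J_mem_J (h.tr _ _ (h.funs_mem hA) (mem_funs.2 hs)) (h.isSatSet_mem hA hu)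

/-- `j ↾ V_d`. -/
theorem restriction_iff {d k : M} (hd : d ∈ₘ lp) (hk : IsRestriction j (Vr d) k) {x y : M} :
    App k x y ↔ x ∈ₘ Vr d ∧ ap j x = y := by
  have hsub := Vr_mono (h.olp.mem hd) h.olp (h.olp.1 _ hd)
  rw [app_iff, hk, ← app_iff]
  constructor
  · rintro ⟨hxy, x', y', hx', he⟩
    rw [isOPair_iff, pr_inj] at he
    obtain ⟨rfl, -⟩ := he
    exact ⟨hx', (h.app_j (hsub _ hx')).1 hxy⟩
  · rintro ⟨hx, rfl⟩
    exact ⟨(h.app_j (hsub _ hx)).2 rfl, x, _, hx, isOPair_iff.2 rfl⟩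

theorem J_mem_Vr {d x : M} (hd : IsLimit d) (hdl : d ∈ₘ lp)
    (hcl : ∀ a, a ∈ₘ d → ap j a ∈ₘ d) (hx : x ∈ₘ Vr d) : ap j x ∈ₘ Vr d := by
  obtain ⟨a, ha, hx⟩ := (mem_Vr_limit hd).1 hx
  have hal := h.olp.trans ha hdl
  have haV := Vr_mem_Vr h.olp hal
  have := (h.J_mem_J (h.tr _ _ haV hx) haV).1 hx
  rw [h.J_Vr hal] at this
  exact (mem_Vr_limit hd).2 ⟨_, hcl a ha, this⟩

theorem isFun_restriction {d k : M} (hd : IsLimit d) (hdl : d ∈ₘ lp)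
    (hcl : ∀ a, a ∈ₘ d → ap j a ∈ₘ d) (hk : IsRestriction j (Vr d) k) : IsFun k (Vr d) (Vr d) := by
  refine ⟨⟨fun p hp => ((hk p).1 hp).2, fun x hx => ⟨_, (h.restriction_iff hdl hk).2 ⟨hx, rfl⟩,
    fun y hy => ((h.restriction_iff hdl hk).1 hy).2.symm⟩⟩, fun x y hxy => ?_⟩
  obtain ⟨hx, rfl⟩ := (h.restriction_iff hdl hk).1 hxy
  exact h.J_mem_Vr hd hdl hcl hx

/-- On a bounded assignment, `Σ₁` truth in `V_d` is witnessed in some `V_b` with `b < d`. There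
`RR.sat_J` compares `V_b` with `V_{j(b)}`, still a stage below `d`, and upward absoluteness returns
to `V_d`. -/
theorem sigma1_restriction {d k : M} (hd : IsLimit d) (hdl : d ∈ₘ lp)
    (hcl : ∀ a, a ∈ₘ d → ap j a ∈ₘ d) (hk : IsRestriction j (Vr d) k) :
    IsSigma1Elementary (Vr d) k := by
  refine ⟨h.isFun_restriction hd hdl hcl hk, fun c s t hc hs ht hst => ?_⟩
  rw [isAssignment_iff] at hs ht
  have hst' : ∀ i, i ∈ₘ om M → ap t i = ap j (ap s i) := fun i hi =>
    (ht.1.app_iff hi).1 (hst i _ _ (app_ap hs.1 hi)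
      ((h.restriction_iff hdl hk).2 ⟨hs.ap_mem hi, rfl⟩))
  obtain ⟨N, hN, hsupp⟩ := exists_support (A := Vr d) hc.isFormula
  obtain ⟨b, s', hb, hs', hss'⟩ := exists_bounded_assignment hd hs hN
  have hVd : ∀ {b}, b ∈ₘ d → IsSubset (Vr b) (Vr d) := fun {b} hb =>
    Vr_mono (hd.1.mem hb) hd.1 (hd.1.1 b hb)
  have htr : ∀ {a}, a ∈ₘ d → ∀ x y, x ∈ₘ Vr a → y ∈ₘ x → y ∈ₘ Vr a := fun {a} ha x y hx hy =>
    Vr_trans (hd.1.mem ha) hx hy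
  have hlp : ∀ {b}, b ∈ₘ d → b ∈ₘ lp := fun hb => h.olp.trans hb hdl
  have hA : ∀ {b}, b ∈ₘ d → Vr b ∈ₘ Vr lp := fun hb => Vr_mem_Vr h.olp (hlp hb)
  have hJs := h.J_assignment (hA hb) hs'
  rw [h.J_Vr (hlp hb)] at hJs
  have hJs'd := hJs.1.mono (hVd (hcl b hb))
  rw [hsupp s s' hs (hs'.mono (hVd hb)) hss', hsupp t (ap j s') ht hJs'd fun i hi => by
    have hio := isLimit_om.1.trans hi hN
    rw [hst' i hio, hJs.2 i hio, hss' i hi]]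
  constructor
  · intro hsat
    obtain ⟨b', hb', hsb', hsat⟩ := hc.exists_Vr hd s' b hb hs' hsat
    rw [h.sat_J (hA hb') hc.isFormula hsb', h.J_Vr (hlp hb')] at hsat
    have := (h.J_assignment (hA hb') hsb').1
    rw [h.J_Vr (hlp hb')] at this
    exact hc.upward (htr (hcl _ hb')) (hVd (hcl _ hb')) _ this hsat
  · intro hsat
    obtain ⟨b', hb', hsb', hsat⟩ := hc.exists_Vr hd (ap j s') (ap j b) (hcl b hb) hJs.1 hsat
    -- Pulling truth back along `j` requires a stage of the form `V_{j(e)}`. Any `e` above `b` and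
    -- `b'` will do, since `b' ≤ e ≤ j(e)`.
    obtain ⟨e, he, h1, h2⟩ := exists_Vr_two hd (Vr_mem_Vr hd.1 hb) (Vr_mem_Vr hd.1 hb')
    have hse := hs'.mono (c := Vr e) fun z hz => htr he _ z h1 hz
    have hJe := hcl e he
    have hsub : IsSubset (Vr b') (Vr (ap j e)) := fun z hz =>
      Vr_mono (hd.1.mem he) (hd.1.mem hJe) (h.subset_J (hlp he)) _ (htr he _ z h2 hz)
    have hsat := hc.upward (htr hb') hsub _ hsb' hsat
    rw [← h.J_Vr (hlp he), ← h.sat_J (hA he) hc.isFormula hse] at hsat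
    exact hc.upward (htr he) (hVd he) _ hse hsat

end RR
end Restriction
end RankToRank

namespace RankToRank

/-! ### Gödel pairing on `λ`. -/

section Pairing

variable {M : Type*} [setLang.Structure M] [hZ : ZF M]

instance {n : ℕ} {p x y z : (Fin n → M) → M} [DefFun p] [DefFun x] [DefFun y] [DefFun z] :
    Dfn fun v => Tri (p v) (x v) (y v) (z v) :=
  Dfn.congr (Q := fun v => pr (x v) (pr (y v) (z v)) ∈ₘ p v) inferInstance fun _ => tri_iff

/-- For ordinals: `max a' b' < max a b`. -/
def MaxLt (a' b' a b : M) : Prop := (a' ∈ₘ a ∨ a' ∈ₘ b) ∧ (b' ∈ₘ a ∨ b' ∈ₘ b)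

/-- Gödel's well-ordering of pairs of ordinals. -/
def GodelLt (a' b' a b : M) : Prop :=
  MaxLt a' b' a b ∨ ¬ MaxLt a b a' b' ∧ (a' ∈ₘ a ∨ a' = a ∧ b' ∈ₘ b)

instance {n : ℕ} {a b c d : (Fin n → M) → M} [DefFun a] [DefFun b] [DefFun c] [DefFun d] :
    Dfn fun v => GodelLt (a v) (b v) (c v) (d v) := by
  unfold GodelLt MaxLt
  infer_instance

instance {n : ℕ} {a b c d : (Fin n → M) → M} [IsVar a] [IsVar b] [IsVar c] [IsVar d] :
    D0 fun v => GodelLt (a v) (b v) (c v) (d v) := by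
  unfold GodelLt MaxLt
  infer_instance

/-- `G` is the set of all `(a, (b, z))` such that `z ∈ l` is less than the rank of `(a, b)` in
Gödel's well-ordering of `l × l`. -/
def IsGodelRank (G l : M) : Prop :=
  ∀ a, a ∈ₘ l → ∀ b, b ∈ₘ l → ∀ z, z ∈ₘ l → (Tri G a b z ↔ ∃ a', a' ∈ₘ l ∧ ∃ b', b' ∈ₘ l ∧
    GodelLt a' b' a b ∧ (Tri G a' b' z ∨ ∀ w, w ∈ₘ l → (w ∈ₘ z ↔ Tri G a' b' w)))

instance {n : ℕ} {G l : (Fin n → M) → M} [IsVar G] [IsVar l] :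
    D0 fun v => IsGodelRank (G v) (l v) :=
  D0.comp_two (P := IsGodelRank) (by unfold IsGodelRank; infer_instance)

theorem IsOrd.un_eq {a b : M} (ha : IsOrd a) (hb : IsOrd b) : un a b = a ∨ un a b = b := by
  rcases ha.trichotomy hb with h | rfl | h
  · right
    refine ext fun z => ?_
    rw [mem_un]
    exact ⟨fun hz => hz.elim (fun hz => hb.trans hz h) id, Or.inr⟩
  · left
    refine ext fun z => ?_
    rw [mem_un, or_self]
  · left
    refine ext fun z => ?_
    rw [mem_un]
    exact ⟨fun hz => hz.elim id (fun hz => ha.trans hz h), Or.inl⟩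

theorem IsOrd.un {a b : M} (ha : IsOrd a) (hb : IsOrd b) : IsOrd (un a b) := by
  rcases ha.un_eq hb with e | e <;> rwa [e]

theorem maxLt_iff {a' b' a b : M} (ha' : IsOrd a') (hb' : IsOrd b') (ha : IsOrd a) (hb : IsOrd b) :
    MaxLt a' b' a b ↔ RankToRank.un a' b' ∈ₘ RankToRank.un a b := by
  have ho := ha.un hb
  have ho' := ha'.un hb'
  constructor
  · rintro ⟨h1, h2⟩
    rw [← mem_un] at h1 h2
    rcases ha'.un_eq hb' with e | e <;> rwa [e]
  · intro h
    have key : ∀ c, IsOrd c → IsSubset c (RankToRank.un a' b') → c ∈ₘ a ∨ c ∈ₘ b :=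
      fun c hc hsub => by
        rw [← mem_un]
        rcases hc.subset_cases ho' hsub with rfl | hc
        exacts [h, ho.trans hc h]
    exact ⟨key a' ha' fun z hz => mem_un.2 (Or.inl hz), key b' hb' fun z hz => mem_un.2 (Or.inr hz)⟩

theorem GodelLt.subset {a' b' a b : M} (ha' : IsOrd a') (hb' : IsOrd b') (ha : IsOrd a)
    (hb : IsOrd b) (h : GodelLt a' b' a b) :
    IsSubset (RankToRank.un a' b') (RankToRank.un a b) := by
  rcases h with h | ⟨h, -⟩
  · rw [maxLt_iff ha' hb' ha hb] at h
    exact (ha.un hb).1 _ h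
  · rw [maxLt_iff ha hb ha' hb'] at h
    exact ((ha.un hb).not_mem_iff (ha'.un hb')).1 h

theorem GodelLt.total {a' b' a b : M} (ha' : IsOrd a') (hb' : IsOrd b') (ha : IsOrd a)
    (hb : IsOrd b) : GodelLt a' b' a b ∨ (a' = a ∧ b' = b) ∨ GodelLt a b a' b' := by
  by_cases h1 : MaxLt a' b' a b
  · exact Or.inl (Or.inl h1)
  by_cases h2 : MaxLt a b a' b'
  · exact Or.inr (Or.inr (Or.inl h2))
  unfold GodelLt
  have h3 := ha'.trichotomy ha
  have h4 := hb'.trichotomy hb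
  have h5 : a = a' ↔ a' = a := eq_comm
  tauto

/-- Three nested inductions on ordinals: on the maximum of the pair, then on the first coordinate,
then on the second. -/
theorem godel_induction {l : M} (hl : IsOrd l) (P : M → M → Prop)
    [hP : Dfn fun v : Fin 2 → M => P (v 0) (v 1)]
    (h : ∀ a b, a ∈ₘ l → b ∈ₘ l →
      (∀ a' b', a' ∈ₘ l → b' ∈ₘ l → GodelLt a' b' a b → P a' b') → P a b) :
    ∀ a b, a ∈ₘ l → b ∈ₘ l → P a b := by
  have hP' := fun {n} {a b : (Fin n → M) → M} [DefFun a] [DefFun b] =>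
    Dfn.comp_two hP (a := a) (b := b)
  have key : ∀ m, IsOrd m → ∀ a b, a ∈ₘ l → b ∈ₘ l → RankToRank.un a b = m → P a b := by
    intro m hm
    refine hm.induction (fun m => ∀ a b, a ∈ₘ l → b ∈ₘ l → RankToRank.un a b = m → P a b) ?_
    intro m hm ihm
    have key2 : ∀ a, IsOrd a → ∀ b, a ∈ₘ l → b ∈ₘ l → RankToRank.un a b = m → P a b := by
      intro a ha
      refine ha.induction (fun a => ∀ b, a ∈ₘ l → b ∈ₘ l → RankToRank.un a b = m → P a b) ?_
      intro a ha iha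
      have key3 : ∀ b, IsOrd b → a ∈ₘ l → b ∈ₘ l → RankToRank.un a b = m → P a b := by
        intro b hb
        refine hb.induction (fun b => a ∈ₘ l → b ∈ₘ l → RankToRank.un a b = m → P a b) ?_
        intro b hb ihb hal hbl hab
        refine h a b hal hbl fun a' b' ha' hb' hlt => ?_
        have hao' := hl.mem ha'
        have hbo' := hl.mem hb'
        have hsub := hlt.subset hao' hbo' ha hb
        rw [hab] at hsub
        rcases (hao'.un hbo').subset_cases hm hsub with e | e
        · rcases hlt with hlt | ⟨-, hlt | ⟨rfl, hlt⟩⟩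
          · rw [maxLt_iff hao' hbo' ha hb, hab, e] at hlt
            exact absurd hlt (mem_irrefl _)
          · exact iha a' hlt b' ha' hb' e
          · exact ihb b' hlt ha' hb' e
        · exact ihm _ e a' b' ha' hb' rfl
      exact fun b hal hbl => key3 b (hl.mem hbl) hal hbl
    exact fun a b hal => key2 a (hl.mem hal) b hal
  exact fun a b ha hb => key _ ((hl.mem ha).un (hl.mem hb)) a b ha hb rfl

theorem exists_isGodelRank {l : M} (hl : IsOrd l) :
    ∃ G, IsSubset G (prod l (prod l l)) ∧ IsGodelRank G l := by
  let R : M → M → Prop := fun q' q => ∃ a' b' a b, q' = pr a' b' ∧ q = pr a b ∧ GodelLt a' b' a b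
  have hR : Dfn fun v : Fin 2 → M => R (v 0) (v 1) := by
    simp only [R]
    infer_instance
  have hR' := fun {n} {a b : (Fin n → M) → M} [DefFun a] [DefFun b] =>
    Dfn.comp_two hR (a := a) (b := b)
  obtain ⟨H, hH⟩ := exists_recursion (prod l l) l R
    (fun q H z => ∃ q', q' ∈ₘ prod l l ∧ R q' q ∧ (App H q' z ∨ ∀ w, w ∈ₘ z ↔ App H q' w))
    (fun X hX q hq => by
      obtain ⟨a, b, ha, hb, rfl⟩ := mem_prod.1 hq
      refine godel_induction hl (fun a b => pr a b ∈ₘ X) (fun a b ha hb ih => ?_) a b ha hb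
      refine hX _ (pr_mem_prod.2 ⟨ha, hb⟩) fun q' hq' hlt => ?_
      obtain ⟨a', b', a₁, b₁, rfl, he, hlt⟩ := hlt
      rw [pr_inj] at he
      obtain ⟨rfl, rfl⟩ := he
      rw [pr_mem_prod] at hq'
      exact ih a' b' hq'.1 hq'.2 hlt)
    (fun q G G' hq hGG' z => exists_congr fun q' => and_congr_right fun hq' =>
      and_congr_right fun hlt => by simp only [hGG' q' hq' hlt])
  have hRp : ∀ {a' b' a b}, R (pr a' b') (pr a b) ↔ GodelLt a' b' a b := fun {a' b' a b} => by
    simp only [R, pr_inj]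
    exact ⟨fun ⟨_, _, _, _, ⟨h1, h2⟩, ⟨h3, h4⟩, h⟩ => by rwa [h1, h2, h3, h4],
      fun h => ⟨_, _, _, _, ⟨rfl, rfl⟩, ⟨rfl, rfl⟩, h⟩⟩
  let G := sep (prod l (prod l l)) fun t => ∃ a b z, t = pr a (pr b z) ∧ App H (pr a b) z
  have hG : ∀ a b z, Tri G a b z ↔ App H (pr a b) z := fun a b z => by
    rw [tri_iff, mem_sep, pr_mem_prod, pr_mem_prod]
    constructor
    · rintro ⟨-, a', b', z', he, h⟩
      rw [pr_inj, pr_inj] at he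
      rwa [he.1, he.2.1, he.2.2]
    · intro h
      have h1 := (hH _ _).1 h
      rw [pr_mem_prod] at h1
      exact ⟨⟨h1.1.1, h1.1.2, h1.2.1⟩, a, b, z, rfl, h⟩
  refine ⟨G, fun t ht => (mem_sep.1 ht).1, fun a ha b hb z hz => ?_⟩
  simp only [hG]
  rw [hH, pr_mem_prod, and_iff_right ⟨ha, hb⟩, and_iff_right hz]
  have hw : ∀ q, (∀ w, w ∈ₘ l → (w ∈ₘ z ↔ App H q w)) ↔ ∀ w, w ∈ₘ z ↔ App H q w := fun q =>
    ⟨fun h w => ⟨fun hw => (h w (hl.trans hw hz)).1 hw, fun hw => (h w ((hH _ _).1 hw).2.1).2 hw⟩,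
      fun h w _ => h w⟩
  simp only [hw]
  constructor
  · rintro ⟨q', hq', hlt, h⟩
    obtain ⟨a', b', ha', hb', rfl⟩ := mem_prod.1 hq'
    exact ⟨a', ha', b', hb', hRp.1 hlt, h⟩
  · rintro ⟨a', ha', b', hb', hlt, h⟩
    exact ⟨_, pr_mem_prod.2 ⟨ha', hb'⟩, hRp.2 hlt, h⟩

/-- Used with `G' = j(G)`: as `j(λ) = λ`, both obey the same recursion, so `j` fixes the pairing on
`λ`. -/
theorem IsGodelRank.unique {l G G' : M} (hl : IsOrd l) (hG : IsGodelRank G l)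
    (hG' : IsGodelRank G' l) : ∀ a b, a ∈ₘ l → b ∈ₘ l → ∀ z, z ∈ₘ l → (Tri G a b z ↔ Tri G' a b z) := by
  refine godel_induction hl (fun a b => ∀ z, z ∈ₘ l → (Tri G a b z ↔ Tri G' a b z)) ?_
  intro a b ha hb ih z hz
  rw [hG a ha b hb z hz, hG' a ha b hb z hz]
  refine exists_congr fun a' => and_congr_right fun ha' => exists_congr fun b' =>
    and_congr_right fun hb' => and_congr_right fun hlt => or_congr (ih a' b' ha' hb' hlt z hz) ?_
  exact forall_congr' fun w => imp_congr_right fun hw => iff_congr Iff.rfl (ih a' b' ha' hb' hlt w hw)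

/-- The rank of `(a, b)`, cut off at `l`. -/
noncomputable def gr (G l a b : M) : M := sep l fun z => Tri G a b z

theorem mem_gr {G l a b z : M} : z ∈ₘ gr G l a b ↔ z ∈ₘ l ∧ Tri G a b z := mem_sep

theorem IsGodelRank.mem_gr_iff {G l a b z : M} (hl : IsOrd l) (hG : IsGodelRank G l)
    (ha : a ∈ₘ l) (hb : b ∈ₘ l) : z ∈ₘ gr G l a b ↔ z ∈ₘ l ∧ ∃ a', a' ∈ₘ l ∧ ∃ b', b' ∈ₘ l ∧
      GodelLt a' b' a b ∧ (z ∈ₘ gr G l a' b' ∨ z = gr G l a' b') := by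
  rw [mem_gr]
  refine and_congr_right fun hz => ?_
  rw [hG a ha b hb z hz]
  simp only [mem_gr, hz, true_and]
  refine exists_congr fun a' => and_congr_right fun ha' => exists_congr fun b' =>
    and_congr_right fun hb' => and_congr_right fun hlt => or_congr Iff.rfl ?_
  constructor
  · exact fun h => ext fun w => by
      rw [mem_gr]
      exact ⟨fun hw => ⟨hl.trans hw hz, (h w (hl.trans hw hz)).1 hw⟩, fun hw => (h w hw.1).2 hw.2⟩
  · rintro rfl w hw
    rw [mem_gr, and_iff_right hw]

theorem IsGodelRank.isOrd_gr {G l : M} (hl : IsOrd l) (hG : IsGodelRank G l) :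
    ∀ a b, a ∈ₘ l → b ∈ₘ l → IsOrd (gr G l a b) := by
  have key : ∀ a b, a ∈ₘ l → b ∈ₘ l → ∀ z w, z ∈ₘ gr G l a b → w ∈ₘ z → w ∈ₘ gr G l a b := by
    have hd : Dfn fun v : Fin 2 → M => ∀ z w, z ∈ₘ gr G l (v 0) (v 1) → w ∈ₘ z →
      w ∈ₘ gr G l (v 0) (v 1) := by
        simp only [mem_gr]
        infer_instance
    refine godel_induction hl (fun a b => ∀ z w, z ∈ₘ gr G l a b → w ∈ₘ z → w ∈ₘ gr G l a b) ?_
    intro a b ha hb ih z w hz hw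
    rw [hG.mem_gr_iff hl ha hb] at hz ⊢
    obtain ⟨hz, a', ha', b', hb', hlt, h⟩ := hz
    refine ⟨hl.trans hw hz, a', ha', b', hb', hlt, Or.inl ?_⟩
    rcases h with h | rfl
    exacts [ih a' b' ha' hb' hlt z w h hw, hw]
  exact fun a b ha hb => isOrd_of_forall (fun z hz w hw => key a b ha hb z w hz hw)
    fun z hz => hl.mem (mem_gr.1 hz).1

/-- Ranks below that of `(a, b)` are attained on pairs with no larger maximum. -/
theorem IsGodelRank.exists_eq {G l : M} (hl : IsOrd l) (hG : IsGodelRank G l) (c : M) :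
    ∀ a b, a ∈ₘ l → b ∈ₘ l → c ∈ₘ gr G l a b → ∃ a', a' ∈ₘ l ∧ ∃ b', b' ∈ₘ l ∧
      IsSubset (un a' b') (un a b) ∧ c = gr G l a' b' := by
  have hd : Dfn fun v : Fin 2 → M => c ∈ₘ gr G l (v 0) (v 1) → ∃ a', a' ∈ₘ l ∧ ∃ b', b' ∈ₘ l ∧
      IsSubset (un a' b') (un (v 0) (v 1)) ∧ c = gr G l a' b' := by
    have : ∀ a b, c = gr G l a b ↔ ∀ z, z ∈ₘ c ↔ z ∈ₘ l ∧ Tri G a b z := fun a b =>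
      ⟨by rintro rfl z; exact mem_gr, fun h => ext fun z => (h z).trans mem_gr.symm⟩
    simp only [mem_gr, this]
    infer_instance
  refine godel_induction hl (fun a b => c ∈ₘ gr G l a b → ∃ a', a' ∈ₘ l ∧ ∃ b', b' ∈ₘ l ∧
      IsSubset (un a' b') (un a b) ∧ c = gr G l a' b') ?_
  intro a b ha hb ih hc
  rw [hG.mem_gr_iff hl ha hb] at hc
  obtain ⟨hc, a', ha', b', hb', hlt, h⟩ := hc
  have hsub := hlt.subset (hl.mem ha') (hl.mem hb') (hl.mem ha) (hl.mem hb)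
  rcases h with h | h
  · obtain ⟨a'', ha'', b'', hb'', hs, he⟩ := ih a' b' ha' hb' hlt h
    exact ⟨a'', ha'', b'', hb'', hs.trans hsub, he⟩
  · exact ⟨a', ha', b', hb', hsub, h⟩

namespace RR

variable {l lp j K : M} (h : RR l lp j K)

include h

/-- If some pair below `κ₀` had rank at least `κ₀`, then `κ₀` itself would be the rank of a pair
`(a', b')` below `κ₀`. That pair is fixed by `j`, and `j(G)` agrees with `G` on `λ`, so `κ₀` would
be fixed too. Elementarity carries closure from `κ_i` to `κ_{i+1}`. -/
theorem gr_mem_kap {G : M} (hGl : IsSubset G (prod l (prod l l))) (hG : IsGodelRank G l) {i : M}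
    (hi : i ∈ₘ om M) : ∀ a, a ∈ₘ ap K i → ∀ b, b ∈ₘ ap K i → gr G l a b ∈ₘ ap K i := by
  have hGV : G ∈ₘ Vr lp := subset_mem_Vr h.olp
    (prod_mem_Vr h.limit_lp h.lV (prod_mem_Vr h.limit_lp h.lV h.lV)) hGl
  have hJG := (h.pres_2 (fun G l => IsGodelRank G l) hGV h.lV).1 hG
  rw [h.J_l] at hJG
  have hJ := hJG.unique h.ol hG
  have hkl : ∀ {i x}, i ∈ₘ om M → x ∈ₘ ap K i → x ∈ₘ l := fun hi hx => (h.mem_l _).2 ⟨_, hi, hx⟩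
  have hgr : ∀ {a b c}, (∀ z, z ∈ₘ c → z ∈ₘ l) →
      (c = gr G l a b ↔ ∀ z, z ∈ₘ l → (z ∈ₘ c ↔ Tri G a b z)) := fun {a b c} hc =>
    ⟨by rintro rfl z hz; rw [mem_gr, and_iff_right hz], fun hz => ext fun z => by
      rw [mem_gr]; exact ⟨fun h => ⟨hc z h, (hz z (hc z h)).1 h⟩, fun h => (hz z h.1).2 h.2⟩⟩
  have hl1 : ∀ c, c ∈ₘ l → ∀ z, z ∈ₘ c → z ∈ₘ l := fun c hc z hz => h.ol.trans hz hc
  have h0 := isLimit_om.emp_mem (M := M)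
  have hd : Dfn fun v : Fin 1 → M =>
      ∀ a, a ∈ₘ ap K (v 0) → ∀ b, b ∈ₘ ap K (v 0) → gr G l a b ∈ₘ ap K (v 0) := by
    have : ∀ k a b, gr G l a b ∈ₘ k ↔ ∃ c, c ∈ₘ k ∧ ∀ z, z ∈ₘ c ↔ z ∈ₘ l ∧ Tri G a b z :=
      fun k a b => ⟨fun h => ⟨_, h, fun z => mem_gr⟩, fun ⟨c, hc, h⟩ => by
        rwa [← show c = gr G l a b from ext fun z => (h z).trans mem_gr.symm]⟩
    simp only [this]
    infer_instance
  refine om_induction (fun i => ∀ a, a ∈ₘ ap K i → ∀ b, b ∈ₘ ap K i → gr G l a b ∈ₘ ap K i)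
    (fun a ha b hb => ?_) (fun i hi ih => ?_) hi
  · have hal := hkl h0 ha
    have hbl := hkl h0 hb
    have hor := hG.isOrd_gr h.ol a b hal hbl
    by_contra hno
    rw [hor.not_mem_iff h.ord_crit] at hno
    have hun : ∀ a b, a ∈ₘ ap K (emp M) → b ∈ₘ ap K (emp M) → un a b ∈ₘ ap K (emp M) :=
      fun a b ha hb => by
        rcases (h.ord_crit.mem ha).un_eq (h.ord_crit.mem hb) with e | e <;> rwa [e]
    have hex : ∃ a', a' ∈ₘ l ∧ ∃ b', b' ∈ₘ l ∧
        IsSubset (un a' b') (un a b) ∧ ap K (emp M) = gr G l a' b' := by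
      rcases h.ord_crit.subset_cases hor hno with e | e
      · exact ⟨a, hal, b, hbl, IsSubset.refl _, e⟩
      · exact hG.exists_eq h.ol _ a b hal hbl e
    obtain ⟨a', ha', b', hb', hsub, he⟩ := hex
    have hin : ∀ c, c ∈ₘ l → IsSubset c (un a' b') → c ∈ₘ ap K (emp M) := fun c hc hs => by
      have hm := hun a b ha hb
      rcases (h.ol.mem hc).subset_cases (h.ord_crit.mem hm) (hs.trans hsub) with rfl | e
      exacts [hm, h.ord_crit.trans e hm]
    have ha'k := hin a' ha' fun z hz => mem_un.2 (Or.inl hz)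
    have hb'k := hin b' hb' fun z hz => mem_un.2 (Or.inr hz)
    rw [hgr (hl1 _ (h.kap_mem_l h0))] at he
    have key := (h.pres_5 (fun k G l a b => ∀ z, z ∈ₘ l → (z ∈ₘ k ↔ Tri G a b z)) (h.K_mem _ h0)
      hGV h.lV (h.tr _ _ h.lV ha') (h.tr _ _ h.lV hb')).1 he
    rw [h.J_l, h.J_crit ha'k, h.J_crit hb'k] at key
    have hκ := h.kap_mem_l h0
    exact mem_irrefl _ ((he _ hκ).2 ((hJ a' b' ha' hb' _ hκ).1 ((key _ hκ).1 h.crit_mem)))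
  · have key := (h.pres_3 (fun k G l => ∀ a, a ∈ₘ k → ∀ b, b ∈ₘ k → ∃ c, c ∈ₘ k ∧ ∀ z, z ∈ₘ l →
      (z ∈ₘ c ↔ Tri G a b z)) (h.K_mem _ hi) hGV h.lV).1 fun a ha b hb =>
        ⟨_, ih a ha b hb, (hgr fun z hz => (mem_gr.1 hz).1).1 rfl⟩
    rw [h.J_l, h.step i hi] at key
    intro a ha b hb
    have hi' := isLimit_om.suc_mem hi
    obtain ⟨c, hc, hcz⟩ := key a ha b hb
    rw [← (hgr (hl1 c (hkl hi' hc))).2 fun z hz =>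
      (hcz z hz).trans (hJ a b (hkl hi' ha) (hkl hi' hb) z hz)]
    exact hc

/-- Ranks of pairs stay below `λ` because any two ordinals below `λ` lie below a common `κ_i`. They
separate pairs because the Gödel ordering is total and strictly increases the rank. -/
theorem exists_pairing : ∃ r, (∀ a b, a ∈ₘ l → b ∈ₘ l → ap r (pr a b) ∈ₘ l) ∧
    ∀ a b a' b', a ∈ₘ l → b ∈ₘ l → a' ∈ₘ l → b' ∈ₘ l →
      ap r (pr a b) = ap r (pr a' b') → a = a' ∧ b = b' := by
  obtain ⟨G, hGl, hG⟩ := exists_isGodelRank h.ol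
  have hml : ∀ a b, a ∈ₘ l → b ∈ₘ l → gr G l a b ∈ₘ l := fun a b ha hb => by
    obtain ⟨i, hi, hai⟩ := (h.mem_l _).1 ha
    obtain ⟨k, hk, hbk⟩ := (h.mem_l _).1 hb
    obtain ⟨i', hi', ha', hb'⟩ : ∃ i, i ∈ₘ om M ∧ a ∈ₘ ap K i ∧ b ∈ₘ ap K i := by
      rcases (h.kap_lp hi).2.trichotomy (h.kap_lp hk).2 with e | e | e
      · exact ⟨k, hk, (h.kap_lp hk).2.trans hai e, hbk⟩
      · exact ⟨i, hi, hai, e ▸ hbk⟩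
      · exact ⟨i, hi, hai, (h.kap_lp hi).2.trans hbk e⟩
    exact h.ol.trans (h.gr_mem_kap hGl hG hi' a ha' b hb') (h.kap_mem_l hi')
  let F : M → M := fun q => sep l fun z => ∃ a b, q = pr a b ∧ Tri G a b z
  have hF : ∀ a b, F (pr a b) = gr G l a b := fun a b => ext fun z => by
    rw [mem_gr, mem_sep]
    refine and_congr_right fun _ => ⟨?_, fun h => ⟨a, b, rfl, h⟩⟩
    rintro ⟨a', b', he, h⟩
    rw [pr_inj] at he
    rwa [he.1, he.2]
  obtain ⟨r, hr, hap⟩ := exists_fun (prod l l) l F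
    (Dfn.congr (Q := fun v : Fin 2 → M => ∀ z, z ∈ₘ v 1 ↔ z ∈ₘ l ∧ ∃ a b, v 0 = pr a b ∧ Tri G a b z)
      inferInstance fun v => ⟨fun h z => by rw [h]; exact mem_sep,
        fun h => ext fun z => (h z).trans (show z ∈ₘ F (v 0) ↔ _ from mem_sep).symm⟩)
    (fun q hq => by
      obtain ⟨a, b, ha, hb, rfl⟩ := mem_prod.1 hq
      rw [hF]
      exact hml a b ha hb)
  have hr' : ∀ a b, a ∈ₘ l → b ∈ₘ l → ap r (pr a b) = gr G l a b := fun a b ha hb => by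
    rw [hap _ (pr_mem_prod.2 ⟨ha, hb⟩), hF]
  refine ⟨r, fun a b ha hb => by rw [hr' a b ha hb]; exact hml a b ha hb,
    fun a b a' b' ha hb ha' hb' he => ?_⟩
  rw [hr' a b ha hb, hr' a' b' ha' hb'] at he
  have hlt : ∀ {a b a' b'}, a ∈ₘ l → b ∈ₘ l → a' ∈ₘ l → b' ∈ₘ l → GodelLt a b a' b' →
      gr G l a b ∈ₘ gr G l a' b' := fun {a b a' b'} ha hb ha' hb' hlt => by
    rw [hG.mem_gr_iff h.ol ha' hb']
    exact ⟨hml a b ha hb, a, ha, b, hb, hlt, Or.inr rfl⟩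
  rcases GodelLt.total (h.ol.mem ha) (h.ol.mem hb) (h.ol.mem ha') (h.ol.mem hb') with e | e | e
  · exact absurd (he ▸ hlt ha hb ha' hb' e) (mem_irrefl _)
  · exact e
  · exact absurd (he ▸ hlt ha' hb' ha hb e) (mem_irrefl _)

end RR
end Pairing
end RankToRank

namespace RankToRank

/-! ### Towers of ordinals below `λ⁺` with increasing surjections from `λ`. -/

section Towers

variable {M : Type*} [setLang.Structure M] [hZ : ZF M]

/-- `e ⊆ l × a` is the graph of a partial surjection from `l` onto `a`. -/
def Codes (l e a : M) : Prop :=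
  (∀ p, p ∈ₘ e → ∃ x, x ∈ₘ l ∧ ∃ b, b ∈ₘ a ∧ IsOPair x b p) ∧
  (∀ b, b ∈ₘ a → ∃ x, x ∈ₘ l ∧ App e x b) ∧
  ∀ x, x ∈ₘ l → ∀ b, b ∈ₘ a → ∀ c, c ∈ₘ a → App e x b → App e x c → b = c

instance {n : ℕ} {a b c : (Fin n → M) → M} [DefFun a] [DefFun b] [DefFun c] :
    Dfn fun v => Codes (a v) (b v) (c v) :=
  Dfn.comp_three (P := Codes) (by unfold Codes; infer_instance)

instance {n : ℕ} {a b c : (Fin n → M) → M} [IsVar a] [IsVar b] [IsVar c] :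
    D0 fun v => Codes (a v) (b v) (c v) :=
  D0.comp_three (P := Codes) (by unfold Codes; infer_instance)

theorem Codes.mem_of_app {l e a x b : M} (h : Codes l e a) (hx : App e x b) : x ∈ₘ l ∧ b ∈ₘ a := by
  obtain ⟨x', hx', b', hb', he⟩ := h.1 _ (app_iff.1 hx)
  rw [isOPair_iff, pr_inj] at he
  rw [he.1, he.2]
  exact ⟨hx', hb'⟩

theorem Codes.unique {l e a x b c : M} (h : Codes l e a) (hb : App e x b) (hc : App e x c) : b = c :=
  h.2.2 x (h.mem_of_app hb).1 b (h.mem_of_app hb).2 c (h.mem_of_app hc).2 hb hc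

/-- Each element is sent to its least code; no choice is involved since `l` is an ordinal. -/
theorem Codes.injects {l e a : M} (hl : IsOrd l) (h : Codes l e a) : Injects a l := by
  let Q : M → M → Prop := fun b x => x ∈ₘ l ∧ App e x b ∧ ∀ y, y ∈ₘ l → App e y b → ¬ y ∈ₘ x
  have hQd : Dfn fun v : Fin 2 → M => Q (v 0) (v 1) := by
    simp only [Q]
    infer_instance
  have hQ' := fun {n} {a b : (Fin n → M) → M} [DefFun a] [DefFun b] =>
    Dfn.comp_two hQd (a := a) (b := b)
  have hQ : ∀ b, b ∈ₘ a → ∃! x, Q b x := fun b hb => by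
    obtain ⟨x, hx, hxb, hmin⟩ := exists_min l (fun x => App e x b) (h.2.1 b hb)
    refine ⟨x, ⟨hx, hxb, hmin⟩, fun y hy => ?_⟩
    have h1 := hmin y hy.1 hy.2.1
    have h2 := hy.2.2 x hx hxb
    have := (hl.mem hx).trichotomy (hl.mem hy.1)
    tauto
  refine injects_of (fun b => the (Q b)) (Dfn.congr (Q := fun v : Fin 2 → M =>
    (Q (v 0) (v 1) ∧ ∃! z, Q (v 0) z) ∨ (¬ (∃! z, Q (v 0) z) ∧ v 1 = emp M)) inferInstance
    fun _ => eq_the_iff)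
    (fun b hb => (the_spec (hQ b hb)).1) fun b c hb hc hbc => ?_
  have h1 := (the_spec (hQ b hb)).2.1
  have h2 := (the_spec (hQ c hc)).2.1
  rw [← hbc] at h2
  exact h.unique h1 h2

/-- An increasing sequence of partial surjections `e ζ` from `l` onto ordinals
`a ζ = l ∪ ⋃_{η < ζ} (j (a η) + 1)`. -/
structure Tower (l lp j : M) (e a : M → M) : Prop where
  dfn_e : Dfn fun v : Fin 2 → M => v 1 = e (v 0)
  a_mem : ∀ ζ, ζ ∈ₘ l → a ζ ∈ₘ lp
  codes : ∀ ζ, ζ ∈ₘ l → Codes l (e ζ) (a ζ)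
  mem_a : ∀ ζ, ζ ∈ₘ l → ∀ b, b ∈ₘ a ζ ↔ b ∈ₘ l ∨ ∃ η, η ∈ₘ ζ ∧ b ∈ₘ suc (ap j (a η))
  mono : ∀ ζ, ζ ∈ₘ l → ∀ η, η ∈ₘ ζ → IsSubset (e η) (e ζ)

namespace RR

variable {l lp j K : M} (h : RR l lp j K)

include h

theorem codes_mem {e a : M} (ha : a ∈ₘ lp) (he : Codes l e a) : e ∈ₘ Vr lp := by
  refine subset_mem_Vr h.olp (prod_mem_Vr h.limit_lp h.lV (h.ordV ha)) fun p hp => ?_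
  obtain ⟨x, hx, b, hb, hp⟩ := he.1 p hp
  rw [isOPair_iff] at hp
  rw [hp, pr_mem_prod]
  exact ⟨hx, hb⟩

theorem J_codes {e a : M} (ha : a ∈ₘ lp) (he : Codes l e a) : Codes l (ap j e) (ap j a) := by
  have := (h.pres_3 (fun l e a => Codes l e a) h.lV (h.codes_mem ha he) (h.ordV ha)).1 he
  rwa [h.J_l] at this

/-- One recursion produces the `e ζ`, and `a ζ` is recovered as the range of `e ζ`. The clause for
`η < ζ` does not mention `ζ` otherwise, which makes the `e ζ` increasing. -/
theorem exists_tower : ∃ e a, Tower l lp j e a := by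
  obtain ⟨r, hr, hinj⟩ := h.exists_pairing
  let o1 : M := suc (emp M)
  -- Three kinds of codes: `(b, 0)` for `b < λ`, `(η, 1)` for the point `j(a η)`, and `(η, y + 2)`
  -- for the point of `j(a η)` with code `y` in `j(e η)`. The second coordinate tells them apart.
  -- Here `u` is the earlier value `e η`, as a set.
  let T : M → M → M → M → Prop := fun ζ G x b => (b ∈ₘ l ∧ x = ap r (pr b (emp M))) ∨
    ∃ η, η ∈ₘ ζ ∧ ∃ u, (∀ p, p ∈ₘ u ↔ App G η p) ∧
      (((∀ c, c ∈ₘ b ↔ ∃ y, App (ap j u) y c) ∧ x = ap r (pr η o1)) ∨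
        ∃ y, App (ap j u) y b ∧ x = ap r (pr η (suc (suc y))))
  have hP : Dfn fun v : Fin 3 → M => ∃ x b, v 2 = pr x b ∧ T (v 0) (v 1) x b := by
    simp only [T]
    infer_instance
  obtain ⟨G, hG⟩ := exists_recursion l (prod l lp) (fun b a => b ∈ₘ a)
    (fun ζ G q => ∃ x b, q = pr x b ∧ T ζ G x b) (fun X hX => h.ol.set_induction X hX)
    (fun ζ G G' hζ hGG' q => by
      refine exists_congr fun x => exists_congr fun b => and_congr_right fun _ => ?_
      refine or_congr Iff.rfl (exists_congr fun η => and_congr_right fun hη => ?_)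
      simp only [hGG' η (h.ol.trans hη hζ) hη])
  let e : M → M := fun ζ => sep (prod l lp) fun p => App G ζ p
  let a : M → M := fun ζ => sep lp fun b => ∃ x, App G ζ (pr x b)
  have he : ∀ ζ p, p ∈ₘ e ζ ↔ App G ζ p := fun ζ p =>
    mem_sep.trans (and_iff_right_of_imp fun hp => ((hG _ _).1 hp).2.1)
  have happ : ∀ ζ x b, App (e ζ) x b ↔ App G ζ (pr x b) := fun ζ x b => by rw [app_iff, he]
  have ha : ∀ ζ b, b ∈ₘ a ζ ↔ ∃ x, App (e ζ) x b := fun ζ b => by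
    simp only [happ]
    exact mem_sep.trans (and_iff_right_of_imp fun ⟨x, hx⟩ => by
      have := ((hG _ _).1 hx).2.1
      rw [pr_mem_prod] at this
      exact this.2)
  have hTe : ∀ ζ, ζ ∈ₘ l → ∀ x b, App (e ζ) x b ↔ x ∈ₘ l ∧ b ∈ₘ lp ∧
      ((b ∈ₘ l ∧ x = ap r (pr b (emp M))) ∨ ∃ η, η ∈ₘ ζ ∧
        (((∀ c, c ∈ₘ b ↔ ∃ y, App (ap j (e η)) y c) ∧ x = ap r (pr η o1)) ∨
          ∃ y, App (ap j (e η)) y b ∧ x = ap r (pr η (suc (suc y))))) := fun ζ hζ x b => by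
    have h1 : (∃ x' b', pr x b = pr x' b' ∧ T ζ G x' b') ↔ T ζ G x b := by
      simp only [pr_inj]
      exact ⟨fun ⟨_, _, ⟨h1, h2⟩, h⟩ => by rwa [h1, h2], fun h => ⟨_, _, ⟨rfl, rfl⟩, h⟩⟩
    rw [happ, hG, pr_mem_prod, h1, and_iff_right hζ, and_assoc]
    refine and_congr_right fun _ => and_congr_right fun _ => or_congr Iff.rfl
      (exists_congr fun η => and_congr_right fun _ => ⟨?_, fun h' => ⟨e η, he η, h'⟩⟩)
    rintro ⟨u, hu, h'⟩
    rwa [show u = e η from ext fun p => (hu p).trans (he η p).symm] at h'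
  have hde : Dfn fun v : Fin 2 → M => v 1 = e (v 0) :=
    Dfn.congr (Q := fun v : Fin 2 → M => ∀ p, p ∈ₘ v 1 ↔ App G (v 0) p) inferInstance fun v =>
      ⟨fun h p => by rw [h, he], fun h => ext fun p => (h p).trans (he _ p).symm⟩
  have hda : Dfn fun v : Fin 2 → M => v 1 = a (v 0) :=
    Dfn.congr (Q := fun v : Fin 2 → M => ∀ b, b ∈ₘ v 1 ↔ ∃ x, App G (v 0) (pr x b)) inferInstance
      fun v => ⟨fun h b => by simp only [h, ha, happ], fun h => ext fun b => (h b).trans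
        (by simp only [ha, happ])⟩
  have hde' := fun {n} {t : (Fin n → M) → M} [DefFun t] => DefFun.comp_one hde (a := t)
  have hda' := fun {n} {t : (Fin n → M) → M} [DefFun t] => DefFun.comp_one hda (a := t)
  have h0 : emp M ∈ₘ l := h.limit_l.emp_mem
  have h1 : o1 ∈ₘ l := h.limit_l.suc_mem h0
  have hss : ∀ {y}, y ∈ₘ l → suc (suc y) ∈ₘ l := fun hy =>
    h.limit_l.suc_mem (h.limit_l.suc_mem hy)
  -- the description of one stage, given the previous ones
  have step : ∀ ζ, ζ ∈ₘ l → (∀ η, η ∈ₘ ζ → a η ∈ₘ lp ∧ Codes l (e η) (a η)) →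
      (∀ b, b ∈ₘ a ζ ↔ b ∈ₘ l ∨ ∃ η, η ∈ₘ ζ ∧ b ∈ₘ suc (ap j (a η))) ∧
      a ζ ∈ₘ lp ∧ Codes l (e ζ) (a ζ) := fun ζ hζ ih => by
    have hηl : ∀ {η}, η ∈ₘ ζ → η ∈ₘ l := fun hη => h.ol.trans hη hζ
    have hJc : ∀ η, η ∈ₘ ζ → Codes l (ap j (e η)) (ap j (a η)) := fun η hη =>
      h.J_codes (ih η hη).1 (ih η hη).2
    have hJa : ∀ η, η ∈ₘ ζ → ∀ c, c ∈ₘ ap j (a η) ↔ ∃ y, App (ap j (e η)) y c := fun η hη c =>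
      ⟨fun hc => ((hJc η hη).2.1 c hc).imp fun _ hx => hx.2,
        fun ⟨y, hy⟩ => ((hJc η hη).mem_of_app hy).2⟩
    have hJb : ∀ η, η ∈ₘ ζ → ∀ b, (∀ c, c ∈ₘ b ↔ ∃ y, App (ap j (e η)) y c) ↔ b = ap j (a η) :=
      fun η hη b => ⟨fun hb => ext fun c => (hb c).trans (hJa η hη c).symm,
        fun hb c => by rw [hb, hJa η hη]⟩
    have happ : ∀ x b, App (e ζ) x b ↔ x ∈ₘ l ∧ b ∈ₘ lp ∧
      ((b ∈ₘ l ∧ x = ap r (pr b (emp M))) ∨ ∃ η, η ∈ₘ ζ ∧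
        ((b = ap j (a η) ∧ x = ap r (pr η o1)) ∨
          ∃ y, App (ap j (e η)) y b ∧ x = ap r (pr η (suc (suc y))))) := fun x b => by
      rw [hTe ζ hζ]
      refine and_congr_right fun _ => and_congr_right fun _ => or_congr Iff.rfl
        (exists_congr fun η => and_congr_right fun hη => ?_)
      rw [hJb η hη]
    have hmem : ∀ b, b ∈ₘ a ζ ↔ b ∈ₘ l ∨ ∃ η, η ∈ₘ ζ ∧ b ∈ₘ suc (ap j (a η)) := fun b => by
      rw [ha]
      constructor
      · rintro ⟨x, hx⟩
        obtain ⟨-, -, ⟨hb, -⟩ | ⟨η, hη, ⟨hb, -⟩ | ⟨y, hy, -⟩⟩⟩ := (happ _ _).1 hx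
        · exact Or.inl hb
        · exact Or.inr ⟨η, hη, hb ▸ self_mem_suc _⟩
        · exact Or.inr ⟨η, hη, mem_suc.2 (Or.inl ((hJc η hη).mem_of_app hy).2)⟩
      · rintro (hb | ⟨η, hη, hb⟩)
        · exact ⟨_, (happ _ _).2 ⟨hr _ _ hb h0, h.olp.trans hb h.l_mem, Or.inl ⟨hb, rfl⟩⟩⟩
        · have hJl := h.J_lp (ih η hη).1
          rcases mem_suc.1 hb with hb | hb
          · obtain ⟨y, hy, hyb⟩ := (hJc η hη).2.1 b hb
            exact ⟨_, (happ _ _).2 ⟨hr _ _ (hηl hη) (hss hy), h.olp.trans hb hJl,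
              Or.inr ⟨η, hη, Or.inr ⟨y, hyb, rfl⟩⟩⟩⟩
          · exact ⟨_, (happ _ _).2 ⟨hr _ _ (hηl hη) h1, hb ▸ hJl,
              Or.inr ⟨η, hη, Or.inl ⟨hb, rfl⟩⟩⟩⟩
    have hlp : IsSubset (a ζ) lp := fun b hb => (mem_sep.1 hb).1
    have hord : IsOrd (a ζ) := isOrd_of_forall (fun b hb c hc => by
      rw [hmem] at hb ⊢
      rcases hb with hb | ⟨η, hη, hb⟩
      · exact Or.inl (h.ol.trans hc hb)
      · exact Or.inr ⟨η, hη, (isOrd_suc (h.J_ordinal (ih η hη).1)).trans hc hb⟩)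
      fun b hb => h.olp.mem (hlp b hb)
    have hcodes : Codes l (e ζ) (a ζ) := by
      refine ⟨fun p hp => ?_, fun b hb => ?_, fun x hx b hb c hc hxb hxc => ?_⟩
      · obtain ⟨x, b, hx, -, rfl⟩ := mem_prod.1 ((hG _ _).1 ((he _ _).1 hp)).2.1
        exact ⟨x, hx, b, (ha _ _).2 ⟨x, app_iff.2 hp⟩, isOPair_iff.2 rfl⟩
      · obtain ⟨x, hx⟩ := (ha _ _).1 hb
        exact ⟨x, ((happ _ _).1 hx).1, hx⟩
      · have n1 : emp M ≠ o1 := fun e => suc_ne_emp _ e.symm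
        have n2 : ∀ y, emp M ≠ suc (suc y) := fun y e => suc_ne_emp _ e.symm
        have n3 : ∀ y : M, o1 ≠ suc (suc y) := fun y e => suc_ne_emp _ (suc_inj.1 e).symm
        have hyl : ∀ {η y b}, η ∈ₘ ζ → App (ap j (e η)) y b → suc (suc y) ∈ₘ l :=
          fun hη hy => hss ((hJc _ hη).mem_of_app hy).1
        obtain ⟨-, -, h2⟩ := (happ _ _).1 hxb
        obtain ⟨-, -, h3⟩ := (happ _ _).1 hxc
        rcases h2 with ⟨hbl, e2⟩ | ⟨η, hη, ⟨hb', e2⟩ | ⟨y, hy, e2⟩⟩ <;>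
          rcases h3 with ⟨hcl, e3⟩ | ⟨η', hη', ⟨hc', e3⟩ | ⟨y', hy', e3⟩⟩ <;> rw [e2] at e3
        · exact (hinj _ _ _ _ hbl h0 hcl h0 e3).1
        · exact absurd (hinj _ _ _ _ hbl h0 (hηl hη') h1 e3).2 n1
        · exact absurd (hinj _ _ _ _ hbl h0 (hηl hη') (hyl hη' hy') e3).2 (n2 _)
        · exact absurd (hinj _ _ _ _ (hηl hη) h1 hcl h0 e3).2.symm n1
        · rw [hb', hc', (hinj _ _ _ _ (hηl hη) h1 (hηl hη') h1 e3).1]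
        · exact absurd (hinj _ _ _ _ (hηl hη) h1 (hηl hη') (hyl hη' hy') e3).2 (n3 _)
        · exact absurd (hinj _ _ _ _ (hηl hη) (hyl hη hy) hcl h0 e3).2.symm (n2 _)
        · exact absurd (hinj _ _ _ _ (hηl hη) (hyl hη hy) (hηl hη') h1 e3).2.symm (n3 _)
        · obtain ⟨e4, e5⟩ := hinj _ _ _ _ (hηl hη) (hyl hη hy) (hηl hη') (hyl hη' hy') e3
          rw [suc_inj, suc_inj] at e5
          subst e4 e5
          exact (hJc η hη).unique hy hy'
    refine ⟨hmem, ?_, hcodes⟩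
    -- The range was cut off at `λ⁺`, so `a ζ ≤ λ⁺`. Equality would inject `λ⁺` into `λ`.
    rcases hord.subset_cases h.olp hlp with e | e
    · exact absurd (e ▸ hcodes.injects h.ol) h.not_injects
    · exact e
  have hall : ∀ ζ, ζ ∈ₘ l → a ζ ∈ₘ lp ∧ Codes l (e ζ) (a ζ) := fun ζ hζ =>
    (h.ol.mem hζ).induction (fun ζ => ζ ∈ₘ l → a ζ ∈ₘ lp ∧ Codes l (e ζ) (a ζ))
      (fun ζ _ ih hζ => (step ζ hζ fun η hη => ih η hη (h.ol.trans hη hζ)).2) hζ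
  refine ⟨e, a, hde, fun ζ hζ => (hall ζ hζ).1, fun ζ hζ => (hall ζ hζ).2, fun ζ hζ =>
    (step ζ hζ fun η hη => hall η (h.ol.trans hη hζ)).1, fun ζ hζ η hη p hp => ?_⟩
  have hηl := h.ol.trans hη hζ
  obtain ⟨x, -, b, -, hp'⟩ := (hall η hηl).2.1 p hp
  rw [isOPair_iff] at hp'
  subst hp'
  rw [← app_iff, hTe η hηl] at hp
  rw [← app_iff, hTe ζ hζ]
  refine ⟨hp.1, hp.2.1, hp.2.2.imp id ?_⟩
  rintro ⟨η', hη', h'⟩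
  exact ⟨η', (h.ol.mem hζ).trans hη' hη, h'⟩

end RR

namespace Tower

variable {l lp j K : M} {e a : M → M} (t : Tower l lp j e a) (h : RR l lp j K)

include t h

theorem ord_a {ζ : M} (hζ : ζ ∈ₘ l) : IsOrd (a ζ) := h.olp.mem (t.a_mem ζ hζ)

theorem J_a_mem {ζ η : M} (hζ : ζ ∈ₘ l) (hη : η ∈ₘ ζ) : ap j (a η) ∈ₘ a ζ :=
  (t.mem_a ζ hζ _).2 (Or.inr ⟨η, hη, self_mem_suc _⟩)

theorem a_mem_a {ζ η : M} (hζ : ζ ∈ₘ l) (hη : η ∈ₘ ζ) : a η ∈ₘ a ζ := by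
  have hη' := t.a_mem η (h.ol.trans hη hζ)
  have h1 := t.J_a_mem h hζ hη
  rcases (h.olp.mem hη').subset_cases (h.J_ordinal hη') (h.subset_J hη') with e | e
  exacts [e.symm ▸ h1, (t.ord_a h hζ).trans e h1]

/-- The limit stages of a tower. -/
theorem exists_mem {k b : M} (hk : IsLimit k) (hkl : k ∈ₘ l) (hb : b ∈ₘ a k) :
    ∃ ζ, ζ ∈ₘ k ∧ b ∈ₘ a ζ := by
  have hmem : ∀ {ζ}, ζ ∈ₘ k → ζ ∈ₘ l := fun hζ => h.ol.trans hζ hkl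
  rcases (t.mem_a k hkl b).1 hb with hb | ⟨η, hη, hb⟩
  · exact ⟨_, hk.emp_mem, (t.mem_a _ (hmem hk.emp_mem) b).2 (Or.inl hb)⟩
  · have hs := hk.suc_mem hη
    exact ⟨_, hs, (t.mem_a _ (hmem hs) b).2 (Or.inr ⟨η, self_mem_suc η, hb⟩)⟩

/-- From `b < a ζ` with `ζ < k` follows `j(b) < j(a ζ) < a k`. -/
theorem closed {k b : M} (hk : IsLimit k) (hkl : k ∈ₘ l) (hb : b ∈ₘ a k) : ap j b ∈ₘ a k := by
  obtain ⟨ζ, hζ, hb⟩ := t.exists_mem h hk hkl hb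
  have hζl := h.ol.trans hζ hkl
  have hζp := t.a_mem ζ hζl
  have h1 := (h.J_mem_J (h.ordV (h.olp.trans hb hζp)) (h.ordV hζp)).1 hb
  exact (t.ord_a h hkl).trans h1 (t.J_a_mem h hkl hζ)

theorem l_mem_a {k : M} (hk : IsLimit k) (hkl : k ∈ₘ l) : l ∈ₘ a k := by
  have h0 := hk.emp_mem
  have h0l := h.ol.trans h0 hkl
  have hsub : IsSubset l (a (emp M)) := fun b hb => (t.mem_a _ h0l b).2 (Or.inl hb)
  have h1 := t.a_mem_a h hkl h0
  rcases h.ol.subset_cases (t.ord_a h h0l) hsub with e | e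
  exacts [e.symm ▸ h1, (t.ord_a h hkl).trans e h1]

theorem limit_a {k : M} (hk : IsLimit k) (hkl : k ∈ₘ l) : IsLimit (a k) := by
  refine ⟨t.ord_a h hkl, ⟨l, t.l_mem_a h hk hkl⟩, fun b hb => ?_⟩
  obtain ⟨ζ, hζ, hb⟩ := t.exists_mem h hk hkl hb
  exact ⟨_, t.a_mem_a h hkl hζ, hb⟩

end Tower
end Towers
end RankToRank

namespace RankToRank

/-! ### The iterates of `j ↾ V_δ` and their discontinuities. -/

section Iterates

variable {M : Type*} [setLang.Structure M] [hZ : ZF M]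

theorem exists_iteration (S x₀ : M) (F : M → M) (hF : Dfn fun v : Fin 2 → M => v 1 = F (v 0))
    (h₀ : x₀ ∈ₘ S) (hS : ∀ x, x ∈ₘ S → F x ∈ₘ S) : ∃ f, IsFun f (om M) S ∧ ap f (emp M) = x₀ ∧
      ∀ i, i ∈ₘ om M → ap f (suc i) = F (ap f i) := by
  have hF' := fun {n} {t : (Fin n → M) → M} [DefFun t] => DefFun.comp_one hF (a := t)
  obtain ⟨G, hG⟩ := exists_recursion (om M) S (fun b a => b ∈ₘ a)
    (fun i G z => (i = emp M ∧ z = x₀) ∨ ∃ i', i = suc i' ∧ ∃ y, App G i' y ∧ z = F y)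
    (fun X hX => isLimit_om.1.set_induction X hX)
    (fun i G G' hi hGG' z => or_congr Iff.rfl (exists_congr fun i' => and_congr_right fun e => by
      have hi' : i' ∈ₘ i := e ▸ self_mem_suc i'
      simp only [hGG' i' (isLimit_om.1.trans hi' hi) hi']))
  have h0 : ∀ z, App G (emp M) z ↔ z = x₀ := fun z => by
    rw [hG, and_iff_right isLimit_om.emp_mem]
    constructor
    · rintro ⟨-, ⟨-, h⟩ | ⟨i', h, -⟩⟩
      exacts [h, absurd h.symm (suc_ne_emp _)]
    · rintro rfl
      exact ⟨h₀, Or.inl ⟨rfl, rfl⟩⟩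
  have hs : ∀ i, i ∈ₘ om M → ∀ z, App G (suc i) z ↔ ∃ y, App G i y ∧ z = F y := fun i hi z => by
    rw [hG, and_iff_right (isLimit_om.suc_mem hi)]
    constructor
    · rintro ⟨-, ⟨h, -⟩ | ⟨i', h, h'⟩⟩
      · exact absurd h (suc_ne_emp _)
      · rwa [suc_inj.1 h]
    · rintro ⟨y, hy, rfl⟩
      exact ⟨hS y ((hG _ _).1 hy).2.1, Or.inr ⟨i, rfl, y, hy, rfl⟩⟩
  have huniq : ∀ i, i ∈ₘ om M → ∃! z, App G i z := fun i hi => by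
    refine om_induction (fun i => ∃! z, App G i z) ⟨x₀, (h0 _).2 rfl, fun y hy => (h0 y).1 hy⟩
      (fun i hi ⟨y, hy, huy⟩ => ⟨F y, (hs i hi _).2 ⟨y, hy, rfl⟩, fun z hz => ?_⟩) hi
    obtain ⟨y', hy', rfl⟩ := (hs i hi z).1 hz
    rw [huy y' hy']
  have hap : ∀ i, i ∈ₘ om M → App G i (ap G i) := fun i hi => the_spec (huniq i hi)
  obtain ⟨f, hf, hfG⟩ := exists_fun (om M) S (fun i => ap G i) inferInstance fun i hi =>
    ((hG _ _).1 (hap i hi)).2.1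
  refine ⟨f, hf, ?_, fun i hi => ?_⟩
  · rw [hfG _ isLimit_om.emp_mem]
    exact (h0 _).1 (hap _ isLimit_om.emp_mem)
  · rw [hfG i hi, hfG _ (isLimit_om.suc_mem hi)]
    refine (huniq _ (isLimit_om.suc_mem hi)).unique (hap _ (isLimit_om.suc_mem hi)) ?_
    exact (hs i hi _).2 ⟨_, hap i hi, rfl⟩

theorem exists_isRestriction (j v : M) : ∃ k, IsRestriction j v k :=
  exists_sep j fun p => ∃ x y, x ∈ₘ v ∧ IsOPair x y p

theorem exists_suc_of_mem {i m : M} (hi : i ∈ₘ om M) (hm : m ∈ₘ i) :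
    ∃ i', i' ∈ₘ om M ∧ i = suc i' ∧ (m ∈ₘ i' ∨ m = i') := by
  rcases (isLimit_om.1.mem hi).cases with rfl | ⟨b, hb, rfl⟩ | hl
  · exact absurd hm not_mem_emp
  · exact ⟨b, isLimit_om.1.trans hb hi, rfl, mem_suc.1 hm⟩
  · exact absurd hl (isOmega_om.2 i hi)

/-- `X` is discontinuous at the `κ_i` with `i ≥ m`. -/
def Discont (d K m X : M) : Prop := ∀ i, i ∈ₘ om M → (m ∈ₘ i ∨ m = i) →
  ∃ η θ, θ ∈ₘ Vr d ∧ App X (ap K i) θ ∧ η ∈ₘ θ ∧ ∀ ξ, ξ ∈ₘ ap K i → ∀ y, App X ξ y → y ∈ₘ η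

namespace RR

variable {l lp j K : M} (h : RR l lp j K)

include h

theorem restriction_subset {d k : M} (hd : IsLimit d) (hdl : d ∈ₘ lp)
    (hcl : ∀ a, a ∈ₘ d → ap j a ∈ₘ d) (hk : IsRestriction j (Vr d) k) : IsSubset k (Vr d) := by
  intro p hp
  obtain ⟨-, x, y, hx, hp'⟩ := (hk p).1 hp
  rw [isOPair_iff] at hp'
  subst hp'
  rw [← app_iff, h.restriction_iff hdl hk] at hp
  rw [← hp.2]
  exact pr_mem_Vr hd hx (h.J_mem_Vr hd hdl hcl hx)

theorem isCanonicalExt_iff {d k X Y : M} (hd : IsLimit d) (hdl : d ∈ₘ lp)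
    (hk : IsRestriction j (Vr d) k) : IsCanonicalExt d k X Y ↔ ∀ z, z ∈ₘ Y ↔
      ∃ a, a ∈ₘ d ∧ ∃ u, (∀ x, x ∈ₘ u ↔ x ∈ₘ X ∧ x ∈ₘ Vr a) ∧ z ∈ₘ ap j u := by
  refine forall_congr' fun z => iff_congr Iff.rfl ?_
  constructor
  · rintro ⟨a, v, u, y, ha, hv, hu, hy, hz⟩
    obtain ⟨-, rfl⟩ := isRank_iff_eq.1 hv
    obtain ⟨-, rfl⟩ := (h.restriction_iff hdl hk).1 hy
    exact ⟨a, ha, u, hu, hz⟩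
  · rintro ⟨a, ha, u, hu, hz⟩
    refine ⟨a, _, u, _, ha, isRank_Vr (hd.1.mem ha), hu, (h.restriction_iff hdl hk).2 ⟨?_, rfl⟩, hz⟩
    exact subset_mem_Vr hd.1 (Vr_mem_Vr hd.1 ha) fun x hx => ((hu x).1 hx).2

theorem exists_iterates {d k : M} (hd : IsLimit d) (hdl : d ∈ₘ lp)
    (hcl : ∀ a, a ∈ₘ d → ap j a ∈ₘ d) (hk : IsRestriction j (Vr d) k) :
    ∃ f, IsIterateSeq d k f ∧ IsFun f (om M) (pow (Vr d)) ∧ ap f (emp M) = k ∧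
      ∀ i, i ∈ₘ om M → IsCanonicalExt d k (ap f i) (ap f (suc i)) := by
  let F : M → M := fun X => sep (Vr d) fun z =>
    ∃ a, a ∈ₘ d ∧ ∃ u, (∀ x, x ∈ₘ u ↔ x ∈ₘ X ∧ x ∈ₘ Vr a) ∧ z ∈ₘ ap j u
  have hF : ∀ X z, z ∈ₘ F X ↔
      ∃ a, a ∈ₘ d ∧ ∃ u, (∀ x, x ∈ₘ u ↔ x ∈ₘ X ∧ x ∈ₘ Vr a) ∧ z ∈ₘ ap j u := fun X z => by
    refine mem_sep.trans (and_iff_right_of_imp ?_)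
    rintro ⟨a, ha, u, hu, hz⟩
    exact Vr_trans hd.1 (h.J_mem_Vr hd hdl hcl (subset_mem_Vr hd.1 (Vr_mem_Vr hd.1 ha)
      fun x hx => ((hu x).1 hx).2)) hz
  obtain ⟨f, hf, hf0, hfs⟩ := exists_iteration (pow (Vr d)) k F
    (Dfn.congr (Q := fun v : Fin 2 → M => ∀ z, z ∈ₘ v 1 ↔
      ∃ a, a ∈ₘ d ∧ ∃ u, (∀ x, x ∈ₘ u ↔ x ∈ₘ v 0 ∧ x ∈ₘ Vr a) ∧ z ∈ₘ ap j u) inferInstance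
      fun v => ⟨fun h z => by rw [h, hF], fun h => ext fun z => (h z).trans (hF _ z).symm⟩)
    (mem_pow.2 (h.restriction_subset hd hdl hcl hk))
    (fun X _ => mem_pow.2 fun z hz => (mem_sep.1 hz).1)
  have hcan : ∀ i, i ∈ₘ om M → IsCanonicalExt d k (ap f i) (ap f (suc i)) := fun i hi => by
    rw [h.isCanonicalExt_iff hd hdl hk, hfs i hi]
    exact hF _
  refine ⟨f, ⟨om M, isOmega_om, hf.1, ⟨emp M, isEmp_iff.2 rfl, ?_⟩, fun i i' x y hi hi' hx hy => ?_⟩,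
    hf, hf0, hcan⟩
  · exact (hf.1.app_iff isLimit_om.emp_mem).2 hf0
  · rw [isSucc_iff] at hi'
    subst hi'
    rw [hf.1.app_iff hi] at hx
    rw [hf.1.app_iff (isLimit_om.suc_mem hi)] at hy
    rw [← hx, ← hy]
    exact hcan i hi

/-- The value at `κ_i` is `κ_{i+1}`, and `RR.exists_bound_J` bounds the earlier values strictly
below it. -/
theorem discont_restriction {d k : M} (hd : IsLimit d) (hdl : d ∈ₘ lp) (hld : l ∈ₘ d)
    (hk : IsRestriction j (Vr d) k) : Discont d K (emp M) k := by
  intro i hi _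
  have hV : ∀ {i}, i ∈ₘ om M → ap K i ∈ₘ Vr d := fun hi =>
    ord_mem_Vr hd.1 (hd.1.trans (h.kap_mem_l hi) hld)
  obtain ⟨b, hb, hbJ⟩ := h.exists_bound_J hi
  have hi' := isLimit_om.suc_mem hi
  refine ⟨b, _, hV hi', (h.restriction_iff hdl hk).2 ⟨hV hi, h.step i hi⟩, hb, fun ξ hξ y hy => ?_⟩
  rw [h.restriction_iff hdl hk] at hy
  exact hy.2 ▸ hbJ ξ hξ

/-- Apply `j` to the bounded pieces `X ∩ V_a`. If `X` sends `κ_i` to `θ` and all smaller ordinals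
below `η < θ`, then `Y` sends `κ_{i+1} = j(κ_i)` to `j(θ)` and all smaller ordinals below `j(η) <
j(θ)`. Each extension thus shifts the index by one, so an iterate `k_m` is controlled only from
`κ_m` on. -/
theorem discont_canonicalExt {d k m X Y : M} (hd : IsLimit d) (hdl : d ∈ₘ lp) (hld : l ∈ₘ d)
    (hcl : ∀ a, a ∈ₘ d → ap j a ∈ₘ d) (hk : IsRestriction j (Vr d) k)
    (hXY : IsCanonicalExt d k X Y) (hX : Discont d K m X) : Discont d K (suc m) Y := by
  rw [h.isCanonicalExt_iff hd hdl hk] at hXY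
  intro i hi hmi
  have hmi' : m ∈ₘ i := by
    rcases hmi with hmi | rfl
    exacts [(isLimit_om.1.mem hi).trans (self_mem_suc m) hmi, self_mem_suc m]
  obtain ⟨i', hi', rfl, hm⟩ := exists_suc_of_mem hi hmi'
  obtain ⟨η, θ, hθ, hXθ, hηθ, hη⟩ := hX i' hi' hm
  have hVlp : ∀ {x}, x ∈ₘ Vr d → x ∈ₘ Vr lp := fun hx =>
    Vr_mono hd.1 h.olp (h.olp.1 _ hdl) _ hx
  have hκ : ap K i' ∈ₘ Vr d := ord_mem_Vr hd.1 (hd.1.trans (h.kap_mem_l hi') hld)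
  have hpart : ∀ a, ∃ u, ∀ x, x ∈ₘ u ↔ x ∈ₘ X ∧ x ∈ₘ Vr a := fun a => exists_sep X _
  have hpartV : ∀ {a u}, a ∈ₘ d → (∀ x, x ∈ₘ u ↔ x ∈ₘ X ∧ x ∈ₘ Vr a) → u ∈ₘ Vr lp := fun ha hu =>
    hVlp (subset_mem_Vr hd.1 (Vr_mem_Vr hd.1 ha) fun x hx => ((hu x).1 hx).2)
  refine ⟨ap j η, ap j θ, h.J_mem_Vr hd hdl hcl hθ, ?_,
    (h.J_mem_J (hVlp (Vr_trans hd.1 hθ hηθ)) (hVlp hθ)).1 hηθ, fun ξ hξ y hy => ?_⟩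
  · obtain ⟨a, ha, hpa⟩ := (mem_Vr_limit hd).1 (pr_mem_Vr hd hκ hθ)
    obtain ⟨u, hu⟩ := hpart a
    rw [app_iff, hXY]
    refine ⟨a, ha, u, hu, ?_⟩
    rw [← h.step i' hi', ← app_iff, ← h.J_app (hpartV ha hu) (hVlp hκ) (hVlp hθ), app_iff, hu]
    exact ⟨app_iff.1 hXθ, hpa⟩
  · rw [app_iff, hXY] at hy
    obtain ⟨a, ha, u, hu, hy⟩ := hy
    have haV := Vr_mem_Vr hd.1 ha
    have huV := hpartV ha hu
    -- The extra bound `y ∈ V_a` makes the statement bounded. It costs nothing, because the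
    -- coordinates of a pair in `V_a`, or in `j(V_a) = V_{j(a)}`, lie there too.
    have key := (h.pres_4 (fun k V u η => ∀ ξ, ξ ∈ₘ k → ∀ y, y ∈ₘ V → App u ξ y → y ∈ₘ η)
      (hVlp hκ) (hVlp haV) huV (hVlp (Vr_trans hd.1 hθ hηθ))).1
      (fun ξ hξ y _ hy => hη ξ hξ y (app_iff.2 ((hu _).1 (app_iff.1 hy)).1))
    rw [h.step i' hi'] at key
    refine key ξ hξ y ?_ (app_iff.2 hy)
    have halp := h.olp.trans ha hdl
    have hsub := (h.pres_2 (fun u V => IsSubset u V) huV (hVlp haV)).1 fun x hx => ((hu x).1 hx).2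
    have := hsub _ hy
    rw [h.J_Vr halp] at this ⊢
    exact (of_pr_mem_Vr (h.J_ordinal halp) this).2

end RR

/-! ### Failure of `Σ₂`-elementarity -/

section sigma2

variable {d k : M} (hk : IsSigma2Elementary (Vr d) k) (hd : IsLimit d)

include hk hd

theorem IsSigma2Elementary.d0 {n : ℕ} (w : Fin n → M) (hw : ∀ i, w i ∈ₘ Vr d)
    (Q : (Fin n → M) → Prop) [D0 Q] : Q w ↔ Q fun i => ap k (w i) :=
  PreservesOn.d0 (fun _ => isSigma2_neg_code) hk (fun _ _ hx hy => Vr_trans hd.1 hx hy)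
    (ord_mem_Vr hd.1 hd.emp_mem) w hw Q

theorem IsSigma2Elementary.pres_1 (Q : M → Prop) [D0 fun v : Fin 1 → M => Q (v 0)] {x : M}
    (hx : x ∈ₘ Vr d) : Q x ↔ Q (ap k x) :=
  hk.d0 hd ![x] (by simp [hx]) fun v => Q (v 0)

theorem IsSigma2Elementary.pres_2 (Q : M → M → Prop) [D0 fun v : Fin 2 → M => Q (v 0) (v 1)]
    {x y : M} (hx : x ∈ₘ Vr d) (hy : y ∈ₘ Vr d) : Q x y ↔ Q (ap k x) (ap k y) :=
  hk.d0 hd ![x, y] (by simp [Fin.forall_fin_succ, hx, hy]) fun v => Q (v 0) (v 1)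

theorem IsSigma2Elementary.pres_3 (Q : M → M → M → Prop)
    [D0 fun v : Fin 3 → M => Q (v 0) (v 1) (v 2)] {x y z : M}
    (hx : x ∈ₘ Vr d) (hy : y ∈ₘ Vr d) (hz : z ∈ₘ Vr d) :
    Q x y z ↔ Q (ap k x) (ap k y) (ap k z) :=
  hk.d0 hd ![x, y, z] (by simp [Fin.forall_fin_succ, hx, hy, hz]) fun v => Q (v 0) (v 1) (v 2)

theorem IsSigma2Elementary.pres_5 (Q : M → M → M → M → M → Prop)
    [D0 fun v : Fin 5 → M => Q (v 0) (v 1) (v 2) (v 3) (v 4)] {x y z u t : M}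
    (hx : x ∈ₘ Vr d) (hy : y ∈ₘ Vr d) (hz : z ∈ₘ Vr d) (hu : u ∈ₘ Vr d) (ht : t ∈ₘ Vr d) :
    Q x y z u t ↔ Q (ap k x) (ap k y) (ap k z) (ap k u) (ap k t) :=
  hk.d0 hd ![x, y, z, u, t] (by simp [Fin.forall_fin_succ, hx, hy, hz, hu, ht])
    fun v => Q (v 0) (v 1) (v 2) (v 3) (v 4)

theorem IsSigma2Elementary.subset_ap {x : M} (hx : x ∈ₘ d) : IsSubset x (ap k x) := by
  have hV : ∀ {x}, x ∈ₘ d → x ∈ₘ Vr d := fun hx => ord_mem_Vr hd.1 hx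
  have hord : ∀ {x}, x ∈ₘ d → IsOrd (ap k x) := fun hx =>
    (hk.pres_1 hd (fun x => IsOrd x) (hV hx)).1 (hd.1.mem hx)
  have hmem : ∀ {x}, x ∈ₘ d → ap k x ∈ₘ d := fun hx =>
    mem_of_mem_Vr hd.1 (hord hx) (hk.1.ap_mem (hV hx))
  rw [← (hord hx).not_mem_iff (hd.1.mem hx)]
  refine (hd.1.mem hx).induction (fun x => x ∈ₘ d → ¬ ap k x ∈ₘ x) (fun x hxo ih hx hJ => ?_) hx
  exact ih _ hJ (hmem hx) ((hk.pres_2 hd (fun x y => x ∈ₘ y) (hV (hmem hx)) (hV hx)).1 hJ)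

end sigma2

/-- `g` maps the relation `{(x, y) : (ξ, (x, y)) ∈ p}` on `l` homomorphically into the
ordinal `b`. -/
def IsRanking (ξ p l g b : M) : Prop := IsOrd b ∧
  (∀ x, x ∈ₘ l → ∀ u, u ∈ₘ b → ∀ v, v ∈ₘ b → App g x u → App g x v → u = v) ∧
  ∀ x, x ∈ₘ l → ∀ y, y ∈ₘ l → Tri p ξ x y →
    ∃ u, u ∈ₘ b ∧ ∃ v, v ∈ₘ b ∧ App g x u ∧ App g y v ∧ u ∈ₘ v

instance {n : ℕ} {a b c d e : (Fin n → M) → M} [ha : IsVar a] [hb : IsVar b] [hc : IsVar c]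
    [hd : IsVar d] [he : IsVar e] : D0 fun v => IsRanking (a v) (b v) (c v) (d v) (e v) := by
  have : D0 fun v : Fin 5 → M => IsRanking (v 0) (v 1) (v 2) (v 3) (v 4) := by
    unfold IsRanking
    infer_instance
  obtain ⟨i, rfl⟩ := ha.out
  obtain ⟨i', rfl⟩ := hb.out
  obtain ⟨i₂, rfl⟩ := hc.out
  obtain ⟨i₃, rfl⟩ := hd.out
  obtain ⟨i₄, rfl⟩ := he.out
  exact this.reindex ![i, i', i₂, i₃, i₄]

/-- If `κ` is a limit below `l`, no map on `V_{a κ}` which is discontinuous at `κ` is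
`Σ₂`-elementary. -/
theorem Tower.not_sigma2 {l lp j K : M} {e a : M → M} (t : Tower l lp j e a) (h : RR l lp j K)
    {κ k η : M} (hκ : IsLimit κ) (hκl : κ ∈ₘ l) (hη : η ∈ₘ ap k κ)
    (hηk : ∀ ξ, ξ ∈ₘ κ → ap k ξ ∈ₘ η) : ¬ IsSigma2Elementary (Vr (a κ)) k := by
  intro hk
  have hd := t.limit_a h hκ hκl
  have hld := t.l_mem_a h hκ hκl
  have hV : ∀ {x}, x ∈ₘ a κ → x ∈ₘ Vr (a κ) := fun hx => ord_mem_Vr hd.1 hx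
  have hξl : ∀ {ξ}, ξ ∈ₘ κ → ξ ∈ₘ l := fun hξ => h.ol.trans hξ hκl
  have hξV : ∀ {ξ}, ξ ∈ₘ κ → ξ ∈ₘ Vr (a κ) := fun hξ => hV (hd.1.trans (hξl hξ) hld)
  have hκV := hV (hd.1.trans hκl hld)
  have hlV := hV hld
  have haV : ∀ {ξ}, ξ ∈ₘ κ → a ξ ∈ₘ Vr (a κ) := fun hξ => hV (t.a_mem_a h hκl hξ)
  have hord : ∀ {ξ}, ξ ∈ₘ κ → IsOrd (a ξ) := fun hξ => t.ord_a h (hξl hξ)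
  have hc : ∀ {ξ}, ξ ∈ₘ κ → Codes l (e ξ) (a ξ) := fun hξ => t.codes _ (hξl hξ)
  have heV : ∀ {ξ}, ξ ∈ₘ κ → e ξ ∈ₘ Vr (a κ) := fun hξ => by
    refine subset_mem_Vr hd.1 (prod_mem_Vr hd hlV (haV hξ)) fun q hq => ?_
    obtain ⟨x, hx, b, hb, hq⟩ := (hc hξ).1 q hq
    rw [isOPair_iff.1 hq, pr_mem_prod]
    exact ⟨hx, hb⟩
  have he' := fun {n} {s : (Fin n → M) → M} [DefFun s] => DefFun.comp_one t.dfn_e (a := s)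
  -- the parameter
  obtain ⟨p, hp⟩ := exists_sep (prod κ (prod l l)) fun q => ∃ ξ x y, q = pr ξ (pr x y) ∧
    ∃ β γ, β ∈ₘ γ ∧ App (e ξ) x β ∧ App (e ξ) y γ
  have hpV : p ∈ₘ Vr (a κ) :=
    subset_mem_Vr hd.1 (prod_mem_Vr hd hκV (prod_mem_Vr hd hlV hlV)) fun q hq => ((hp q).1 hq).1
  have htri : ∀ ξ x y, Tri p ξ x y ↔ ξ ∈ₘ κ ∧ ∃ β γ, β ∈ₘ γ ∧ App (e ξ) x β ∧ App (e ξ) y γ :=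
    fun ξ x y => by
      rw [tri_iff, hp, pr_mem_prod, pr_mem_prod]
      constructor
      · rintro ⟨h1, ξ', x', y', he, h2⟩
        rw [pr_inj, pr_inj] at he
        obtain ⟨rfl, rfl, rfl⟩ := he
        exact ⟨h1.1, h2⟩
      · rintro ⟨hξ, β, γ, h1, h2, h3⟩
        exact ⟨⟨hξ, ((hc hξ).mem_of_app h2).1, ((hc hξ).mem_of_app h3).1⟩, ξ, x, y, rfl, β, γ, h1, h2, h3⟩
  -- in `V_{a κ}`, all sections of `p` have rankings
  have hrank : ∀ ξ, ξ ∈ₘ κ → IsRanking ξ p l (e ξ) (a ξ) := fun ξ hξ => by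
    refine ⟨hord hξ, fun x _ u _ v _ hu hv => (hc hξ).unique hu hv, fun x _ y _ hxy => ?_⟩
    obtain ⟨-, β, γ, hβγ, hx, hy⟩ := (htri _ _ _).1 hxy
    exact ⟨β, ((hc hξ).mem_of_app hx).2, γ, ((hc hξ).mem_of_app hy).2, hx, hy, hβγ⟩
  -- This is the only use of `Σ₂`-elementarity beyond bounded formulas. The leading quantifier runs
  -- over all of `V_{a κ}`, so the condition `ξ < κ` moves into the matrix. For other `ξ` the matrix
  -- is vacuous and `l` serves as a dummy witness.
  have hs2 : ¬ ∃ ξ, ξ ∈ₘ Vr (a κ) ∧ ¬ ∃ g, g ∈ₘ Vr (a κ) ∧ ∃ b, b ∈ₘ Vr (a κ) ∧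
      (ξ ∈ₘ ap k κ → IsRanking ξ (ap k p) (ap k l) g b) := by
    refine mt (PreservesOn.sigma2 hk (fun x y hx hy => Vr_trans hd.1 hx hy) hlV ![κ, p, l]
      (by simp [Fin.forall_fin_succ, hκV, hpV, hlV])
      fun w ξ g b => ξ ∈ₘ w 0 → IsRanking ξ (w 1) (w 2) g b).2 ?_
    rintro ⟨ξ, hξ, hno⟩
    by_cases hξκ : ξ ∈ₘ κ
    · exact hno ⟨e ξ, heV hξκ, a ξ, haV hξκ, fun _ => hrank ξ hξκ⟩
    · exact hno ⟨l, hlV, l, hlV, fun hξ' => absurd hξ' hξκ⟩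
  have hηV : η ∈ₘ Vr (a κ) := Vr_trans hd.1 (hk.1.ap_mem hκV) hη
  obtain ⟨g, -, b, hbV, hgb⟩ : ∃ g, g ∈ₘ Vr (a κ) ∧ ∃ b, b ∈ₘ Vr (a κ) ∧
      (η ∈ₘ ap k κ → IsRanking η (ap k p) (ap k l) g b) := by
    by_contra hno
    exact hs2 ⟨η, hηV, hno⟩
  obtain ⟨hb, hg, hgp⟩ := hgb hη
  -- The sections of `p` increase because the `e ξ` do. Hence section `η` of `k(p)` contains section
  -- `k(ξ)` for every `ξ < κ`, and its ranking ranks them all.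
  have hmono := (hk.pres_3 hd (fun κ p l => ∀ ξ', ξ' ∈ₘ κ → ∀ ξ, ξ ∈ₘ ξ' → ∀ x, x ∈ₘ l →
    ∀ y, y ∈ₘ l → Tri p ξ x y → Tri p ξ' x y) hκV hpV hlV).1 (fun ξ' hξ' ξ hξ x _ y _ hxy => by
      rw [htri] at hxy ⊢
      obtain ⟨-, β, γ, h1, h2, h3⟩ := hxy
      have hsub := t.mono ξ' (hξl hξ') ξ hξ
      exact ⟨hξ', β, γ, h1, app_iff.2 (hsub _ (app_iff.1 h2)), app_iff.2 (hsub _ (app_iff.1 h3))⟩)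
  -- the union of `k (a ξ)` is contained in `b`
  have hsub : ∀ ξ, ξ ∈ₘ κ → ∀ γ', γ' ∈ₘ ap k (a ξ) → ∀ γ, γ ∈ₘ γ' → γ ∈ₘ b := fun ξ hξ => by
    have hkc := (hk.pres_3 hd (fun l e a => Codes l e a) hlV (heV hξ) (haV hξ)).1 (hc hξ)
    have hko := (hk.pres_1 hd (fun x => IsOrd x) (haV hξ)).1 (hord hξ)
    have hdown := (hk.pres_5 hd (fun l a e p ξ => ∀ y, y ∈ₘ l → ∀ γ, γ ∈ₘ a → App e y γ →
      ∀ β, β ∈ₘ γ → ∃ x, x ∈ₘ l ∧ App e x β ∧ Tri p ξ x y) hlV (haV hξ) (heV hξ) hpV (hξV hξ)).1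
      (fun y _ γ hγ hy β hβ => by
        obtain ⟨x, hx, hxβ⟩ := (hc hξ).2.1 β ((hord hξ).trans hβ hγ)
        exact ⟨x, hx, hxβ, (htri _ _ _).2 ⟨hξ, β, γ, hβ, hxβ, hy⟩⟩)
    have hpη : ∀ x, x ∈ₘ ap k l → ∀ y, y ∈ₘ ap k l → Tri (ap k p) (ap k ξ) x y →
        ∃ u, u ∈ₘ b ∧ ∃ v, v ∈ₘ b ∧ App g x u ∧ App g y v ∧ u ∈ₘ v := fun x hx y hy hxy =>
      hgp x hx y hy (hmono η hη _ (hηk ξ hξ) x hx y hy hxy)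
    -- A ranking sends each code of `γ` to an ordinal at least `γ`, by induction on `γ`: by `hdown`
    -- every `β < γ` has a code related to the given code of `γ`.
    have hle : ∀ γ, γ ∈ₘ ap k (a ξ) → ∀ y, y ∈ₘ ap k l → App (ap k (e ξ)) y γ →
        ∀ v, v ∈ₘ b → App g y v → IsSubset γ v := fun γ hγ => by
      refine (hko.mem hγ).induction (fun γ => γ ∈ₘ ap k (a ξ) → ∀ y, y ∈ₘ ap k l →
        App (ap k (e ξ)) y γ → ∀ v, v ∈ₘ b → App g y v → IsSubset γ v) ?_ hγ
      intro γ hγo ih hγ y hy hyγ v hv hyv β hβ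
      obtain ⟨x, hx, hxβ, hxy⟩ := hdown y hy γ hγ hyγ β hβ
      obtain ⟨u, hu, v', hv', hxu, hyv', huv⟩ := hpη x hx y hy hxy
      rw [hg y hy v' hv' v hv hyv' hyv] at huv
      rcases (hγo.mem hβ).subset_cases (hb.mem hu)
        (ih β hβ (hko.trans hβ hγ) x hx hxβ u hu hxu) with rfl | hβu
      exacts [huv, (hb.mem hv).trans hβu huv]
    intro γ' hγ' γ hγ
    -- The ranking is known to be defined only on the field of the relation. The larger `γ'`
    -- guarantees that a code of `γ` occurs there.
    obtain ⟨y, hy, hyγ'⟩ := hkc.2.1 γ' hγ'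
    obtain ⟨x, hx, hxγ, hxy⟩ := hdown y hy γ' hγ' hyγ' γ hγ
    obtain ⟨u, hu, -, -, hxu, -, -⟩ := hpη x hx y hy hxy
    have hγk := hko.trans hγ hγ'
    rcases (hko.mem hγk).subset_cases (hb.mem hu) (hle γ hγk x hx hxγ u hu hxu) with rfl | hγu
    exacts [hu, hb.trans hγu hu]
  have hbd : b ∈ₘ a κ := mem_of_mem_Vr hd.1 hb hbV
  obtain ⟨ξ, hξ, hbξ⟩ := t.exists_mem h hκ hκl hbd
  have hξ' := hκ.suc_mem hξ
  -- The extra level `a (ξ + 1)` supplies the larger ordinal that `hsub` asks for: `b ∈ a ξ ⊆ k(a ξ)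
  -- ∈ k(a (ξ + 1))`, and so `b ∈ b`.
  have haa := (hk.pres_2 hd (fun x y => x ∈ₘ y) (haV hξ) (haV hξ')).1
    (t.a_mem_a h (hξl hξ') (self_mem_suc ξ))
  exact mem_irrefl b (hsub _ hξ' _ haa b (hk.subset_ap hd (t.a_mem_a h hκl hξ) b hbξ))

/-- The witness is `d = a κ_n`. Every `k_m` with `m ≤ n` is discontinuous at `κ_n`, so
`Tower.not_sigma2` applies to all of them at this one ordinal. -/
theorem exists_not_sigma2_iterates {l lp j K : M} (h : RR l lp j K) {n : M} (hn : n ∈ₘ om M) :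
    ∃ d, IsLimit d ∧ d ∈ₘ lp ∧ ClosedUnder j d ∧
      ∃ k f, IsRestriction j (Vr d) k ∧ IsSigma1Elementary (Vr d) k ∧ IsIterateSeq d k f ∧
        ∀ m km, (m ∈ₘ n ∨ m = n) → App f m km → ¬ IsSigma2Elementary (Vr d) km := by
  obtain ⟨e, a, t⟩ := h.exists_tower
  have hκ := h.limit_kap hn
  have hκl := h.kap_mem_l hn
  have hd := t.limit_a h hκ hκl
  have hdl := t.a_mem _ hκl
  have hld := t.l_mem_a h hκ hκl
  have hcl : ∀ b, b ∈ₘ a (ap K n) → ap j b ∈ₘ a (ap K n) := fun b hb => t.closed h hκ hκl hb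
  obtain ⟨k, hk⟩ := exists_isRestriction j (Vr (a (ap K n)))
  obtain ⟨f, hf, hfun, hf0, hfs⟩ := h.exists_iterates hd hdl hcl hk
  refine ⟨a (ap K n), hd, hdl, fun x y hx hxy => ?_, k, f, hk, h.sigma1_restriction hd hdl hcl hk, hf,
    fun m km hm hkm hs2 => ?_⟩
  · rw [h.app_j (h.ordV (h.olp.trans hx hdl))] at hxy
    exact hxy ▸ hcl x hx
  · have hmo : m ∈ₘ om M := hfun.1.mem_of_app hkm
    rw [hfun.1.app_iff hmo] at hkm
    -- The induction on `m` runs inside the model, as `n` and `m` may be nonstandard. This is why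
    -- the definability of `Discont` is needed.
    have hdis : Discont (a (ap K n)) K m (ap f m) := by
      have hdfn : Dfn fun v : Fin 1 → M => Discont (a (ap K n)) K (v 0) (ap f (v 0)) := by
        unfold Discont
        infer_instance
      refine om_induction (fun m => Discont (a (ap K n)) K m (ap f m)) ?_ (fun m hm ih => ?_) hmo
      · rw [hf0]
        exact h.discont_restriction hd hdl hld hk
      · exact h.discont_canonicalExt hd hdl hld hcl hk (hfs m hm) ih
    rw [hkm] at hdis
    obtain ⟨η, θ, hθ, hκθ, hηθ, hη⟩ := hdis n hn hm
    have hV : ∀ {x}, x ∈ₘ l → x ∈ₘ Vr (a (ap K n)) := fun hx =>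
      ord_mem_Vr hd.1 (hd.1.trans hx hld)
    rw [hs2.1.1.app_iff (hV hκl)] at hκθ
    refine t.not_sigma2 h hκ hκl (k := km) (η := η) (hκθ ▸ hηθ) (fun ξ hξ => hη ξ hξ _ ?_) hs2
    exact app_ap hs2.1.1 (hV (h.ol.trans hξ hκl))

end Iterates
end RankToRank

theorem theorem5p9 {M : Type*} [setLang.Structure M] (hM : IsModelZF M)
    (l lp v j : M) (hlp : IsSuccCard l lp) (hv : IsRank lp v)
    (hj : IsElementary v j) (hl : IsCritSup j l) (n : M) (hn : IsNat n) :
    ∃ d, IsLimit d ∧ d ∈ₘ lp ∧ ClosedUnder j d ∧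
      ∃ vd k f, IsRank d vd ∧ IsRestriction j vd k ∧ IsSigma1Elementary vd k ∧
        IsIterateSeq d k f ∧
        ∀ m km, (m ∈ₘ n ∨ m = n) → App f m km → ¬ IsSigma2Elementary vd km := by
  have : ZF M := ⟨hM⟩
  obtain ⟨rfl, K, h⟩ := exists_RR hlp hv hj hl
  obtain ⟨d, hd, hdl, hcl, k, f, hk, h1, hf, hno⟩ := exists_not_sigma2_iterates h (isNat_iff.1 hn)
  exact ⟨d, hd, hdl, hcl, Vr d, k, f, isRank_Vr hd.1, hk, h1, hf, hno⟩
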